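/- Let $n\ge 2$, $-1<a<1$, $\alpha>0$, and let $\ell$ be an integer with $\ell>\alpha$. On the unit sphere $S^n\subset\mathbb R^{n+1}$, with surface measure $dx$, let $\langle a,b\rangle_S=\{x\in S^n: a<x_{n+1}<b\}$ and let $\sigma_{n-1}=2\pi^{n/2}/\Gamma(n/2)$. For $\varphi:\langle a,1\rangle_S\to\mathbb C$ put $$(S^\alpha_{a+}\varphi)(x)=\frac{2}{\Gamma(\alpha)\,\sigma_{n-1}}\int_{\langle a,x_{n+1}\rangle_S}\frac{(x_{n+1}-y_{n+1})^\alpha}{|x-y|^n}\,\varphi(y)\,dy .$$ Write $x=(\theta,\xi')=(\sin\theta\,\xi',-\cos\theta)$ with $0<\theta<\pi$, $\xi'\in S^{n-1}$, for points of $S^n$ other than the poles, so that $t_x:=\tan^2(\theta/2)=\frac{1+x_{n+1}}{1-x_{n+1}}$. For a function $\psi$ on $S^{n-1}$ let $$(\Pi\psi)(\xi',r)=\frac1{\sigma_{n-1}}\int_{S^{n-1}}\frac{1-r^2}{|r\xi'-\eta'|^n}\,\psi(\eta')\,d\eta',\qquad 0\le r<1 .$$ For a function $f$ on $S^n$ put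 $(A_x^+f)(0)=(1+t_x)^{\alpha-n/2}f(x)$, $$(A_x^+f)(u)=\Big(1+\frac u{t_x}\Big)^{n/2-1}(1+t_x+u)^{\alpha-n/2}\;\Pi\big[f(2\arctan\sqrt{t_x+u},\,\cdot\,)\big]\Big(\xi',\Big(1+\frac u{t_x}\Big)^{1/2}\Big)\quad\text{if } -t_x<u<0,$$ and $(A_x^+f)(u)=0$ if $u\le -t_x$. With $(\Delta^\ell_\tau g)(u)=\sum_{j=0}^\ell\binom \ell j(-1)^jg(u-j\tau)$ and $\varkappa(\alpha,\ell)=\int_0^\infty(1-e^{-\tau})^\ell\,\tau^{-1-\alpha}\,d\tau$, define for $\varepsilon>0$ $$(T^\alpha_{+,\varepsilon}f)(x)=\frac{2^{-\alpha}}{\varkappa(\alpha,\ell)}\,(1+t_x)^{\alpha+n/2}\int_\varepsilon^\infty\frac{(\Delta^\ell_\tau A_x^+f)(0)}{\tau^{1+\alpha}}\,d\tau,\qquad T^\alpha_{a+,\varepsilon}=P_{a+}T^\alpha_{+,\varepsilon}\Lambda_{a-},$$ where $\Lambda_{a-}$ extends functions on $\langle a,1\rangle_S$ by zero to $S^n$,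 and $P_{a+}$ restricts functions on $S^n$ to $\langle a,1\rangle_S$. Let $1<p\le\infty$, $1/p+1/p'=1$, $\nu<n/(2p')$, and let $\varphi\in L^p(\langle a,1\rangle_S;(1-x_{n+1})^\nu)$, that is, $(1-x_{n+1})^\nu\varphi\in L^p(\langle a,1\rangle_S)$. Then $(S^\alpha_{a+}\varphi)(x)$ exists as a Lebesgue integral for almost all $x\in\langle a,1\rangle_S$; with $f=\Lambda_{a-}S^\alpha_{a+}\varphi$, the function $f(2\arctan r,\,\cdot\,)$ is integrable on $S^{n-1}$ for almost all $r>0$ (so that its Poisson integrals exist); for almost all $x\in\langle a,1\rangle_S$ the integral defining $(T^\alpha_{+,\varepsilon}f)(x)$ exists as a Lebesgue integral for every $\varepsilon>0$; and $$\lim_{\varepsilon\to0+}(T^\alpha_{a+,\varepsilon}S^\alpha_{a+}\varphi)(x)=\varphi(x)\qquad\text{for almost all }x\in\langle a,1\rangle_S .$$ -/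

import Mathlib

open MeasureTheory Filter Topology
open scoped ENNReal

noncomputable section

namespace SphFrac

/-- `Sph d` is the unit sphere of `ℝ^d`; thus `S^n` is `Sph (n + 1)` and `S^{n-1}` is `Sph n`. -/
abbrev Sph (d : ℕ) : Type := Metric.sphere (0 : EuclideanSpace ℝ (Fin d)) 1

/-- The surface area measure on the unit sphere of `ℝ^d`. -/
def surf (d : ℕ) : Measure (Sph d) :=
  (volume : Measure (EuclideanSpace ℝ (Fin d))).toSphere

/-- The surface area `2 π^{n/2} / Γ(n/2)` of `S^{n-1}`. -/
def sigma (n : ℕ) : ℝ := 2 * Real.pi ^ ((n : ℝ) / 2) / Real.Gamma ((n : ℝ) / 2)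

/-- The last coordinate `x_{n+1}` of a point of `S^n`. -/
def height {n : ℕ} (x : Sph (n + 1)) : ℝ := x.1 (Fin.last n)

/-- The vector `(x_1, …, x_n)` of the first `n` coordinates of a point of `S^n`. -/
def horiz {n : ℕ} (x : Sph (n + 1)) : EuclideanSpace ℝ (Fin n) :=
  WithLp.toLp 2 (fun i : Fin n => x.1 i.castSucc)

/-- The spherical segment `⟨a, b⟩_S = {x ∈ S^n : a < x_{n+1} < b}`. -/
def seg (n : ℕ) (a b : ℝ) : Set (Sph (n + 1)) := {x | a < height x ∧ height x < b}

/-- The polar angle `θ ∈ [0, π]` measured from the south pole, so `x_{n+1} = - cos θ`. -/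
def theta {n : ℕ} (x : Sph (n + 1)) : ℝ := Real.arccos (-height x)

/-- The direction `ξ' ∈ S^{n-1}` of a point `x = (θ, ξ')` of `S^n` other than the poles
(the value is `0` at the poles). -/
def dir {n : ℕ} (x : Sph (n + 1)) : EuclideanSpace ℝ (Fin n) := ‖horiz x‖⁻¹ • horiz x

/-- The coordinates of `(sin θ η, - cos θ)`. -/
def polarVec {n : ℕ} (θ : ℝ) (η : Sph n) : EuclideanSpace ℝ (Fin (n + 1)) :=
  WithLp.toLp 2 (Fin.snoc (α := fun _ => ℝ) (fun i : Fin n => Real.sin θ * η.1 i) (-Real.cos θ))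

theorem norm_polarVec {n : ℕ} (θ : ℝ) (η : Sph n) : ‖polarVec θ η‖ = 1 := by
  have h : ‖η.1‖ = 1 := by simpa using η.2
  have h2 : ∑ i, η.1 i ^ 2 = 1 := by
    have := EuclideanSpace.real_norm_sq_eq η.1
    rw [h] at this
    linarith
  have h3 : ‖polarVec θ η‖ ^ 2 = 1 := by
    rw [EuclideanSpace.real_norm_sq_eq, Fin.sum_univ_castSucc]
    simp only [polarVec, Fin.snoc_castSucc, Fin.snoc_last, mul_pow]
    rw [← Finset.mul_sum, h2, mul_one, neg_sq, Real.sin_sq_add_cos_sq]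
  exact (pow_eq_one_iff_of_nonneg (norm_nonneg _) two_ne_zero).1 h3

/-- The point of `S^n` with polar coordinates `(θ, η)`. -/
def polar {n : ℕ} (θ : ℝ) (η : Sph n) : Sph (n + 1) :=
  ⟨polarVec θ η, by simp [norm_polarVec]⟩

/-- The Poisson integral `(Π ψ)(ξ', r)` of a function `ψ` on `S^{n-1}`. -/
def poisson {n : ℕ} (ψ : Sph n → ℂ) (ξ : EuclideanSpace ℝ (Fin n)) (r : ℝ) : ℂ :=
  (1 / sigma n : ℝ) • ∫ η, ((1 - r ^ 2) / ‖r • ξ - η.1‖ ^ n : ℝ) • ψ η ∂(surf n)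

/-- The integrand `y ↦ (x_{n+1} - y_{n+1})^α |x - y|^{-n} φ(y)`. -/
def fracIntegrand {n : ℕ} (α : ℝ) (φ : Sph (n + 1) → ℂ) (x y : Sph (n + 1)) : ℂ :=
  ((height x - height y) ^ α / ‖x.1 - y.1‖ ^ n : ℝ) • φ y

/-- The left-sided spherical fractional integral `S^α_{a+} φ`; it involves only the values of `φ`
on the part of the sphere above the height `a`. -/
def sphFrac {n : ℕ} (α a : ℝ) (φ : Sph (n + 1) → ℂ) (x : Sph (n + 1)) : ℂ :=
  (2 / (Real.Gamma α * sigma n) : ℝ) •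
    ∫ y in seg n a (height x), fracIntegrand α φ x y ∂(surf (n + 1))

/-- The finite difference `(Δ^ℓ_τ g)(u) = ∑_{j=0}^ℓ (-1)^j binom(ℓ, j) g(u - j τ)`. -/
def findiff (l : ℕ) (τ : ℝ) (g : ℝ → ℂ) (u : ℝ) : ℂ :=
  ∑ j ∈ Finset.range (l + 1), ((-1) ^ j * (l.choose j : ℂ)) * g (u - j * τ)

/-- The normalizing constant `ϰ(α, ℓ) = ∫_0^∞ (1 - e^{-τ})^ℓ τ^{-1-α} dτ`. -/
def kappa (α : ℝ) (l : ℕ) : ℝ :=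
  ∫ τ in Set.Ioi (0 : ℝ), (1 - Real.exp (-τ)) ^ l / τ ^ (1 + α)

/-- The quantity `tan²(θ/2)` for `x = (θ, ξ')`. -/
def tsq {n : ℕ} (x : Sph (n + 1)) : ℝ := Real.tan (theta x / 2) ^ 2

/-- The function `A_x^+ f` on `(-∞, 0]`. It vanishes for `u ≤ - tan²(θ/2)`, because of the factor
`(1 + u / tan²(θ/2))_+^{n/2-1}`; the values at `u > 0` are immaterial. -/
def Aplus {n : ℕ} (α : ℝ) (f : Sph (n + 1) → ℂ) (x : Sph (n + 1)) (u : ℝ) : ℂ :=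
  if u = 0 then ((1 + tsq x) ^ (α - (n : ℝ) / 2) : ℝ) • f x
  else if -tsq x < u ∧ u < 0 then
    ((1 + u / tsq x) ^ ((n : ℝ) / 2 - 1) * (1 + tsq x + u) ^ (α - (n : ℝ) / 2) : ℝ) •
      poisson (fun η => f (polar (2 * Real.arctan (√(tsq x + u))) η)) (dir x)
        (√(1 + u / tsq x))
  else 0

/-- The integrand `τ ↦ (Δ^ℓ_τ A_x^+ f)(0) / τ^{1+α}`. -/
def marchaudIntegrand {n : ℕ} (α : ℝ) (l : ℕ) (f : Sph (n + 1) → ℂ) (x : Sph (n + 1))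
    (τ : ℝ) : ℂ :=
  (1 / τ ^ (1 + α) : ℝ) • findiff l τ (Aplus α f x) 0

/-- The truncated hypersingular integral `T^α_{+,ε} f`. -/
def Tplus {n : ℕ} (α : ℝ) (l : ℕ) (ε : ℝ) (f : Sph (n + 1) → ℂ) (x : Sph (n + 1)) : ℂ :=
  ((2 : ℝ) ^ (-α) / kappa α l * (1 + tsq x) ^ (α + (n : ℝ) / 2) : ℝ) •
    ∫ τ in Set.Ioi ε, marchaudIntegrand α l f x τ

/-- `Λ_{a-}`: the extension by zero to `S^n` of a function given on the cap `⟨a, 1⟩_S`.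
Functions on the cap are represented by functions on `S^n` whose values off the cap are
disregarded. -/
def zeroExt {n : ℕ} (a : ℝ) (f : Sph (n + 1) → ℂ) : Sph (n + 1) → ℂ :=
  (seg n a 1).indicator f

/-- `P_{a+}`: the restriction of a function on `S^n` to the cap `⟨a, 1⟩_S`; in the representation
of functions on the cap by functions on `S^n`, the values off the cap are discarded. -/
def restr {n : ℕ} (a : ℝ) (f : Sph (n + 1) → ℂ) : Sph (n + 1) → ℂ :=
  (seg n a 1).indicator f

/-- `T^α_{a+,ε} f = P_{a+} T^α_{+,ε} Λ_{a-} f`. -/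
def TaPlus {n : ℕ} (α : ℝ) (l : ℕ) (a ε : ℝ) (f : Sph (n + 1) → ℂ) : Sph (n + 1) → ℂ :=
  restr a (Tplus α l ε (zeroExt a f))

/-- The surface measure on the cap `⟨a, 1⟩_S`. -/
def capMeasure (n : ℕ) (a : ℝ) : Measure (Sph (n + 1)) := (surf (n + 1)).restrict (seg n a 1)

end SphFrac

end

noncomputable section

namespace SphFrac

/-! Describe a point of the sphere by `(s, η)` with `s = tan²(θ/2)`. In these coordinates the kernel
of `S^α_{a+}`, multiplied by the surface density, splits into a factor in the outer variable `t`, a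
factor in `s`, and the product of `(t - s)_+^(α-1)` with the Poisson kernel of radius `√(s/t)`
(`density_mul_kernel`). Putting the factor in `s` into a new function `g` (`pullback`), the operator
becomes, up to `potentialFactor`, the potential `∫ (t - s)_+^(α-1) Π[g(s,·)](ξ, √(s/t)) ds`.

The Poisson kernels form a multiplicative semigroup (`integral_pker_mul_pker`), and `√(w/t) √(s/w) =
√(s/t)`. A Poisson integral of radius `√(w/t)` of the potential at level `w` is therefore the same
potential with its power cut off at `w` and its radii still referred to `t` (`pint_potential`). With
`(t, ξ)` fixed and `w = t - u`, this says that `A_x^+ f(-u)` is a constant times the one-dimensional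
fractional integral `∫ (y - u)_+^(α-1) G(y) dy` of one function `G(y) = Π[g(t - y,·)](ξ, √((t -
y)/t))` (`profile`), for `u = 0` and for almost every `u > 0`.

The truncated Marchaud integral of such a function is, by Fubini, an average of `G` against a kernel
rescaled by `ε` (`marchaud_sum`). Taking more than `α` differences makes the kernel integrable
(`exists_abs_mker_le`), and testing on `e^{-y}` gives its integral (`integral_mker`). The averages
thus converge to a constant times `g(t, ξ)` whenever `0` is a right Lebesgue point of `G` with value
`g(t, ξ)` (`tendsto_integral_mker`), and the constants cancel.

What remains is that this Lebesgue point property holds for almost all `(t, ξ)`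
(`ae_tendsto_average_profile`). As `y` tends to `0`, both the slice `t - y` and the radius move. The
difference `G(y) - g(t, ξ)` is split into `g(t - y, ξ) - g(t, ξ)`, treated by Lebesgue's theorem in
`t`, and the deviation of a Poisson integral from its boundary value. The latter is bounded by an
oscillation `osc` over radii close to `1`, again treated by Lebesgue's theorem in `t`; the
oscillation at `(t, ξ)` itself is small by almost everywhere convergence of Poisson integrals
(`ae_tendsto_pint`). Local integrability of the oscillation, and all absolute convergence needed for
Fubini, come from the maximal function `capMax`, which dominates Poisson integrals and is integrable
because `g` is locally in `L^q` for some `q > 1` (`exists_lintegral_capMax_le`). -/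

/-! ### Polar coordinates in Euclidean space and the size of spherical caps. -/

/-- The measure `ρ ^ (n - 1) dρ` on the positive half-line. -/
def radial (n : ℕ) : Measure ℝ :=
  (volume.restrict (Set.Ioi 0)).withDensity fun ρ => ENNReal.ofReal (ρ ^ (n - 1))

instance (n : ℕ) : SFinite (radial n) := by unfold radial; infer_instance

instance (d : ℕ) : IsFiniteMeasure (surf d) := by unfold surf; infer_instance

theorem map_val_volumeIoiPow (n : ℕ) :
    (Measure.volumeIoiPow (n - 1)).map Subtype.val = radial n := by
  have hemb : MeasurableEmbedding (Subtype.val : Set.Ioi (0 : ℝ) → ℝ) :=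
    MeasurableEmbedding.subtype_coe measurableSet_Ioi
  ext s hs
  rw [hemb.map_apply, Measure.volumeIoiPow, withDensity_apply _ (hemb.measurable hs), radial,
    withDensity_apply _ hs, ← map_comap_subtype_coe measurableSet_Ioi, hemb.restrict_map,
    hemb.lintegral_map]

/-- Polar coordinates in `ℝ^n`. -/
theorem map_polar {n : ℕ} (hn : 0 < n) :
    ((surf n).prod (radial n)).map (fun p => p.2 • p.1.1) =
      (volume : Measure (EuclideanSpace ℝ (Fin n))) := by
  have : Nonempty (Fin n) := ⟨⟨0, hn⟩⟩
  have h := (Measure.measurePreserving_homeomorphUnitSphereProd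
    (volume : Measure (EuclideanSpace ℝ (Fin n))))
  have h2 := (h.symm (homeomorphUnitSphereProd (EuclideanSpace ℝ (Fin n))).toMeasurableEquiv).map_eq
  rw [finrank_euclideanSpace_fin] at h2
  have hval : MeasurableEmbedding (Subtype.val : ({0}ᶜ : Set (EuclideanSpace ℝ (Fin n))) → _) :=
    MeasurableEmbedding.subtype_coe (measurableSet_singleton _).compl
  have h3 := congrArg (Measure.map Subtype.val) h2
  rw [hval.map_comap, Subtype.range_coe, restrict_compl_singleton,
    Measure.map_map hval.measurable (MeasurableEquiv.measurable _)] at h3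
  rw [← map_val_volumeIoiPow, ← Measure.map_id (μ := surf n),
    Measure.map_prod_map _ _ measurable_id measurable_subtype_coe, Measure.map_map]
  · rw [← h3]
    rfl
  · fun_prop
  · fun_prop

theorem lintegral_polar {n : ℕ} (hn : 0 < n) {F : EuclideanSpace ℝ (Fin n) → ℝ≥0∞}
    (hF : Measurable F) :
    ∫⁻ x, F x = ∫⁻ ρ in Set.Ioi (0 : ℝ), ENNReal.ofReal (ρ ^ (n - 1)) *
      ∫⁻ ζ, F (ρ • ζ.1) ∂(surf n) := by
  rw [← map_polar hn, lintegral_map hF (by fun_prop), lintegral_prod_symm _ (by fun_prop), radial,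
    lintegral_withDensity_eq_lintegral_mul _ (by fun_prop)]
  · rfl
  · exact Measurable.lintegral_prod_left' (f := fun p : Sph n × ℝ => F (p.2 • p.1.1)) (by fun_prop)

theorem integral_polar {n : ℕ} (hn : 0 < n) {F : EuclideanSpace ℝ (Fin n) → ℝ}
    (hF : Integrable F) :
    ∫ x, F x = ∫ ρ in Set.Ioi (0 : ℝ), ρ ^ (n - 1) * ∫ ζ, F (ρ • ζ.1) ∂(surf n) := by
  have hm : Measurable (fun p : Sph n × ℝ => p.2 • p.1.1) := by fun_prop
  have hF' : Integrable F (((surf n).prod (radial n)).map (fun p => p.2 • p.1.1)) := by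
    rwa [map_polar hn]
  have hF2 := hF'.comp_measurable hm
  conv_lhs => rw [← map_polar hn]
  rw [integral_map hm.aemeasurable hF'.aestronglyMeasurable]
  rw [integral_prod_symm (fun p : Sph n × ℝ => F (p.2 • p.1.1)) hF2, radial, integral_withDensity_eq_integral_toReal_smul (by fun_prop)
    (by simp)]
  refine setIntegral_congr_fun measurableSet_Ioi fun ρ hρ => ?_
  simp only [smul_eq_mul]
  rw [ENNReal.toReal_ofReal (pow_nonneg (le_of_lt hρ) _)]

theorem surf_univ {n : ℕ} (hn : 0 < n) : surf n Set.univ = ENNReal.ofReal (sigma n) := by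
  have : Nonempty (Fin n) := ⟨⟨0, hn⟩⟩
  rw [surf, Measure.toSphere_apply_univ, EuclideanSpace.volume_ball, finrank_euclideanSpace_fin,
    Fintype.card_fin, ENNReal.ofReal_one, one_pow, one_mul, ← ENNReal.ofReal_natCast,
    ← ENNReal.ofReal_mul (by positivity)]
  congr 1
  have h0 : (0 : ℝ) < n := by exact_mod_cast hn
  have hG := Real.Gamma_pos_of_pos (s := (n : ℝ) / 2) (by positivity)
  have hp : √Real.pi ^ n = Real.pi ^ ((n : ℝ) / 2) := by
    rw [Real.sqrt_eq_rpow, ← Real.rpow_natCast, ← Real.rpow_mul Real.pi_pos.le]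
    congr 1
    ring
  rw [hp, Real.Gamma_add_one (by positivity), sigma]
  field_simp

theorem sigma_pos {n : ℕ} (hn : 0 < n) : 0 < sigma n := by
  have : (0 : ℝ) < n := by exact_mod_cast hn
  unfold sigma
  have := Real.Gamma_pos_of_pos (s := (n : ℝ) / 2) (by positivity)
  positivity

/-- The truncated cone over the cap, with radii in `(1 - δ, 1)`, lies in the ball of radius `2δ`
about `ξ`. Since these radii are at least `1/2`, polar coordinates bound its volume below by `δ
2^{1-n}` times the measure of the cap, while the ball has volume of order `δ^n`. -/
theorem surf_closedBall_le_of_le_half {n : ℕ} (hn : 0 < n) (ξ : Sph n) {δ : ℝ} (hδ : 0 < δ)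
    (hδ' : δ ≤ 1 / 2) :
    surf n (Metric.closedBall ξ δ) ≤ ENNReal.ofReal
      (4 ^ n * volume.real (Metric.ball (0 : EuclideanSpace ℝ (Fin n)) 1) * δ ^ (n - 1)) := by
  have : Nonempty (Fin n) := ⟨⟨0, hn⟩⟩
  set v := volume.real (Metric.ball (0 : EuclideanSpace ℝ (Fin n)) 1)
  have hv : volume (Metric.ball (0 : EuclideanSpace ℝ (Fin n)) 1) = ENNReal.ofReal v :=
    (ofReal_measureReal measure_ball_lt_top.ne).symm
  have hvol : volume (Metric.closedBall ξ.1 (2 * δ)) = ENNReal.ofReal ((2 * δ) ^ n * v) := by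
    rw [Measure.addHaar_closedBall _ _ (by positivity), hv, finrank_euclideanSpace_fin,
      ENNReal.ofReal_mul (by positivity)]
  have hmeas : MeasurableSet (Metric.closedBall ξ.1 (2 * δ)) := Metric.isClosed_closedBall.measurableSet
  have hξ : ‖ξ.1‖ = 1 := by simp
  have key : ENNReal.ofReal (δ * (1 / 2) ^ (n - 1)) * surf n (Metric.closedBall ξ δ) ≤
      ENNReal.ofReal ((2 * δ) ^ n * v) := by
    rw [← hvol, ← lintegral_indicator_one hmeas,
      lintegral_polar hn (measurable_one.indicator hmeas)]
    calc ENNReal.ofReal (δ * (1 / 2) ^ (n - 1)) * surf n (Metric.closedBall ξ δ)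
        = ∫⁻ ρ in Set.Ioo (1 - δ) 1, ENNReal.ofReal ((1 / 2) ^ (n - 1)) *
            surf n (Metric.closedBall ξ δ) := by
          rw [setLIntegral_const, Real.volume_Ioo, mul_comm δ, ENNReal.ofReal_mul (by positivity)]
          ring_nf
      _ ≤ ∫⁻ ρ in Set.Ioo (1 - δ) 1, ENNReal.ofReal (ρ ^ (n - 1)) *
            ∫⁻ ζ, (Metric.closedBall ξ.1 (2 * δ)).indicator 1 (ρ • ζ.1) ∂(surf n) := by
          refine setLIntegral_mono' measurableSet_Ioo fun ρ hρ => ?_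
          gcongr
          · linarith [hρ.1]
          · rw [← lintegral_indicator_one Metric.isClosed_closedBall.measurableSet]
            refine lintegral_mono fun ζ => ?_
            by_cases hζ : ζ ∈ Metric.closedBall ξ δ
            · rw [Set.indicator_of_mem hζ, Set.indicator_of_mem]
              · exact le_rfl
              rw [Metric.mem_closedBall, Subtype.dist_eq] at hζ
              rw [Metric.mem_closedBall]
              have h1 : dist (ρ • ζ.1) ζ.1 = 1 - ρ := by
                rw [dist_eq_norm, show ρ • ζ.1 - ζ.1 = (ρ - 1) • ζ.1 by rw [sub_smul, one_smul],
                  norm_smul, norm_eq_of_mem_sphere, mul_one, Real.norm_eq_abs, abs_sub_comm,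
                  abs_of_pos (by linarith [hρ.2])]
              linarith [dist_triangle (ρ • ζ.1) ζ.1 ξ.1, hρ.1]
            · rw [Set.indicator_of_notMem hζ]
              exact zero_le
      _ ≤ _ := lintegral_mono_set fun ρ hρ => by
          simp only [Set.mem_Ioi]
          linarith [hρ.1]
  have hpos : 0 < δ * (1 / 2) ^ (n - 1) := by positivity
  rw [mul_comm, ← ENNReal.le_div_iff_mul_le (.inl (by simpa using hpos)) (by simp),
    ← ENNReal.ofReal_div_of_pos hpos] at key
  refine key.trans (ENNReal.ofReal_le_ofReal ?_)
  rw [div_le_iff₀ hpos]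
  obtain ⟨k, rfl⟩ : ∃ k, n = k + 1 := ⟨n - 1, by omega⟩
  have h4 : (4 : ℝ) ^ (k + 1) * (1 / 2) ^ k = 2 * 2 ^ (k + 1) := by
    rw [show (4 : ℝ) = 2 * 2 by norm_num, mul_pow, one_div, inv_pow, pow_succ]
    field_simp
  have hv0 : 0 ≤ v := measureReal_nonneg
  have h5 : 0 ≤ (2 * δ) ^ (k + 1) * v := by positivity
  calc (2 * δ) ^ (k + 1) * v ≤ 2 * ((2 * δ) ^ (k + 1) * v) := by linarith
    _ = (4 ^ (k + 1) * (1 / 2) ^ k) * v * δ ^ k * δ := by rw [h4]; ring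
    _ = _ := by rw [Nat.add_sub_cancel]; ring

/-- Spherical caps of radius `δ` have measure `O(δ ^ (n - 1))`. -/
theorem exists_surf_closedBall_le {n : ℕ} (hn : 0 < n) :
    ∃ A : ℝ, 0 < A ∧ ∀ (ξ : Sph n) (δ : ℝ), 0 < δ →
      surf n (Metric.closedBall ξ δ) ≤ ENNReal.ofReal (A * δ ^ (n - 1)) := by
  set v := volume.real (Metric.ball (0 : EuclideanSpace ℝ (Fin n)) 1)
  have hv : 0 ≤ v := measureReal_nonneg
  have hσ := sigma_pos hn
  refine ⟨4 ^ n * v + sigma n * 2 ^ (n - 1), by positivity, fun ξ δ hδ => ?_⟩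
  rcases le_total δ (1 / 2) with h | h
  · refine (surf_closedBall_le_of_le_half hn ξ hδ h).trans (ENNReal.ofReal_le_ofReal ?_)
    gcongr
    exact le_add_of_nonneg_right (by positivity)
  · refine (measure_mono (Set.subset_univ _)).trans ?_
    rw [surf_univ hn]
    refine ENNReal.ofReal_le_ofReal ?_
    have h1 : 1 ≤ 2 ^ (n - 1) * δ ^ (n - 1) := by
      rw [← mul_pow]
      exact one_le_pow₀ (by linarith)
    calc sigma n ≤ sigma n * (2 ^ (n - 1) * δ ^ (n - 1)) := le_mul_of_one_le_right hσ.le h1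
      _ ≤ _ := by
        rw [add_mul, mul_assoc (sigma n)]
        exact le_add_of_nonneg_left (by positivity)

/-! ### Harmonic functions on balls and Green's identity on spheres. -/

/-- `u` is a harmonic function on the ball of radius `R` with continuous gradient `g` whose
components have the pure second derivatives `H i`. -/
structure IsHarmonicOnBall {n : ℕ} (R : ℝ) (u : EuclideanSpace ℝ (Fin n) → ℝ)
    (g : EuclideanSpace ℝ (Fin n) → EuclideanSpace ℝ (Fin n))
    (H : Fin n → EuclideanSpace ℝ (Fin n) → ℝ) : Prop where
  hasFDerivAt : ∀ x, ‖x‖ < R → HasFDerivAt u (innerSL ℝ (g x)) x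
  hasLineDerivAt : ∀ x, ‖x‖ < R → ∀ i,
    HasLineDerivAt ℝ (fun y => g y i) (H i x) x (EuclideanSpace.single i 1)
  continuousOn_grad : ContinuousOn g (Metric.ball 0 R)
  continuousOn_second : ∀ i, ContinuousOn (H i) (Metric.ball 0 R)
  sum_eq_zero : ∀ x, ‖x‖ < R → ∑ i, H i x = 0

theorem IsHarmonicOnBall.continuousOn {n : ℕ} {R : ℝ} {u : EuclideanSpace ℝ (Fin n) → ℝ} {g H}
    (h : IsHarmonicOnBall R u g H) : ContinuousOn u (Metric.ball 0 R) := fun x hx =>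
  (h.hasFDerivAt x (by simpa using hx)).continuousAt.continuousWithinAt

theorem isHarmonicOnBall_one {n : ℕ} (R : ℝ) :
    IsHarmonicOnBall (n := n) R (fun _ => 1) (fun _ => 0) (fun _ _ => 0) where
  hasFDerivAt x _ := by simpa using hasFDerivAt_const (1 : ℝ) x
  hasLineDerivAt x _ i := by
    simpa [HasLineDerivAt] using hasDerivAt_const (0 : ℝ) (0 : ℝ)
  continuousOn_grad := continuousOn_const
  continuousOn_second _ := continuousOn_const
  sum_eq_zero _ _ := by simp

/-- Needed to apply Green's identity on the unit sphere to two different dilates: for `a < 1` a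
function harmonic on the unit ball becomes harmonic on a ball of radius greater than `1`. -/
theorem IsHarmonicOnBall.comp_smul {n : ℕ} {R a : ℝ} {u : EuclideanSpace ℝ (Fin n) → ℝ} {g H}
    (h : IsHarmonicOnBall R u g H) (ha : 0 < a) :
    IsHarmonicOnBall (R / a) (fun x => u (a • x)) (fun x => a • g (a • x))
      (fun i x => a ^ 2 * H i (a • x)) := by
  have hn : ∀ x : EuclideanSpace ℝ (Fin n), ‖x‖ < R / a → ‖a • x‖ < R := fun x hx => by
    rw [norm_smul, Real.norm_eq_abs, abs_of_pos ha, mul_comm]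
    exact (lt_div_iff₀ ha).1 hx
  have hmaps : Set.MapsTo (fun x : EuclideanSpace ℝ (Fin n) => a • x) (Metric.ball 0 (R / a))
      (Metric.ball 0 R) := fun x hx => by simpa using hn x (by simpa using hx)
  refine ⟨fun x hx => ?_, fun x hx i => ?_, ?_, fun i => ?_, fun x hx => ?_⟩
  · have h1 := (h.hasFDerivAt _ (hn x hx)).comp x ((hasFDerivAt_id x).const_smul a)
    refine h1.congr_fderiv ?_
    ext v
    simp
  · have h1 := h.hasLineDerivAt _ (hn x hx) i
    have h2 : HasDerivAt (fun t : ℝ => g (a • x + t • EuclideanSpace.single i 1) i)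
      (H i (a • x)) (a * 0) := by simpa [HasLineDerivAt] using h1
    have h3 := (h2.scomp (0 : ℝ) ((hasDerivAt_id (0 : ℝ)).const_mul a)).const_mul a
    refine (h3.congr_deriv ?_).congr_of_eventuallyEq (Eventually.of_forall fun t => ?_)
    · simp; ring
    · simp [smul_smul]
  · exact (h.continuousOn_grad.comp (by fun_prop) hmaps).const_smul a
  · exact ((h.continuousOn_second i).comp (by fun_prop) hmaps).const_smul (a ^ 2)
  · rw [← Finset.mul_sum, h.sum_eq_zero _ (hn x hx), mul_zero]

/-- The divergence theorem for the compactly supported field `χ (v ∇u - u ∇v)`. -/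
theorem integral_inner_cutoff_eq_zero {n : ℕ} {R : ℝ} {u v : EuclideanSpace ℝ (Fin n) → ℝ}
    {g g' H H'} (hu : IsHarmonicOnBall R u g H) (hv : IsHarmonicOnBall R v g' H')
    {χ : EuclideanSpace ℝ (Fin n) → ℝ} {χ' : EuclideanSpace ℝ (Fin n) → EuclideanSpace ℝ (Fin n)}
    (hχ : ∀ x, HasFDerivAt χ (innerSL ℝ (χ' x)) x) (hχ' : Continuous χ')
    (hs : HasCompactSupport χ) (hsR : tsupport χ ⊆ Metric.ball 0 R) :
    ∫ x, inner ℝ (χ' x) (v x • g x - u x • g' x) = 0 := by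
  have hc : ∀ {f : EuclideanSpace ℝ (Fin n) → ℝ}, ContinuousOn f (Metric.ball 0 R) →
      ∀ {θ : EuclideanSpace ℝ (Fin n) → ℝ}, Continuous θ → tsupport θ ⊆ tsupport χ →
      Integrable (fun x => θ x * f x) := by
    intro f hf θ hθ hsub
    refine Continuous.integrable_of_hasCompactSupport ?_ ?_
    · refine continuous_of_tsupport fun x hx => ?_
      have hx' : x ∈ tsupport θ := tsupport_mul_subset_left hx
      exact hθ.continuousAt.mul (hf.continuousAt (Metric.isOpen_ball.mem_nhds (hsR (hsub hx'))))
    · exact HasCompactSupport.mul_right (hs.of_isClosed_subset (isClosed_tsupport _) hsub)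
  have hcont : Continuous χ := continuous_iff_continuousAt.2 fun x => (hχ x).continuousAt
  have hfd : ∀ x, fderiv ℝ χ x = innerSL ℝ (χ' x) := fun x => (hχ x).fderiv
  have hsub : ∀ i, tsupport (fun x => χ' x i) ⊆ tsupport χ := fun i => by
    refine (closure_mono ?_).trans (tsupport_fderiv_subset ℝ (f := χ))
    intro x hx h0
    apply hx
    rw [hfd] at h0
    have := congrArg (fun L : EuclideanSpace ℝ (Fin n) →L[ℝ] ℝ => L (EuclideanSpace.single i 1)) h0
    simpa [EuclideanSpace.inner_single_right] using this
  have hmem : ∀ x ∈ tsupport χ, ‖x‖ < R := fun x hx => by simpa using hsR hx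
  have hgi : ∀ i, ContinuousOn (fun x => g x i) (Metric.ball 0 R) := fun i =>
    (PiLp.continuous_apply 2 _ i).comp_continuousOn hu.continuousOn_grad
  have hgi' : ∀ i, ContinuousOn (fun x => g' x i) (Metric.ball 0 R) := fun i =>
    (PiLp.continuous_apply 2 _ i).comp_continuousOn hv.continuousOn_grad
  -- Integration by parts in the `i`-th direction. In the derivative of `v g_i - u g'_i` the
  -- products of first derivatives cancel for each `i` separately, leaving only pure second
  -- derivatives.
  have key : ∀ i, ∫ x, χ' x i * (v x * g x i - u x * g' x i) =
      - ∫ x, χ x * (v x * H i x - u x * H' i x) := by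
    intro i
    have hcW : ContinuousOn (fun x => v x * g x i - u x * g' x i) (Metric.ball 0 R) :=
      (hv.continuousOn.mul (hgi i)).sub (hu.continuousOn.mul (hgi' i))
    have hcW' : ContinuousOn (fun x => v x * H i x - u x * H' i x) (Metric.ball 0 R) :=
      (hv.continuousOn.mul (hu.continuousOn_second i)).sub
        (hu.continuousOn.mul (hv.continuousOn_second i))
    have := integral_bilinear_hasLineDerivAt_right_eq_neg_left_of_integrable
      (μ := (volume : Measure (EuclideanSpace ℝ (Fin n)))) (f := χ) (f' := fun x => χ' x i)
      (g := fun x => v x * g x i - u x * g' x i)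
      (g' := fun x => v x * H i x - u x * H' i x) (v := EuclideanSpace.single i 1)
      (B := ContinuousLinearMap.mul ℝ ℝ) (by simpa using hc hcW (by fun_prop) (hsub i))
      (by simpa using hc hcW' hcont le_rfl) (by simpa using hc hcW hcont le_rfl)
      (fun x _ => by simpa [EuclideanSpace.inner_single_right] using (hχ x).hasLineDerivAt (EuclideanSpace.single i 1))
      (fun x hx => ?_)
    · simp only [ContinuousLinearMap.mul_apply'] at this
      linarith
    · have h1 := hu.hasLineDerivAt x (hmem x hx) i
      have h2 := hv.hasLineDerivAt x (hmem x hx) i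
      have h3 := (hu.hasFDerivAt x (hmem x hx)).hasLineDerivAt (EuclideanSpace.single i 1)
      have h4 := (hv.hasFDerivAt x (hmem x hx)).hasLineDerivAt (EuclideanSpace.single i 1)
      unfold HasLineDerivAt at h1 h2 h3 h4 ⊢
      refine ((h4.mul h1).sub (h3.mul h2)).congr_deriv ?_
      simp [EuclideanSpace.inner_single_right]
      ring
  have h1 : ∀ x, inner ℝ (χ' x) (v x • g x - u x • g' x) =
      ∑ i, χ' x i * (v x * g x i - u x * g' x i) := fun x => by
    simp [PiLp.inner_apply, mul_comm]
  simp_rw [h1]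
  rw [integral_finsetSum]
  · simp_rw [key]
    rw [Finset.sum_neg_distrib, ← integral_finsetSum, neg_eq_zero]
    · refine integral_eq_zero_of_ae (Eventually.of_forall fun x => ?_)
      by_cases hx : x ∈ tsupport χ
      · simp only [Pi.zero_apply]
        rw [← Finset.mul_sum, Finset.sum_sub_distrib, ← Finset.mul_sum, ← Finset.mul_sum,
          hu.sum_eq_zero x (hmem x hx), hv.sum_eq_zero x (hmem x hx)]
        simp
      · simp [image_eq_zero_of_notMem_tsupport hx]
    · intro i _
      exact hc ((hv.continuousOn.mul (hu.continuousOn_second i)).sub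
        (hu.continuousOn.mul (hv.continuousOn_second i))) hcont le_rfl
  · intro i _
    exact hc ((hv.continuousOn.mul (hgi i)).sub (hu.continuousOn.mul (hgi' i))) (by fun_prop)
      (hsub i)

theorem hasFDerivAt_comp_norm_sq {n : ℕ} {χ : ℝ → ℝ} {c : ℝ} (x : EuclideanSpace ℝ (Fin n))
    (h : HasDerivAt χ c (‖x‖ ^ 2)) :
    HasFDerivAt (fun y : EuclideanSpace ℝ (Fin n) => χ (‖y‖ ^ 2)) (innerSL ℝ ((2 * c) • x)) x := by
  have h1 := (hasStrictFDerivAt_norm_sq x).hasFDerivAt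
  refine (h.comp_hasFDerivAt x h1).congr_fderiv ?_
  ext v
  simp
  ring

/-- The primitive of `ψ` that vanishes beyond `c²` gives a radial cutoff with gradient `2 ψ(‖x‖²)
x`. An arbitrary radial test function can thus be placed in front of the radial flux. -/
theorem integral_comp_norm_sq_mul_inner_eq_zero {n : ℕ} {R : ℝ}
    {u v : EuclideanSpace ℝ (Fin n) → ℝ} {g g' H H'} (hu : IsHarmonicOnBall R u g H)
    (hv : IsHarmonicOnBall R v g' H') {ψ : ℝ → ℝ} (hψ : Continuous ψ) {c : ℝ} (hc : 0 ≤ c)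
    (hcR : c < R) (hψc : ∀ s, c ^ 2 ≤ s → ψ s = 0) :
    ∫ x, ψ (‖x‖ ^ 2) * inner ℝ x (v x • g x - u x • g' x) = 0 := by
  set χ : ℝ → ℝ := fun s => ∫ τ in (c ^ 2)..s, ψ τ with hχdef
  have hder : ∀ s, HasDerivAt χ (ψ s) s := fun s =>
    intervalIntegral.integral_hasDerivAt_right (hψ.intervalIntegrable _ _)
      (hψ.stronglyMeasurableAtFilter _ _) hψ.continuousAt
  have hzero : ∀ s, c ^ 2 ≤ s → χ s = 0 := fun s hs => by
    refine intervalIntegral.integral_zero_ae (Eventually.of_forall fun τ hτ => ?_)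
    rw [Set.uIoc_of_le hs] at hτ
    exact hψc τ hτ.1.le
  have hsub : tsupport (fun x : EuclideanSpace ℝ (Fin n) => χ (‖x‖ ^ 2)) ⊆
      Metric.closedBall 0 c := by
    refine closure_minimal (fun x hx => ?_) Metric.isClosed_closedBall
    rw [mem_closedBall_zero_iff]
    by_contra! hcx
    exact hx (hzero _ (by gcongr))
  have h := integral_inner_cutoff_eq_zero hu hv
    (χ := fun x => χ (‖x‖ ^ 2)) (χ' := fun x => (2 * ψ (‖x‖ ^ 2)) • x)
    (fun x => hasFDerivAt_comp_norm_sq x (hder _)) (by fun_prop)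
    ((isCompact_closedBall _ _).of_isClosed_subset (isClosed_tsupport _) hsub)
    (hsub.trans (Metric.closedBall_subset_ball hcR))
  simp_rw [inner_smul_left, conj_trivial, mul_assoc] at h
  rw [integral_const_mul] at h
  simpa using h

theorem continuousOn_integral_sphere {n : ℕ} {R : ℝ} {f : EuclideanSpace ℝ (Fin n) → ℝ}
    (hf : ContinuousOn f (Metric.ball 0 R)) :
    ContinuousOn (fun ρ : ℝ => ∫ ζ, f (ρ • ζ.1) ∂(surf n)) (Set.Ioo 0 R) := by
  have h : ContinuousOn (fun p : ℝ × Sph n => f (p.1 • p.2.1)) (Set.Ioo 0 R ×ˢ Set.univ) := by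
    refine hf.comp (by fun_prop) fun p hp => ?_
    have h1 := hp.1
    simp [norm_smul, abs_of_pos h1.1, h1.2]
  have := continuousOn_integral_of_compact_support (μ := surf n) (k := Set.univ)
    (f := fun (ρ : ℝ) (ζ : Sph n) => f (ρ • ζ.1)) isCompact_univ (s := Set.Ioo 0 R) h (by simp)
  exact this

/-- Green's second identity on a sphere centered at the origin. -/
theorem integral_sphere_green {n : ℕ} (hn : 0 < n) {R : ℝ}
    {u v : EuclideanSpace ℝ (Fin n) → ℝ} {g g' H H'} (hu : IsHarmonicOnBall R u g H)
    (hv : IsHarmonicOnBall R v g' H') {ρ : ℝ} (hρ : ρ ∈ Set.Ioo 0 R) :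
    ∫ ζ, inner ℝ (ρ • ζ.1) (v (ρ • ζ.1) • g (ρ • ζ.1) - u (ρ • ζ.1) • g' (ρ • ζ.1)) ∂(surf n)
      = 0 := by
  have hR : 0 < R := hρ.1.trans hρ.2
  set e : EuclideanSpace ℝ (Fin n) → ℝ := fun x => inner ℝ x (v x • g x - u x • g' x) with he
  have hcont : ContinuousOn e (Metric.ball 0 R) := continuousOn_id.inner
    ((hv.continuousOn.smul hu.continuousOn_grad).sub (hu.continuousOn.smul hv.continuousOn_grad))
  set E : ℝ → ℝ := fun ρ => ρ ^ (n - 1) * ∫ ζ, e (ρ • ζ.1) ∂(surf n)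
  have hE : ContinuousOn E (Set.Ioo 0 R) :=
    (continuous_pow _).continuousOn.mul (continuousOn_integral_sphere hcont)
  -- Du Bois-Reymond: tested against a smooth `θ(ρ)`, the spherical flux `E` becomes, in polar
  -- coordinates, the integral of the preceding lemma with `ψ(s) = θ(√s)`.
  have hae : ∀ᵐ ρ : ℝ, ρ ∈ Set.Ioo 0 R → E ρ = 0 := by
    refine isOpen_Ioo.ae_eq_zero_of_integral_contDiff_smul_eq_zero
      (hE.locallyIntegrableOn measurableSet_Ioo) fun θ hθ hθc hθs => ?_
    have hθ0 : ∀ s ∉ Set.Ioo 0 R, θ s = 0 := fun s hs =>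
      image_eq_zero_of_notMem_tsupport fun h => hs (hθs h)
    obtain ⟨c, hc0, hcR, hc⟩ : ∃ c, 0 ≤ c ∧ c < R ∧ ∀ s, c ≤ s → θ s = 0 := by
      rcases (tsupport θ).eq_empty_or_nonempty with h | h
      · exact ⟨0, le_rfl, hR, fun s _ => image_eq_zero_of_notMem_tsupport (by simp [h])⟩
      · obtain ⟨m, hm, hmax⟩ := IsCompact.exists_isGreatest hθc h
        have hmR := hθs hm
        refine ⟨(m + R) / 2, by linarith [hmR.1], by linarith [hmR.2], fun s hs => ?_⟩
        refine image_eq_zero_of_notMem_tsupport fun h => ?_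
        linarith [hmax h, hmR.2]
    have h := integral_comp_norm_sq_mul_inner_eq_zero hu hv (ψ := fun s => θ (√s))
      (hθ.continuous.comp Real.continuous_sqrt) hc0 hcR
      (fun s hs => hc _ (Real.le_sqrt_of_sq_le hs))
    simp only [Real.sqrt_sq (norm_nonneg _)] at h
    rw [integral_polar hn] at h
    · rw [← h, ← integral_indicator measurableSet_Ioi]
      refine integral_congr_ae (Eventually.of_forall fun s => ?_)
      simp only [smul_eq_mul]
      by_cases hs : 0 < s
      · rw [Set.indicator_of_mem (Set.mem_Ioi.2 hs)]
        simp only [norm_smul, norm_eq_of_mem_sphere, mul_one, Real.norm_eq_abs, abs_of_pos hs]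
        rw [integral_const_mul]
        simp only [E, he]
        ring
      · rw [Set.indicator_of_notMem (by simpa using hs), hθ0 s fun h => hs h.1, zero_mul]
    · have hts : tsupport (fun x : EuclideanSpace ℝ (Fin n) => θ ‖x‖) ⊆ Metric.closedBall 0 c := by
        refine closure_minimal (fun x hx => ?_) Metric.isClosed_closedBall
        rw [mem_closedBall_zero_iff]
        by_contra! hcx
        exact hx (hc _ hcx.le)
      refine Continuous.integrable_of_hasCompactSupport ?_ ?_
      · refine continuous_of_tsupport fun x hx => ?_
        have hx' := hts (tsupport_mul_subset_left hx)
        exact (hθ.continuous.comp continuous_norm).continuousAt.mul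
          (hcont.continuousAt (Metric.isOpen_ball.mem_nhds (Metric.closedBall_subset_ball hcR hx')))
      · exact HasCompactSupport.mul_right
          ((isCompact_closedBall _ _).of_isClosed_subset (isClosed_tsupport _) hts)
  -- Continuity of `E` turns vanishing at almost every radius into vanishing at every radius.
  have hz := Measure.eqOn_open_of_ae_eq (μ := volume) (f := E) (g := fun _ => 0)
    ((ae_restrict_iff' measurableSet_Ioo).2 hae) isOpen_Ioo hE continuousOn_const hρ
  have : ρ ^ (n - 1) ≠ 0 := pow_ne_zero _ hρ.1.ne'
  exact (mul_eq_zero.1 hz).resolve_left this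

/-- The integral over the unit sphere of `u (a ζ) v (b ζ)`, for harmonic functions `u`, `v` on the
unit ball, depends on `a b` only. -/
theorem integral_mul_dilates_eq {n : ℕ} (hn : 0 < n)
    {u v : EuclideanSpace ℝ (Fin n) → ℝ} {g g' H H'} (hu : IsHarmonicOnBall 1 u g H)
    (hv : IsHarmonicOnBall 1 v g' H') {a b s : ℝ} (ha : 0 < a) (ha1 : a < 1) (hb : 0 < b)
    (hb1 : b < 1) (hs : 1 ≤ s) (has : a * s < 1) :
    ∫ ζ, u ((a * s) • ζ.1) * v ((b / s) • ζ.1) ∂(surf n) =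
      ∫ ζ, u (a • ζ.1) * v (b • ζ.1) ∂(surf n) := by
  -- The derivative of `u(aτζ) v(bζ/τ)` in `τ` is `τ⁻¹ e(aτ, b/τ)`. This is the Green flux of the
  -- dilates through the unit sphere, so it integrates to zero and the integral does not depend on
  -- `τ`.
  set e : ℝ → ℝ → Sph n → ℝ := fun a b ζ => v (b • ζ.1) * (a * inner ℝ ζ.1 (g (a • ζ.1))) -
    u (a • ζ.1) * (b * inner ℝ ζ.1 (g' (b • ζ.1)))
  have he : ∀ a ∈ Set.Ioo (0 : ℝ) 1, ∀ b ∈ Set.Ioo (0 : ℝ) 1, ∫ ζ, e a b ζ ∂(surf n) = 0 := by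
    intro a ha b hb
    have ha' : 1 < 1 / a := by rw [lt_div_iff₀ ha.1]; linarith [ha.2]
    have hb' : 1 < 1 / b := by rw [lt_div_iff₀ hb.1]; linarith [hb.2]
    have hmono : ∀ {R R' : ℝ} {u : EuclideanSpace ℝ (Fin n) → ℝ} {g H}, IsHarmonicOnBall R u g H →
        R' ≤ R → IsHarmonicOnBall R' u g H := fun h hR =>
      ⟨fun x hx => h.1 x (hx.trans_le hR), fun x hx => h.2 x (hx.trans_le hR),
        h.3.mono (Metric.ball_subset_ball hR), fun i => (h.4 i).mono (Metric.ball_subset_ball hR),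
        fun x hx => h.5 x (hx.trans_le hR)⟩
    have := integral_sphere_green hn (hmono (hu.comp_smul ha.1) (min_le_left (1 / a) (1 / b)))
      (hmono (hv.comp_smul hb.1) (min_le_right (1 / a) (1 / b))) (ρ := 1)
      ⟨one_pos, lt_min ha' hb'⟩
    rw [← this]
    refine integral_congr_ae (Eventually.of_forall fun ζ => ?_)
    simp [e, inner_sub_right, inner_smul_right]
  have hmem : ∀ τ ∈ Set.Icc 1 s, a * τ ∈ Set.Ioo (0 : ℝ) 1 ∧ b / τ ∈ Set.Ioo (0 : ℝ) 1 := by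
    intro τ hτ
    have h0 : 0 < τ := by linarith [hτ.1]
    refine ⟨⟨by positivity, by nlinarith [hτ.2]⟩, by positivity, ?_⟩
    rw [div_lt_one h0]
    linarith [hτ.1]
  have hball : ∀ c ∈ Set.Ioo (0 : ℝ) 1, ∀ ζ : Sph n, ‖c • ζ.1‖ < 1 := fun c hc ζ => by
    simp [norm_smul, abs_of_pos hc.1, hc.2]
  set k : ℝ → Sph n → ℝ := fun τ ζ => u ((a * τ) • ζ.1) * v ((b / τ) • ζ.1) with hk
  have hder : ∀ ζ, ∀ τ ∈ Set.Icc 1 s, HasDerivAt (fun τ => k τ ζ)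
      (τ⁻¹ * e (a * τ) (b / τ) ζ) τ := by
    intro ζ τ hτ
    have h0 : τ ≠ 0 := by linarith [hτ.1]
    have h1 := (hu.hasFDerivAt _ (hball _ (hmem τ hτ).1 ζ)).comp_hasDerivAt τ
      (((hasDerivAt_id τ).const_mul a).smul_const ζ.1)
    have h2 := (hv.hasFDerivAt _ (hball _ (hmem τ hτ).2 ζ)).comp_hasDerivAt τ
      (((hasDerivAt_inv h0).const_mul b).smul_const ζ.1)
    refine (h1.mul h2).congr_deriv ?_
    simp only [Function.comp_apply, e, id, innerSL_apply_apply, inner_smul_right, real_inner_comm ζ.1, ← div_eq_mul_inv]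
    field_simp
    ring
  have hcomp : ∀ {F : Type} [TopologicalSpace F] {f : EuclideanSpace ℝ (Fin n) → F}
      {c : ℝ → ℝ}, ContinuousOn f (Metric.ball 0 1) → ContinuousOn c (Set.Icc 1 s) →
      (∀ τ ∈ Set.Icc 1 s, c τ ∈ Set.Ioo (0 : ℝ) 1) →
      ContinuousOn (fun p : ℝ × Sph n => f (c p.1 • p.2.1)) (Set.Icc 1 s ×ˢ Set.univ) := by
    intro F _ f c hf hc hcm
    refine hf.comp (f := fun p : ℝ × Sph n => c p.1 • p.2.1) ?_ fun p hp => ?_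
    · exact (hc.comp continuousOn_fst fun p hp => hp.1).smul
        (continuous_subtype_val.comp continuous_snd).continuousOn
    · simpa using hball _ (hcm _ hp.1) p.2
  have hca : ContinuousOn (fun τ : ℝ => a * τ) (Set.Icc 1 s) := by fun_prop
  have hcb : ContinuousOn (fun τ : ℝ => b / τ) (Set.Icc 1 s) :=
    continuousOn_const.div continuousOn_id fun τ hτ => by linarith [hτ.1]
  have hcont : ContinuousOn (fun p : ℝ × Sph n => p.1⁻¹ * e (a * p.1) (b / p.1) p.2)
      (Set.Icc 1 s ×ˢ Set.univ) := by
    have m1 := fun τ hτ => (hmem τ hτ).1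
    have m2 := fun τ hτ => (hmem τ hτ).2
    have c1 := hcomp hv.continuousOn hcb m2
    have c2 := hcomp hu.continuousOn hca m1
    have c3 := hcomp hu.continuousOn_grad hca m1
    have c4 := hcomp hv.continuousOn_grad hcb m2
    have c5 : ContinuousOn (fun p : ℝ × Sph n => p.2.1) (Set.Icc 1 s ×ˢ Set.univ) := by fun_prop
    have c6 : ContinuousOn (fun p : ℝ × Sph n => a * p.1) (Set.Icc 1 s ×ˢ Set.univ) := by fun_prop
    have c7 : ContinuousOn (fun p : ℝ × Sph n => b / p.1) (Set.Icc 1 s ×ˢ Set.univ) :=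
      hcb.comp continuousOn_fst fun p hp => hp.1
    have c8 : ContinuousOn (fun p : ℝ × Sph n => p.1⁻¹) (Set.Icc 1 s ×ˢ Set.univ) :=
      continuousOn_fst.inv₀ fun p hp => by linarith [hp.1.1]
    exact c8.mul ((c1.mul (c6.mul (c5.inner c3))).sub (c2.mul (c7.mul (c5.inner c4))))
  have hk : ∀ c ∈ Set.Ioo (0 : ℝ) 1, ∀ d ∈ Set.Ioo (0 : ℝ) 1,
      Integrable (fun ζ : Sph n => u (c • ζ.1) * v (d • ζ.1)) (surf n) := by
    intro c hc d hd
    refine Continuous.integrable_of_hasCompactSupport ?_ (HasCompactSupport.of_compactSpace _)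
    exact (hu.continuousOn.comp_continuous (by fun_prop) fun ζ => by simpa using hball c hc ζ).mul
      (hv.continuousOn.comp_continuous (by fun_prop) fun ζ => by simpa using hball d hd ζ)
  have hs' := hmem s ⟨hs, le_rfl⟩
  rw [← sub_eq_zero, ← integral_sub (hk _ hs'.1 _ hs'.2) (hk _ ⟨ha, ha1⟩ _ ⟨hb, hb1⟩)]
  have hftc : ∀ ζ : Sph n, u ((a * s) • ζ.1) * v ((b / s) • ζ.1) - u (a • ζ.1) * v (b • ζ.1) =
      ∫ τ in Set.Ioc 1 s, τ⁻¹ * e (a * τ) (b / τ) ζ := by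
    intro ζ
    rw [← intervalIntegral.integral_of_le hs, intervalIntegral.integral_eq_sub_of_hasDerivAt
      (f := fun τ => k τ ζ)]
    · simp [k]
    · intro τ hτ
      rw [Set.uIcc_of_le hs] at hτ
      exact hder ζ τ hτ
    · refine ContinuousOn.intervalIntegrable ?_
      rw [Set.uIcc_of_le hs]
      exact hcont.comp (f := fun τ : ℝ => (τ, ζ)) (by fun_prop) fun τ hτ => ⟨hτ, trivial⟩
  simp_rw [hftc]
  rw [integral_integral_swap]
  · refine integral_eq_zero_of_ae ?_
    filter_upwards [ae_restrict_mem measurableSet_Ioc] with τ hτ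
    have h := hmem τ ⟨hτ.1.le, hτ.2⟩
    rw [integral_const_mul, he _ h.1 _ h.2]
    simp
  · have h1 : IntegrableOn (fun p : ℝ × Sph n => p.1⁻¹ * e (a * p.1) (b / p.1) p.2)
      (Set.Ioc 1 s ×ˢ Set.univ) (volume.prod (surf n)) :=
      (hcont.integrableOn_compact (isCompact_Icc.prod isCompact_univ)).mono_set
        (Set.prod_mono Set.Ioc_subset_Icc_self le_rfl)
    rw [IntegrableOn, ← Measure.prod_restrict, Measure.restrict_univ] at h1
    exact h1.swap

/-! ### The Poisson kernel: normalization, approximate identity, semigroup property. -/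

/-- Direct differentiation, with the kernel written through real powers of `‖x - ξ‖²`. After
factoring out powers, the Laplacian is a multiple of `2 ∑ x_i (x_i - ξ_i) - (‖x - ξ‖² + ‖x‖² - 1)`,
which vanishes because `ξ` is a unit vector. -/
theorem isHarmonicOnBall_poisson {n : ℕ} (ξ : Sph n) :
    IsHarmonicOnBall 1
      (fun x => (1 - ‖x‖ ^ 2) * (‖x - ξ.1‖ ^ 2) ^ (-((n : ℝ) / 2)))
      (fun x => (-2 * (‖x - ξ.1‖ ^ 2) ^ (-((n : ℝ) / 2))) • x -
        (n * (1 - ‖x‖ ^ 2) * (‖x - ξ.1‖ ^ 2) ^ (-((n : ℝ) / 2) - 1)) • (x - ξ.1))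
      (fun i x => -2 * (‖x - ξ.1‖ ^ 2) ^ (-((n : ℝ) / 2)) +
        4 * n * x i * (x i - ξ.1 i) * (‖x - ξ.1‖ ^ 2) ^ (-((n : ℝ) / 2) - 1) +
        (1 - ‖x‖ ^ 2) * (n * (n + 2) * (x i - ξ.1 i) ^ 2 *
          (‖x - ξ.1‖ ^ 2) ^ (-((n : ℝ) / 2) - 1 - 1) -
          n * (‖x - ξ.1‖ ^ 2) ^ (-((n : ℝ) / 2) - 1))) := by
  have hpos : ∀ x : EuclideanSpace ℝ (Fin n), ‖x‖ < 1 → 0 < ‖x - ξ.1‖ ^ 2 := fun x hx => by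
    have : x - ξ.1 ≠ 0 := fun h => by
      rw [sub_eq_zero.1 h, norm_eq_of_mem_sphere] at hx
      exact lt_irrefl _ hx
    positivity
  have hq : ∀ c : ℝ, ContinuousOn (fun x : EuclideanSpace ℝ (Fin n) => (‖x - ξ.1‖ ^ 2) ^ c)
      (Metric.ball 0 1) := fun c =>
    ContinuousOn.rpow_const (by fun_prop) fun x hx => .inl (hpos x (by simpa using hx)).ne'
  have hi : ∀ i, Continuous fun x : EuclideanSpace ℝ (Fin n) => x i := fun i => by fun_prop
  refine ⟨fun x hx => ?_, fun x hx i => ?_, ?_, fun i => ?_, fun x hx => ?_⟩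
  · have h1 := ((hasFDerivAt_const (1 : ℝ) x).sub (hasStrictFDerivAt_norm_sq x).hasFDerivAt)
    have h2 : HasFDerivAt (fun y : EuclideanSpace ℝ (Fin n) => ‖y - ξ.1‖ ^ 2)
        (2 • innerSL ℝ (x - ξ.1)) x := by
      have := (hasStrictFDerivAt_norm_sq (x - ξ.1)).hasFDerivAt.comp x
        ((hasFDerivAt_id x).sub_const ξ.1)
      exact this
    have h3 := h2.rpow_const (p := -((n : ℝ) / 2)) (.inl (hpos x hx).ne')
    refine (h1.mul h3).congr_fderiv ?_
    ext w
    simp only [Pi.sub_apply, nsmul_eq_mul, Nat.cast_ofNat, zero_sub, smul_neg, map_sub, map_smul,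
      add_apply, neg_apply, sub_apply, smul_apply, innerSL_apply_apply, smul_eq_mul]
    simp
    ring
  · have hx1 : HasDerivAt (fun t : ℝ => (x + t • EuclideanSpace.single i (1 : ℝ)) i) 1 0 := by
      simpa using (hasDerivAt_id (0 : ℝ)).const_add (x i)
    have hline : HasDerivAt (fun t : ℝ => x + t • EuclideanSpace.single i (1 : ℝ))
        (EuclideanSpace.single i (1 : ℝ)) 0 := by
      simpa using ((hasDerivAt_id (0 : ℝ)).smul_const
        (EuclideanSpace.single i (1 : ℝ))).const_add x
    have hx2 := hline.norm_sq
    have hx3 := (hline.sub_const ξ.1).norm_sq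
    have h0 : x + (0 : ℝ) • EuclideanSpace.single i (1 : ℝ) = x := by simp
    have hne : ‖x + (0 : ℝ) • EuclideanSpace.single i (1 : ℝ) - ξ.1‖ ^ 2 ≠ 0 := by
      rw [h0]
      exact (hpos x hx).ne'
    have hr := hx3.rpow_const (p := -((n : ℝ) / 2)) (.inl hne)
    have hr' := hx3.rpow_const (p := -((n : ℝ) / 2) - 1) (.inl hne)
    have := ((hr.const_mul (-2)).mul hx1).sub
      ((((hx2.const_sub 1).const_mul (n : ℝ)).mul hr').mul (hx1.sub_const (ξ.1 i)))
    refine HasDerivAt.congr_deriv (f := fun t : ℝ => _) this ?_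
    simp only [h0, EuclideanSpace.inner_single_right]
    simp
    ring
  · exact ((continuousOn_const.mul (hq _)).smul continuousOn_id).sub
      (((continuousOn_const.mul (by fun_prop)).mul (hq _)).smul (by fun_prop))
  · have := (hi i).continuousOn (s := Metric.ball (0 : EuclideanSpace ℝ (Fin n)) 1)
    have h1 := hq (-((n : ℝ) / 2))
    have h2 := hq (-((n : ℝ) / 2) - 1)
    have h3 := hq (-((n : ℝ) / 2) - 1 - 1)
    fun_prop
  · set q := ‖x - ξ.1‖ ^ 2 with hqdef
    have hq0 : 0 < q := hpos x hx
    have e1 : q ^ (-((n : ℝ) / 2)) = q ^ (-((n : ℝ) / 2) - 1 - 1) * q * q := by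
      rw [← Real.rpow_add_one hq0.ne', ← Real.rpow_add_one hq0.ne']
      ring_nf
    have e2 : q ^ (-((n : ℝ) / 2) - 1) = q ^ (-((n : ℝ) / 2) - 1 - 1) * q := by
      rw [← Real.rpow_add_one hq0.ne']
      ring_nf
    have s1 : ∑ i, (x i - ξ.1 i) ^ 2 = q := by
      rw [hqdef, EuclideanSpace.real_norm_sq_eq]
      simp
    have s2 : ∑ i, x i ^ 2 = ‖x‖ ^ 2 := (EuclideanSpace.real_norm_sq_eq x).symm
    have s3 : ∑ i, ξ.1 i ^ 2 = 1 := by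
      rw [← EuclideanSpace.real_norm_sq_eq, norm_eq_of_mem_sphere, one_pow]
    have s4 : 2 * ∑ i, x i * (x i - ξ.1 i) = q + ‖x‖ ^ 2 - 1 := by
      have : 2 * ∑ i, x i * (x i - ξ.1 i) =
          ∑ i, (x i - ξ.1 i) ^ 2 + ∑ i, x i ^ 2 - ∑ i, ξ.1 i ^ 2 := by
        rw [Finset.mul_sum, ← Finset.sum_add_distrib, ← Finset.sum_sub_distrib]
        exact Finset.sum_congr rfl fun i _ => by ring
      rw [this, s1, s2, s3]
    set w := q ^ (-((n : ℝ) / 2) - 1 - 1)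
    rw [e1, e2]
    have : ∀ i, -2 * (w * q * q) + 4 * n * x i * (x i - ξ.1 i) * (w * q) +
        (1 - ‖x‖ ^ 2) * (n * (n + 2) * (x i - ξ.1 i) ^ 2 * w - n * (w * q)) =
        (-2 * (w * q * q) - (1 - ‖x‖ ^ 2) * n * w * q) +
        (4 * n * (w * q)) * (x i * (x i - ξ.1 i)) +
        ((1 - ‖x‖ ^ 2) * n * (n + 2) * w) * (x i - ξ.1 i) ^ 2 := fun i => by ring
    simp_rw [this]
    rw [Finset.sum_add_distrib, Finset.sum_add_distrib, ← Finset.mul_sum, ← Finset.mul_sum, s1,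
      Finset.sum_const, Finset.card_univ, Fintype.card_fin, nsmul_eq_mul]
    linear_combination (2 * n * (w * q)) * s4

/-- The Poisson kernel of the unit ball with respect to the normalized surface measure. -/
def pker {n : ℕ} (r : ℝ) (x y : EuclideanSpace ℝ (Fin n)) : ℝ :=
  1 / sigma n * ((1 - r ^ 2) / ‖r • x - y‖ ^ n)

theorem norm_smul_sub_comm {n : ℕ} (r : ℝ) (ξ η : Sph n) : ‖r • ξ.1 - η.1‖ = ‖r • η.1 - ξ.1‖ := by
  have h : ‖r • ξ.1 - η.1‖ ^ 2 = ‖r • η.1 - ξ.1‖ ^ 2 := by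
    rw [norm_sub_sq_real, norm_sub_sq_real]
    simp only [norm_smul, norm_eq_of_mem_sphere, inner_smul_left, real_inner_comm]
  exact (sq_eq_sq₀ (norm_nonneg _) (norm_nonneg _)).1 h

theorem pker_comm {n : ℕ} (r : ℝ) (ξ η : Sph n) : pker r ξ.1 η.1 = pker r η.1 ξ.1 := by
  rw [pker, pker, norm_smul_sub_comm]

theorem one_sub_le_norm_smul_sub {n : ℕ} {r : ℝ} (hr : 0 ≤ r) (ξ η : Sph n) :
    1 - r ≤ ‖r • ξ.1 - η.1‖ := by
  have := norm_sub_norm_le η.1 (r • ξ.1)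
  rw [norm_smul, norm_eq_of_mem_sphere, norm_eq_of_mem_sphere, Real.norm_of_nonneg hr,
    norm_sub_rev] at this
  linarith

theorem dist_le_two_mul_norm_smul_sub {n : ℕ} {r : ℝ} (hr : 0 ≤ r) (hr1 : r ≤ 1) (ξ η : Sph n) :
    dist ξ η ≤ 2 * ‖r • ξ.1 - η.1‖ := by
  have h := one_sub_le_norm_smul_sub hr ξ η
  have h2 : ‖ξ.1 - r • ξ.1‖ = 1 - r := by
    rw [show ξ.1 - r • ξ.1 = (1 - r) • ξ.1 by rw [sub_smul, one_smul], norm_smul,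
      norm_eq_of_mem_sphere, Real.norm_of_nonneg (by linarith), mul_one]
  have h3 := norm_sub_le_norm_sub_add_norm_sub ξ.1 (r • ξ.1) η.1
  rw [Subtype.dist_eq, dist_eq_norm]
  linarith

theorem pker_pos {n : ℕ} (hn : 0 < n) {r : ℝ} (hr : 0 ≤ r) (hr1 : r < 1) (ξ η : Sph n) :
    0 < pker r ξ.1 η.1 := by
  have h1 := one_sub_le_norm_smul_sub hr ξ η
  have h2 := sigma_pos hn
  have h3 : 0 < 1 - r ^ 2 := by nlinarith
  have h4 : 0 < ‖r • ξ.1 - η.1‖ := by linarith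
  unfold pker
  positivity

theorem pker_zero {n : ℕ} (ξ η : Sph n) : pker 0 ξ.1 η.1 = 1 / sigma n := by
  simp [pker]

theorem measurable_pker {n : ℕ} :
    Measurable fun p : ℝ × EuclideanSpace ℝ (Fin n) × EuclideanSpace ℝ (Fin n) =>
      pker p.1 p.2.1 p.2.2 := by
  unfold pker
  fun_prop

theorem continuousOn_pker {n : ℕ} :
    ContinuousOn (fun p : ℝ × Sph n × Sph n => pker p.1 p.2.1.1 p.2.2.1)
      (Set.Ico 0 1 ×ˢ Set.univ) := by
  unfold pker
  refine continuousOn_const.mul (ContinuousOn.div (by fun_prop) (by fun_prop) fun p hp => ?_)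
  have := one_sub_le_norm_smul_sub hp.1.1 p.2.1 p.2.2
  have h1 : p.1 < 1 := hp.1.2
  exact pow_ne_zero _ (by linarith)

theorem continuous_pker_left {n : ℕ} {r : ℝ} (hr : 0 ≤ r) (hr1 : r < 1) (ξ : Sph n) :
    Continuous fun ζ : Sph n => pker r ζ.1 ξ.1 :=
  continuousOn_pker.comp_continuous (f := fun ζ : Sph n => (r, ζ, ξ)) (by fun_prop)
    fun _ => ⟨⟨hr, hr1⟩, trivial⟩

theorem continuous_pker_right {n : ℕ} {r : ℝ} (hr : 0 ≤ r) (hr1 : r < 1) (ξ : Sph n) :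
    Continuous fun ζ : Sph n => pker r ξ.1 ζ.1 :=
  continuousOn_pker.comp_continuous (f := fun ζ : Sph n => (r, ξ, ζ)) (by fun_prop)
    fun _ => ⟨⟨hr, hr1⟩, trivial⟩

theorem pker_eq {n : ℕ} (r : ℝ) (ξ ζ : Sph n) : pker r ζ.1 ξ.1 =
    1 / sigma n * ((1 - ‖r • ζ.1‖ ^ 2) * (‖r • ζ.1 - ξ.1‖ ^ 2) ^ (-((n : ℝ) / 2))) := by
  rw [pker, norm_smul, norm_eq_of_mem_sphere, mul_one, Real.norm_eq_abs, sq_abs,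
    ← Real.rpow_natCast ‖r • ζ.1 - ξ.1‖ 2, ← Real.rpow_mul (norm_nonneg _),
    show ((2 : ℕ) : ℝ) * (-((n : ℝ) / 2)) = -(n : ℝ) by push_cast; ring,
    Real.rpow_neg (norm_nonneg _), Real.rpow_natCast, div_eq_mul_inv (1 - r ^ 2)]

theorem integrable_of_continuous_sphere {n : ℕ} {F : Type*} [NormedAddCommGroup F]
    {f : Sph n → F} (hf : Continuous f) : Integrable f (surf n) :=
  hf.integrable_of_hasCompactSupport (HasCompactSupport.of_compactSpace _)

theorem surf_real_univ {n : ℕ} (hn : 0 < n) : (surf n).real Set.univ = sigma n := by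
  rw [measureReal_def, surf_univ hn, ENNReal.toReal_ofReal (sigma_pos hn).le]

/-- The Poisson kernel is normalized. -/
theorem integral_pker {n : ℕ} (hn : 0 < n) {r : ℝ} (hr : 0 ≤ r) (hr1 : r < 1) (ξ : Sph n) :
    ∫ ζ, pker r ζ.1 ξ.1 ∂(surf n) = 1 := by
  have hσ := sigma_pos hn
  rcases hr.eq_or_lt with rfl | hr0
  · simp_rw [pker_zero]
    rw [integral_const, surf_real_univ hn, smul_eq_mul]
    field_simp
  set f : ℝ → ℝ := fun c => ∫ ζ, pker c ζ.1 ξ.1 ∂(surf n)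
  -- Dilation invariance paired with the constant function `1`: the spherical mean does not depend
  -- on the radius, and its limit as the radius tends to `0` is explicit.
  have hconst : ∀ c ∈ Set.Ioc 0 r, f c = f r := by
    intro c hc
    have h1 : 1 ≤ r / c := by rw [le_div_iff₀ hc.1]; linarith [hc.2]
    have hcr : c * (r / c) = r := by rw [mul_div_cancel₀ _ hc.1.ne']
    have := integral_mul_dilates_eq hn (isHarmonicOnBall_poisson ξ) (isHarmonicOnBall_one 1)
      hc.1 (hc.2.trans_lt hr1) (b := 1 / 2) (by norm_num) (by norm_num) h1 (by rwa [hcr])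
    rw [hcr] at this
    simp only [mul_one] at this
    simp only [f, pker_eq, integral_const_mul, this]
  have hcont : Tendsto f (𝓝[>] 0) (𝓝 (f 0)) := by
    have h := continuousOn_integral_of_compact_support (μ := surf n) (k := Set.univ)
      (f := fun (c : ℝ) (ζ : Sph n) => pker c ζ.1 ξ.1) isCompact_univ (s := Set.Ico (0 : ℝ) 1)
      (continuousOn_pker.comp (f := fun p : ℝ × Sph n => (p.1, p.2, ξ)) (by fun_prop)
        fun p hp => ⟨hp.1, trivial⟩) (by simp)
    have h0 := (h 0 ⟨le_rfl, one_pos⟩).tendsto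
    exact h0.mono_left (nhdsWithin_le_of_mem (mem_of_superset (Ioo_mem_nhdsGT one_pos)
      fun x hx => ⟨hx.1.le, hx.2⟩))
  have hlim : Tendsto f (𝓝[>] 0) (𝓝 (f r)) := by
    refine tendsto_const_nhds.congr' ?_
    filter_upwards [Ioc_mem_nhdsGT hr0] with c hc using (hconst c hc).symm
  have h0 : f 0 = 1 := by
    simp only [f, pker_zero]
    rw [integral_const, surf_real_univ hn, smul_eq_mul]
    field_simp
  exact (tendsto_nhds_unique hlim hcont).trans h0

theorem pker_le_of_le_dist {n : ℕ} (hn : 0 < n) {r δ : ℝ} (hr : 0 ≤ r) (hr1 : r < 1) (hδ : 0 < δ)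
    {ξ η : Sph n} (h : δ ≤ dist ξ η) :
    pker r ξ.1 η.1 ≤ 1 / sigma n * ((1 - r ^ 2) * (2 / δ) ^ n) := by
  have h1 := dist_le_two_mul_norm_smul_sub hr hr1.le ξ η
  have h2 := sigma_pos hn
  have h3 : 0 < 1 - r ^ 2 := by nlinarith
  unfold pker
  rw [div_eq_mul_inv (1 - r ^ 2), ← inv_pow]
  gcongr
  rw [show 2 / δ = (δ / 2)⁻¹ by rw [inv_div]]
  gcongr
  linarith

/-- The Poisson kernels form an approximate identity. -/
theorem tendsto_integral_pker_smul {n : ℕ} (hn : 0 < n) {F : Type*} [NormedAddCommGroup F]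
    [NormedSpace ℝ F] [CompleteSpace F] {k : ℝ → Sph n → F} {ξ : Sph n} {L : F} {B : ℝ}
    (hk : Tendsto (fun p : ℝ × Sph n => k p.1 p.2) (𝓝[<] 1 ×ˢ 𝓝 ξ) (𝓝 L))
    (hB : ∀ᶠ r in 𝓝[<] 1, ∀ ζ, ‖k r ζ‖ ≤ B)
    (hm : ∀ᶠ r in 𝓝[<] 1, AEStronglyMeasurable (k r) (surf n)) :
    Tendsto (fun r => ∫ ζ, pker r ζ.1 ξ.1 • k r ζ ∂(surf n)) (𝓝[<] 1) (𝓝 L) := by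
  have hσ := sigma_pos hn
  rw [Metric.tendsto_nhds]
  intro ε hε
  have h1 := (Metric.tendsto_nhds.1 hk) (ε / 2) (by positivity)
  obtain ⟨pa, hpa, pb, hpb, hab⟩ := eventually_prod_iff.1 h1
  obtain ⟨δ, hδ, hδb⟩ := Metric.eventually_nhds_iff.1 hpb
  have htail : Tendsto (fun r : ℝ => (B + ‖L‖) * ((1 - r ^ 2) * (2 / δ) ^ n)) (𝓝[<] 1) (𝓝 0) := by
    have : Tendsto (fun r : ℝ => (B + ‖L‖) * ((1 - r ^ 2) * (2 / δ) ^ n)) (𝓝 1)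
      (𝓝 ((B + ‖L‖) * ((1 - 1 ^ 2) * (2 / δ) ^ n))) := Continuous.tendsto (by fun_prop) 1
    simp only [one_pow, sub_self, zero_mul, mul_zero] at this
    exact this.mono_left nhdsWithin_le_nhds
  have htail' := htail.eventually (gt_mem_nhds (half_pos hε))
  have hI : ∀ᶠ r : ℝ in 𝓝[<] 1, r ∈ Set.Ioo (0 : ℝ) 1 := Ioo_mem_nhdsLT one_pos
  filter_upwards [hpa, hB, hm, htail', hI] with r hra hrB hrm hrt hr
  have hc := continuous_pker_left hr.1.le hr.2 ξ
  have hint := integrable_of_continuous_sphere hc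
  have hintk : Integrable (fun ζ : Sph n => pker r ζ.1 ξ.1 • k r ζ) (surf n) :=
    hint.smul_bdd B hrm (Eventually.of_forall hrB)
  have hL : ∫ ζ, pker r ζ.1 ξ.1 • L ∂(surf n) = L := by
    rw [integral_smul_const, integral_pker hn hr.1.le hr.2, one_smul]
  rw [dist_eq_norm, ← hL, ← integral_sub hintk (hint.smul_const L)]
  set c := 1 / sigma n * ((1 - r ^ 2) * (2 / δ) ^ n) * (B + ‖L‖)
  have hc0 : 0 ≤ c := by
    have : 0 < 1 - r ^ 2 := by nlinarith [hr.1, hr.2]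
    have := (norm_nonneg _).trans (hrB ξ)
    positivity
  -- Near `ξ` the value of `k r` is within `ε/2` of `L`; away from `ξ` the kernel itself is of order
  -- `1 - r²`. Adding the two bounds avoids splitting the domain of integration.
  have hle : ∀ ζ : Sph n, ‖pker r ζ.1 ξ.1 • k r ζ - pker r ζ.1 ξ.1 • L‖ ≤
      pker r ζ.1 ξ.1 * (ε / 2) + c := by
    intro ζ
    have hp := (pker_pos hn hr.1.le hr.2 ζ ξ).le
    rw [← smul_sub, norm_smul, Real.norm_of_nonneg hp]
    by_cases hd : dist ζ ξ < δ
    · have := hab hra (hδb hd)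
      rw [dist_eq_norm] at this
      have := mul_le_mul_of_nonneg_left this.le hp
      linarith
    · have h2 := pker_le_of_le_dist hn hr.1.le hr.2 hδ (not_lt.1 hd)
      have h3 : ‖k r ζ - L‖ ≤ B + ‖L‖ := (norm_sub_le _ _).trans (by gcongr; exact hrB ζ)
      have h4 : pker r ζ.1 ξ.1 * ‖k r ζ - L‖ ≤ c := mul_le_mul h2 h3 (norm_nonneg _) (hp.trans h2)
      have : 0 ≤ pker r ζ.1 ξ.1 * (ε / 2) := by positivity
      linarith
  calc ‖∫ ζ, (pker r ζ.1 ξ.1 • k r ζ - pker r ζ.1 ξ.1 • L) ∂(surf n)‖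
      ≤ ∫ ζ, (pker r ζ.1 ξ.1 * (ε / 2) + c) ∂(surf n) :=
        norm_integral_le_of_norm_le ((hint.mul_const _).add (integrable_const _))
          (Eventually.of_forall hle)
    _ = ε / 2 + (B + ‖L‖) * ((1 - r ^ 2) * (2 / δ) ^ n) := by
        rw [integral_add (hint.mul_const _) (integrable_const _), integral_mul_const,
          integral_pker hn hr.1.le hr.2, integral_const, surf_real_univ hn, smul_eq_mul]
        simp only [c]
        field_simp
    _ < ε := by linarith

/-- The semigroup property of the Poisson kernels. -/
theorem integral_pker_mul_pker {n : ℕ} (hn : 0 < n) {r ρ : ℝ} (hr : 0 ≤ r) (hr1 : r < 1)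
    (hρ : 0 ≤ ρ) (hρ1 : ρ < 1) (ξ η : Sph n) :
    ∫ ζ, pker r ξ.1 ζ.1 * pker ρ ζ.1 η.1 ∂(surf n) = pker (r * ρ) ξ.1 η.1 := by
  have hσ := sigma_pos hn
  simp_rw [pker_comm r ξ]
  rcases hr.eq_or_lt with rfl | hr0
  · simp_rw [pker_zero, zero_mul, pker_zero, integral_const_mul]
    rw [integral_pker hn hρ hρ1, mul_one]
  rcases hρ.eq_or_lt with rfl | hρ0
  · simp_rw [pker_zero, mul_zero, pker_zero, integral_mul_const]
    rw [integral_pker hn hr hr1, one_mul]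
  -- By dilation invariance only the product of the two radii matters. Moving the first radius up to
  -- `1` makes the first kernel an approximate identity at `ξ`, and the second kernel tends to the
  -- one of radius `r ρ`.
  have hconst : ∀ c ∈ Set.Ico r 1, ∫ ζ, pker c ζ.1 ξ.1 • pker (r * ρ / c) ζ.1 η.1 ∂(surf n) =
      ∫ ζ, pker r ζ.1 ξ.1 * pker ρ ζ.1 η.1 ∂(surf n) := by
    intro c hc
    have h1 : 1 ≤ c / r := by rw [le_div_iff₀ hr0]; linarith [hc.1]
    have hcr : r * (c / r) = c := by rw [mul_div_cancel₀ _ hr0.ne']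
    have := integral_mul_dilates_eq hn (isHarmonicOnBall_poisson ξ) (isHarmonicOnBall_poisson η)
      hr0 hr1 hρ0 hρ1 h1 (by rw [hcr]; exact hc.2)
    rw [hcr, show ρ / (c / r) = r * ρ / c by rw [div_div_eq_mul_div, mul_comm]] at this
    simp only [pker_eq, smul_eq_mul, mul_mul_mul_comm (1 / sigma n), integral_const_mul, this]
  have hcont : ContinuousAt (fun p : ℝ × Sph n => pker (r * ρ / p.1) p.2.1 η.1) (1, ξ) := by
    unfold pker
    refine continuousAt_const.mul (ContinuousAt.div ?_ ?_ ?_)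
    · fun_prop (disch := norm_num)
    · fun_prop (disch := norm_num)
    · have := one_sub_le_norm_smul_sub (mul_nonneg hr hρ) ξ η
      simp only [div_one]
      have : r * ρ < 1 := mul_lt_one_of_nonneg_of_lt_one_left hr hr1 hρ1.le
      exact pow_ne_zero _ (by linarith)
  have hdiv : ∀ᶠ c in 𝓝[<] (1 : ℝ), r * ρ / c ∈ Set.Icc 0 ρ := by
    filter_upwards [Ico_mem_nhdsLT hr1] with c hc
    have hc0 : 0 < c := hr0.trans_le hc.1
    refine ⟨by positivity, ?_⟩
    rw [div_le_iff₀ hc0, mul_comm]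
    gcongr
    exact hc.1
  have hlim := tendsto_integral_pker_smul hn (ξ := ξ) (L := pker (r * ρ) ξ.1 η.1)
    (B := 1 / sigma n * (1 / (1 - ρ) ^ n)) (k := fun c ζ => pker (r * ρ / c) ζ.1 η.1) ?_ ?_ ?_
  · refine tendsto_nhds_unique (tendsto_const_nhds.congr' ?_) hlim
    filter_upwards [Ico_mem_nhdsLT hr1] with c hc using (hconst c hc).symm
  · have h1 := hcont.tendsto
    rw [nhds_prod_eq] at h1
    simp only [div_one] at h1
    exact h1.mono_left (prod_mono_left _ nhdsWithin_le_nhds)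
  · filter_upwards [hdiv] with c hc ζ
    rw [Real.norm_of_nonneg (pker_pos hn hc.1 (hc.2.trans_lt hρ1) ζ η).le]
    have h1 := one_sub_le_norm_smul_sub hc.1 ζ η
    have h2 : 1 - ρ ≤ ‖(r * ρ / c) • ζ.1 - η.1‖ := by linarith [hc.2]
    have h3 : 0 < 1 - ρ := by linarith
    unfold pker
    gcongr
    nlinarith [sq_nonneg (r * ρ / c)]
  · filter_upwards [hdiv] with c hc
    exact (continuous_pker_left hc.1 (hc.2.trans_lt hρ1) η).aestronglyMeasurable

/-! ### The maximal function over caps: domination of Poisson integrals, weak type, integrability.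
-/

/-- The maximal function over spherical caps (with rational radii). -/
def capMax {n : ℕ} (w : Sph n → ℝ≥0∞) (ξ : Sph n) : ℝ≥0∞ :=
  ⨆ q : {q : ℚ // 0 < q ∧ q ≤ 4},
    ENNReal.ofReal (((q.1 : ℝ) ^ (n - 1))⁻¹) * ∫⁻ η in Metric.closedBall ξ (q.1 : ℝ), w η ∂(surf n)

theorem measurable_setLIntegral_closedBall {n : ℕ} {S : Type*} [MeasurableSpace S]
    {W : S → Sph n → ℝ≥0∞} (hW : Measurable (Function.uncurry W)) {c : S → ℝ} (hc : Measurable c) :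
    Measurable fun p : S × Sph n => ∫⁻ η in Metric.closedBall p.2 (c p.1), W p.1 η ∂(surf n) := by
  have h : ∀ p : S × Sph n, ∫⁻ η in Metric.closedBall p.2 (c p.1), W p.1 η ∂(surf n) =
      ∫⁻ η, {x : (S × Sph n) × Sph n | dist x.2 x.1.2 ≤ c x.1.1}.indicator
        (fun x => W x.1.1 x.2) (p, η) ∂(surf n) := fun p => by
    rw [← lintegral_indicator Metric.isClosed_closedBall.measurableSet]
    rfl
  simp_rw [h]
  refine Measurable.lintegral_prod_right' (f := {x : (S × Sph n) × Sph n |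
    dist x.2 x.1.2 ≤ c x.1.1}.indicator (fun x => W x.1.1 x.2)) (Measurable.indicator ?_ ?_)
  · exact hW.comp (f := fun x : (S × Sph n) × Sph n => (x.1.1, x.2)) (by fun_prop)
  · exact measurableSet_le (by fun_prop) (by fun_prop)

theorem measurable_capMax {n : ℕ} {S : Type*} [MeasurableSpace S] {W : S → Sph n → ℝ≥0∞}
    (hW : Measurable (Function.uncurry W)) :
    Measurable fun p : S × Sph n => capMax (W p.1) p.2 := by
  unfold capMax
  exact Measurable.iSup fun q => measurable_const.mul
    (measurable_setLIntegral_closedBall hW measurable_const)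

theorem dist_le_two_sphere {n : ℕ} (ξ η : Sph n) : dist ξ η ≤ 2 := by
  have := dist_le_two_mul_norm_smul_sub le_rfl zero_le_one ξ η
  simpa using this

theorem setLIntegral_closedBall_le_capMax {n : ℕ} (w : Sph n → ℝ≥0∞) (ξ : Sph n) {ρ : ℝ}
    (hρ : 0 < ρ) :
    ∫⁻ η in Metric.closedBall ξ ρ, w η ∂(surf n) ≤
      ENNReal.ofReal ((2 * ρ) ^ (n - 1)) * capMax w ξ := by
  -- The sphere has diameter at most `2`, so `ρ` may be replaced by `min ρ 2`; a rational radius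
  -- below twice this number stays within the range up to `4` admitted in `capMax`.
  obtain ⟨q, hq1, hq2⟩ := exists_rat_btwn (show min ρ 2 < 2 * min ρ 2 by
    have : 0 < min ρ 2 := lt_min hρ two_pos
    linarith)
  have hq0 : (0 : ℝ) < q := (lt_min hρ two_pos).trans hq1
  have hq4 : (q : ℝ) ≤ 4 := by linarith [min_le_right ρ 2]
  have hqρ : (q : ℝ) ≤ 2 * ρ := by linarith [min_le_left ρ 2]
  have hsub : Metric.closedBall ξ ρ ⊆ Metric.closedBall ξ (q : ℝ) := fun η hη =>
    (le_min (Metric.mem_closedBall.1 hη) (dist_le_two_sphere η ξ)).trans hq1.le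
  have h1 := le_iSup (fun q : {q : ℚ // 0 < q ∧ q ≤ 4} => ENNReal.ofReal (((q.1 : ℝ) ^ (n - 1))⁻¹) *
    ∫⁻ η in Metric.closedBall ξ (q.1 : ℝ), w η ∂(surf n))
    ⟨q, by exact_mod_cast hq0, by exact_mod_cast hq4⟩
  refine (lintegral_mono_set hsub).trans ?_
  calc ∫⁻ η in Metric.closedBall ξ (q : ℝ), w η ∂(surf n)
      = ENNReal.ofReal ((q : ℝ) ^ (n - 1)) * (ENNReal.ofReal (((q : ℝ) ^ (n - 1))⁻¹) *
          ∫⁻ η in Metric.closedBall ξ (q : ℝ), w η ∂(surf n)) := by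
        rw [← mul_assoc, ← ENNReal.ofReal_mul (by positivity), mul_inv_cancel₀ (by positivity),
          ENNReal.ofReal_one, one_mul]
    _ ≤ _ := by
        gcongr
        exact h1

/-- The range `(m, 2m]` alone suffices. The bound serves to dominate a kernel that decreases with
the distance by a superposition of indicators of caps of radius `ρ`. -/
theorem ofReal_inv_pow_le_lintegral (n : ℕ) {m : ℝ} (hm : 0 < m) :
    ENNReal.ofReal ((m ^ n)⁻¹) ≤
      ENNReal.ofReal (2 ^ (n + 1)) * ∫⁻ ρ in Set.Ioi m, ENNReal.ofReal ((ρ ^ (n + 1))⁻¹) := by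
  calc ENNReal.ofReal ((m ^ n)⁻¹)
      = ENNReal.ofReal (2 ^ (n + 1)) *
          ∫⁻ _ in Set.Ioc m (2 * m), ENNReal.ofReal (((2 * m) ^ (n + 1))⁻¹) := by
        rw [setLIntegral_const, Real.volume_Ioc, ← ENNReal.ofReal_mul (by positivity),
          ← ENNReal.ofReal_mul (by positivity)]
        congr 1
        rw [mul_pow, pow_succ m]
        field_simp
        ring
    _ ≤ ENNReal.ofReal (2 ^ (n + 1)) *
          ∫⁻ ρ in Set.Ioc m (2 * m), ENNReal.ofReal ((ρ ^ (n + 1))⁻¹) := by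
        refine mul_le_mul' le_rfl ?_
        refine setLIntegral_mono' measurableSet_Ioc fun ρ hρ => ?_
        have : 0 < ρ := hm.trans hρ.1
        gcongr
        exact hρ.2
    _ ≤ _ := mul_le_mul' le_rfl (lintegral_mono_set Set.Ioc_subset_Ioi_self)

theorem lintegral_Ioi_inv_sq {δ : ℝ} (hδ : 0 < δ) :
    ∫⁻ ρ in Set.Ioi δ, ENNReal.ofReal ((ρ ^ 2)⁻¹) = ENNReal.ofReal δ⁻¹ := by
  have h1 : ∀ ρ ∈ Set.Ioi δ, (ρ ^ 2)⁻¹ = ρ ^ (-2 : ℝ) := fun ρ hρ => by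
    have : 0 < ρ := hδ.trans hρ
    rw [Real.rpow_neg this.le, ← Real.rpow_natCast]
    norm_num
  have h2 := integrableOn_Ioi_rpow_of_lt (show (-2 : ℝ) < -1 by norm_num) hδ
  rw [setLIntegral_congr_fun measurableSet_Ioi fun ρ hρ => by rw [h1 ρ hρ],
    ← ofReal_integral_eq_lintegral_ofReal h2, integral_Ioi_rpow_of_lt (by norm_num) hδ]
  · norm_num [Real.rpow_neg_one]
  · filter_upwards [ae_restrict_mem measurableSet_Ioi] with ρ hρ
    exact Real.rpow_nonneg (hδ.trans hρ).le _

/-- Poisson integrals are dominated by the maximal function. -/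
theorem exists_lintegral_pker_le_capMax {n : ℕ} (hn : 0 < n) : ∃ C : ℝ, 0 < C ∧
    ∀ (w : Sph n → ℝ≥0∞), Measurable w → ∀ (r : ℝ), 0 ≤ r → r < 1 → ∀ ξ : Sph n,
      ∫⁻ η, ENNReal.ofReal (pker r ξ.1 η.1) * w η ∂(surf n) ≤ ENNReal.ofReal C * capMax w ξ := by
  have hσ := sigma_pos hn
  refine ⟨1 / sigma n * (2 * 2 ^ n) * (2 ^ (n + 1) * 2 ^ (n - 1)), by positivity,
    fun w hw r hr hr1 ξ => ?_⟩
  set δ := 1 - r with hδdef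
  have hδ : 0 < δ := by linarith
  set c : ℝ := 1 / sigma n * (2 * 2 ^ n) * δ with hc
  have hc0 : 0 ≤ c := by positivity
  -- The denominator `‖rξ - η‖` is at least `1 - r` and at least half the distance from `ξ` to `η`,
  -- while `1 - r² ≤ 2δ`.
  have hker : ∀ η : Sph n, pker r ξ.1 η.1 ≤ c * ((max δ (dist ξ η)) ^ n)⁻¹ := by
    intro η
    have h1 := one_sub_le_norm_smul_sub hr ξ η
    have h2 := dist_le_two_mul_norm_smul_sub hr hr1.le ξ η
    have h3 : max δ (dist ξ η) ≤ 2 * ‖r • ξ.1 - η.1‖ := max_le (by linarith) h2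
    have h4 : 0 < max δ (dist ξ η) := lt_max_of_lt_left hδ
    have h6 : 0 < ‖r • ξ.1 - η.1‖ := by linarith
    calc pker r ξ.1 η.1 = 1 / sigma n * (2 ^ n * ((1 - r ^ 2) * ((2 * ‖r • ξ.1 - η.1‖) ^ n)⁻¹)) := by
          rw [pker, mul_pow]
          field_simp
      _ ≤ 1 / sigma n * (2 ^ n * ((2 * δ) * ((max δ (dist ξ η)) ^ n)⁻¹)) := by
          gcongr
          nlinarith
      _ = _ := by rw [hc]; ring
  have hind : ∀ η : Sph n, ENNReal.ofReal (((max δ (dist ξ η)) ^ n)⁻¹) ≤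
      ENNReal.ofReal (2 ^ (n + 1)) * ∫⁻ ρ in Set.Ioi δ, (Metric.closedBall ξ ρ).indicator
        (fun _ => ENNReal.ofReal ((ρ ^ (n + 1))⁻¹)) η := by
    intro η
    refine (ofReal_inv_pow_le_lintegral n (lt_max_of_lt_left hδ)).trans ?_
    refine mul_le_mul' le_rfl ?_
    calc ∫⁻ ρ in Set.Ioi (max δ (dist ξ η)), ENNReal.ofReal ((ρ ^ (n + 1))⁻¹)
        = ∫⁻ ρ in Set.Ioi (max δ (dist ξ η)), (Metric.closedBall ξ ρ).indicator
          (fun _ => ENNReal.ofReal ((ρ ^ (n + 1))⁻¹)) η := by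
          refine setLIntegral_congr_fun measurableSet_Ioi fun ρ hρ => ?_
          have h5 : η ∈ Metric.closedBall ξ ρ := by
            rw [Metric.mem_closedBall, dist_comm]
            exact (le_max_right _ _).trans (le_of_lt hρ)
          simp only [Set.indicator_of_mem h5]
      _ ≤ _ := lintegral_mono_set (Set.Ioi_subset_Ioi (le_max_left _ _))
  have hmeas : Measurable (Function.uncurry fun (η : Sph n) (ρ : ℝ) =>
      (Metric.closedBall ξ ρ).indicator (fun _ => ENNReal.ofReal ((ρ ^ (n + 1))⁻¹)) η * w η) := by
    have : MeasurableSet {x : Sph n × ℝ | dist x.1 ξ ≤ x.2} :=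
      measurableSet_le (by fun_prop) (by fun_prop)
    exact (Measurable.indicator (f := fun x : Sph n × ℝ => ENNReal.ofReal ((x.2 ^ (n + 1))⁻¹))
      (by fun_prop) this).mul (by fun_prop)
  calc ∫⁻ η, ENNReal.ofReal (pker r ξ.1 η.1) * w η ∂(surf n)
      ≤ ∫⁻ η, ENNReal.ofReal (c * 2 ^ (n + 1)) * (∫⁻ ρ in Set.Ioi δ,
          (Metric.closedBall ξ ρ).indicator (fun _ => ENNReal.ofReal ((ρ ^ (n + 1))⁻¹)) η * w η)
            ∂(surf n) := by
        refine lintegral_mono fun η => ?_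
        have hm1 : Measurable fun ρ : ℝ => (Metric.closedBall ξ ρ).indicator
            (fun _ => ENNReal.ofReal ((ρ ^ (n + 1))⁻¹)) η :=
          Measurable.indicator (s := {ρ : ℝ | dist η ξ ≤ ρ})
            (f := fun ρ : ℝ => ENNReal.ofReal ((ρ ^ (n + 1))⁻¹)) (by fun_prop) measurableSet_Ici
        rw [lintegral_mul_const _ hm1, ← mul_assoc]
        gcongr
        refine (ENNReal.ofReal_le_ofReal (hker η)).trans ?_
        rw [ENNReal.ofReal_mul hc0, ENNReal.ofReal_mul hc0, mul_assoc]
        gcongr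
        exact hind η
    _ = ENNReal.ofReal (c * 2 ^ (n + 1)) * ∫⁻ ρ in Set.Ioi δ, ENNReal.ofReal ((ρ ^ (n + 1))⁻¹) *
          ∫⁻ η in Metric.closedBall ξ ρ, w η ∂(surf n) := by
        have hm2 : Measurable fun η : Sph n => ∫⁻ ρ in Set.Ioi δ, (Metric.closedBall ξ ρ).indicator
            (fun _ => ENNReal.ofReal ((ρ ^ (n + 1))⁻¹)) η * w η := hmeas.lintegral_prod_right'
        rw [lintegral_const_mul _ hm2, lintegral_lintegral_swap
          hmeas.aemeasurable]
        congr 1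
        refine lintegral_congr fun ρ => ?_
        rw [← lintegral_const_mul _ hw, ← lintegral_indicator Metric.isClosed_closedBall.measurableSet]
        refine lintegral_congr fun η => ?_
        by_cases h : η ∈ Metric.closedBall ξ ρ <;> simp [h]
    -- A cap of radius `ρ` contributes `ρ^{n-1}` times the maximal function, which against
    -- `ρ^{-(n+1)}` leaves `ρ^{-2}`. Its integral over `(δ, ∞)` is `1/δ` and cancels the factor `δ`
    -- in `c`.
    _ ≤ ENNReal.ofReal (c * 2 ^ (n + 1)) * ∫⁻ ρ in Set.Ioi δ,
          ENNReal.ofReal (2 ^ (n - 1)) * capMax w ξ * ENNReal.ofReal ((ρ ^ 2)⁻¹) := by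
        refine mul_le_mul' le_rfl ?_
        refine setLIntegral_mono' measurableSet_Ioi fun ρ hρ => ?_
        have hρ0 : 0 < ρ := hδ.trans hρ
        refine (mul_le_mul' le_rfl (setLIntegral_closedBall_le_capMax w ξ hρ0)).trans (le_of_eq ?_)
        rw [← mul_assoc, ← ENNReal.ofReal_mul (by positivity), mul_right_comm,
          ← ENNReal.ofReal_mul (by positivity)]
        congr 2
        obtain ⟨k, rfl⟩ : ∃ k, n = k + 1 := ⟨n - 1, by omega⟩
        rw [Nat.add_sub_cancel, mul_pow]
        field_simp
        ring
    _ = _ := by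
        rw [lintegral_const_mul _ (by fun_prop), lintegral_Ioi_inv_sq hδ, mul_right_comm (ENNReal.ofReal (2 ^ (n - 1))),
          ← mul_assoc, ← ENNReal.ofReal_mul (by positivity), ← ENNReal.ofReal_mul (by positivity)]
        congr 2
        rw [hc]
        field_simp

/-- The weak type `(1, 1)` inequality for the maximal function. -/
theorem exists_mul_meas_capMax_le {n : ℕ} (hn : 0 < n) : ∃ C : ℝ, 0 < C ∧
    ∀ (w : Sph n → ℝ≥0∞) (lam : ℝ≥0∞),
      lam * surf n {ξ | lam < capMax w ξ} ≤ ENNReal.ofReal C * ∫⁻ η, w η ∂(surf n) := by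
  obtain ⟨A, hA, hcap⟩ := exists_surf_closedBall_le hn
  refine ⟨A * 5 ^ (n - 1), by positivity, fun w lam => ?_⟩
  -- The caps witnessing a large maximal function. Their radii are bounded, so the Vitali lemma
  -- extracts disjoint caps whose fivefold enlargements cover the superlevel set; this is the source
  -- of `5 ^ (n - 1)`.
  set t : Set (Sph n × ℚ) := {a | 0 < a.2 ∧ a.2 ≤ 4 ∧ lam * ENNReal.ofReal ((a.2 : ℝ) ^ (n - 1)) ≤
    ∫⁻ η in Metric.closedBall a.1 (a.2 : ℝ), w η ∂(surf n)}
  obtain ⟨u, hut, hdisj, hcov⟩ := Vitali.exists_disjoint_subfamily_covering_enlargement_closedBall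
    t (fun a => a.1) (fun a => (a.2 : ℝ)) 4 (fun a ha => by exact_mod_cast ha.2.1) 5 (by norm_num)
  have hu : u.Countable := hdisj.countable_of_nonempty_interior fun a ha => by
    have : (0 : ℝ) < a.2 := by exact_mod_cast (hut ha).1
    exact ⟨a.1, Metric.ball_subset_interior_closedBall (Metric.mem_ball_self this)⟩
  have hsub : {ξ | lam < capMax w ξ} ⊆ ⋃ b ∈ u, Metric.closedBall b.1 (5 * (b.2 : ℝ)) := by
    intro ξ hξ
    obtain ⟨q, hq⟩ := lt_iSup_iff.1 (show lam < capMax w ξ from hξ)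
    have hq0 : (0 : ℝ) < q.1 := by exact_mod_cast q.2.1
    have hmem : (ξ, q.1) ∈ t := by
      refine ⟨q.2.1, q.2.2, ?_⟩
      calc lam * ENNReal.ofReal ((q.1 : ℝ) ^ (n - 1))
          ≤ (ENNReal.ofReal (((q.1 : ℝ) ^ (n - 1))⁻¹) *
            ∫⁻ η in Metric.closedBall ξ (q.1 : ℝ), w η ∂(surf n)) *
            ENNReal.ofReal ((q.1 : ℝ) ^ (n - 1)) := by gcongr
        _ = _ := by
          rw [mul_right_comm, ← ENNReal.ofReal_mul (by positivity), inv_mul_cancel₀ (by positivity),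
            ENNReal.ofReal_one, one_mul]
    obtain ⟨b, hb, hbsub⟩ := hcov _ hmem
    exact Set.mem_biUnion hb (hbsub (Metric.mem_closedBall_self hq0.le))
  have := hu.to_subtype
  calc lam * surf n {ξ | lam < capMax w ξ}
      ≤ lam * ∑' b : u, surf n (Metric.closedBall b.1.1 (5 * (b.1.2 : ℝ))) := by
        gcongr
        exact (measure_mono hsub).trans (measure_biUnion_le _ hu _)
    _ = ∑' b : u, lam * surf n (Metric.closedBall b.1.1 (5 * (b.1.2 : ℝ))) := by
        rw [ENNReal.tsum_mul_left]
    _ ≤ ∑' b : u, ENNReal.ofReal (A * 5 ^ (n - 1)) *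
          ∫⁻ η in Metric.closedBall b.1.1 (b.1.2 : ℝ), w η ∂(surf n) := by
        refine ENNReal.tsum_le_tsum fun b => ?_
        have hb := hut b.2
        have hq0 : (0 : ℝ) < b.1.2 := by exact_mod_cast hb.1
        refine (mul_le_mul' le_rfl (hcap b.1.1 _ (by positivity))).trans ?_
        refine le_trans (le_of_eq ?_) (mul_le_mul' le_rfl hb.2.2)
        rw [mul_left_comm, ← ENNReal.ofReal_mul (by positivity)]
        congr 2
        ring
    _ = ENNReal.ofReal (A * 5 ^ (n - 1)) *
          ∫⁻ η in ⋃ b ∈ u, Metric.closedBall b.1 (b.2 : ℝ), w η ∂(surf n) := by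
        rw [ENNReal.tsum_mul_left, lintegral_biUnion hu
          (fun b _ => Metric.isClosed_closedBall.measurableSet) hdisj]
    _ ≤ _ := mul_le_mul' le_rfl (setLIntegral_le_lintegral _ _)

/-- Dyadic layer cake: if `2^k < x ≤ 2^(k+1)`, the term with index `k` is already enough, and for `x
= ∞` the series diverges. It converts bounds for superlevel sets into a bound for an integral. -/
theorem le_one_add_tsum_indicator (x : ℝ≥0∞) :
    x ≤ 1 + ∑' k : ℕ, if (2 : ℝ≥0∞) ^ k < x then (2 : ℝ≥0∞) ^ (k + 1) else 0 := by
  by_cases h1 : x ≤ 1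
  · exact h1.trans le_self_add
  push Not at h1
  by_cases hx : ∃ k : ℕ, x ≤ 2 ^ k
  · classical
    set m := Nat.find hx with hm
    have hm1 : x ≤ 2 ^ m := Nat.find_spec hx
    obtain ⟨k, hk⟩ : ∃ k, m = k + 1 := ⟨m - 1, by
      rcases Nat.eq_zero_or_pos m with h | h
      · rw [h, pow_zero] at hm1
        exact absurd h1 (not_lt.2 hm1)
      · omega⟩
    have hlt : (2 : ℝ≥0∞) ^ k < x := not_le.1 (Nat.find_min hx (by omega))
    refine le_trans ?_ (le_add_left (ENNReal.le_tsum k))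
    rw [if_pos hlt, ← hk]
    exact hm1
  · push Not at hx
    have : x = ∞ := by
      by_contra hne
      obtain ⟨k, hk⟩ := ENNReal.exists_nat_gt hne
      refine absurd (hx k) (not_lt.2 (hk.le.trans ?_))
      exact_mod_cast (Nat.lt_two_pow_self (n := k)).le
    subst this
    simp only [hx, if_true]
    refine le_add_left ?_
    rw [← ENNReal.tsum_const_eq_top_of_ne_zero (α := ℕ) one_ne_zero]
    exact ENNReal.tsum_le_tsum fun k => one_le_pow₀ one_le_two

/-- Sublinearity of the maximal operator. The factor `A` appears because `capMax` divides by a power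
of the radius and not by the measure of the cap. -/
theorem capMax_le_of_le_add {n : ℕ} (hn : 0 < n) : ∃ A : ℝ, 0 < A ∧
    ∀ (w v : Sph n → ℝ≥0∞) (c d : ℝ≥0∞), Measurable v → (∀ η, w η ≤ c + d * v η) →
      ∀ ξ, capMax w ξ ≤ ENNReal.ofReal A * c + d * capMax v ξ := by
  obtain ⟨A, hA, hcap⟩ := exists_surf_closedBall_le hn
  refine ⟨A, hA, fun w v c d hv h ξ => iSup_le fun q => ?_⟩
  have hq0 : (0 : ℝ) < q.1 := by exact_mod_cast q.2.1
  have h1 : ∫⁻ η in Metric.closedBall ξ (q.1 : ℝ), w η ∂(surf n) ≤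
      c * ENNReal.ofReal (A * (q.1 : ℝ) ^ (n - 1)) +
        d * ∫⁻ η in Metric.closedBall ξ (q.1 : ℝ), v η ∂(surf n) := by
    refine (lintegral_mono h).trans ?_
    rw [lintegral_add_left measurable_const, setLIntegral_const, lintegral_const_mul _ hv]
    gcongr
    exact hcap ξ _ hq0
  refine (mul_le_mul' le_rfl h1).trans ?_
  rw [mul_add]
  gcongr ?_ + ?_
  · rw [mul_left_comm, ← ENNReal.ofReal_mul (by positivity), mul_comm]
    gcongr
    rw [mul_left_comm, inv_mul_cancel₀ (by positivity), mul_one]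
  · rw [mul_left_comm]
    gcongr
    exact le_iSup (fun q : {q : ℚ // 0 < q ∧ q ≤ 4} => ENNReal.ofReal (((q.1 : ℝ) ^ (n - 1))⁻¹) *
      ∫⁻ η in Metric.closedBall ξ (q.1 : ℝ), v η ∂(surf n)) q

theorem measurable_capMax_right {n : ℕ} {w : Sph n → ℝ≥0∞} (hw : Measurable w) :
    Measurable (capMax w) := by
  have h := measurable_capMax (S := Unit) (W := fun _ => w) (hw.comp measurable_snd)
  exact h.comp (g := fun p : Unit × Sph n => capMax w p.2) (f := fun ξ => ((), ξ)) (by fun_prop)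

/-- Truncation at height `b`: above it, `1 ≤ (x/b)^(q-1)`. The part of `w` above `b` is thereby
controlled by the integrable function `w^q`, to which the weak type inequality applies. -/
theorem le_ofReal_add_mul_rpow {b q : ℝ} (hb : 0 < b) (hq : 1 < q) (x : ℝ≥0∞) :
    x ≤ ENNReal.ofReal b + ENNReal.ofReal ((b ^ (q - 1))⁻¹) * x ^ q := by
  rcases le_or_gt x (ENNReal.ofReal b) with h | h
  · exact h.trans le_self_add
  · refine le_add_left ?_
    have hκ : 0 < b ^ (q - 1) := Real.rpow_pos_of_pos hb _
    calc x = ENNReal.ofReal ((b ^ (q - 1))⁻¹) * (ENNReal.ofReal (b ^ (q - 1)) * x) := by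
          rw [← mul_assoc, ← ENNReal.ofReal_mul (by positivity), inv_mul_cancel₀ hκ.ne',
            ENNReal.ofReal_one, one_mul]
      _ ≤ ENNReal.ofReal ((b ^ (q - 1))⁻¹) * (x ^ (q - 1) * x ^ (1 : ℝ)) := by
          rw [← ENNReal.ofReal_rpow_of_pos hb, ENNReal.rpow_one]
          gcongr
      _ = _ := by
          rw [← ENNReal.rpow_add_of_nonneg _ _ (by linarith) zero_le_one, sub_add_cancel]

/-- The maximal function of a function in `L^q`, `q > 1`, is integrable. -/
theorem exists_lintegral_capMax_le {n : ℕ} (hn : 0 < n) {q : ℝ} (hq : 1 < q) :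
    ∃ C : ℝ, 0 < C ∧ ∀ w : Sph n → ℝ≥0∞, Measurable w →
      ∫⁻ ξ, capMax w ξ ∂(surf n) ≤ ENNReal.ofReal C * (1 + ∫⁻ ξ, w ξ ^ q ∂(surf n)) := by
  obtain ⟨C, hC, hweak⟩ := exists_mul_meas_capMax_le hn
  obtain ⟨A, hA, hadd⟩ := capMax_le_of_le_add hn
  have hσ := sigma_pos hn
  -- Truncating `w` at height `c 2^k`, the bounded part contributes at most `A c 2^k = 2^k/2` to the
  -- maximal function. Where `capMax w` exceeds `2^k`, the maximal function of `w^q` must then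
  -- exceed `κ_k 2^k/2`, so the `k`-th layer has size of order `1/κ_k`; this is summable because `q
  -- > 1`.
  set c : ℝ := (2 * A)⁻¹
  have hc : 0 < c := by positivity
  set κ : ℕ → ℝ := fun k => (c * 2 ^ k) ^ (q - 1) with hκdef
  have hκ : ∀ k, 0 < κ k := fun k => Real.rpow_pos_of_pos (by positivity) _
  have hsum : Summable fun k => (κ k)⁻¹ := by
    have h1 : ∀ k, (κ k)⁻¹ = (c ^ (q - 1))⁻¹ * (((2 : ℝ) ^ (q - 1))⁻¹) ^ k := fun k => by
      rw [hκdef]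
      simp only
      rw [Real.mul_rpow hc.le (by positivity), mul_inv, ← Real.rpow_natCast, ← Real.rpow_mul
        zero_le_two, mul_comm (k : ℝ), Real.rpow_mul zero_le_two, Real.rpow_natCast, inv_pow]
    simp_rw [h1]
    refine (summable_geometric_of_lt_one (by positivity) (inv_lt_one_of_one_lt₀ ?_)).mul_left _
    exact Real.one_lt_rpow one_lt_two (by linarith)
  set T := ∑' k, (κ k)⁻¹
  have hT : 0 ≤ T := tsum_nonneg fun k => (inv_pos.2 (hκ k)).le
  refine ⟨sigma n + 4 * C * T, by positivity, fun w hw => ?_⟩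
  set I := ∫⁻ ξ, w ξ ^ q ∂(surf n)
  have hterm : ∀ k : ℕ, (2 : ℝ≥0∞) ^ (k + 1) * surf n {ξ | (2 : ℝ≥0∞) ^ k < capMax w ξ} ≤
      ENNReal.ofReal (4 * C) * I * ENNReal.ofReal (κ k)⁻¹ := by
    intro k
    have h2k : (2 : ℝ≥0∞) ^ k = ENNReal.ofReal (2 ^ k) := by
      rw [ENNReal.ofReal_pow zero_le_two]
      simp
    have hpt : ∀ ξ, capMax w ξ ≤ ENNReal.ofReal (2 ^ k / 2) +
        ENNReal.ofReal (κ k)⁻¹ * capMax (fun η => w η ^ q) ξ := fun ξ => by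
      refine (hadd w (fun η => w η ^ q) (ENNReal.ofReal (c * 2 ^ k)) (ENNReal.ofReal (κ k)⁻¹)
        (hw.pow_const q) (fun η => le_ofReal_add_mul_rpow (by positivity) hq _) ξ).trans (le_of_eq ?_)
      rw [← ENNReal.ofReal_mul hA.le]
      congr 2
      simp only [c]
      field_simp
    set lam : ℝ := κ k * (2 ^ k / 2)
    have hlam : 0 < lam := by have := hκ k; positivity
    have hsub : {ξ | (2 : ℝ≥0∞) ^ k < capMax w ξ} ⊆
        {ξ | ENNReal.ofReal lam < capMax (fun η => w η ^ q) ξ} := by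
      intro ξ hξ
      by_contra hcon
      simp only [Set.mem_ofPred_eq, not_lt] at hcon hξ
      have h1 := hξ.trans_le (hpt ξ)
      refine absurd h1 (not_lt.2 ?_)
      calc ENNReal.ofReal (2 ^ k / 2) + ENNReal.ofReal (κ k)⁻¹ * capMax (fun η => w η ^ q) ξ
          ≤ ENNReal.ofReal (2 ^ k / 2) + ENNReal.ofReal (κ k)⁻¹ * ENNReal.ofReal lam := by gcongr
        _ = (2 : ℝ≥0∞) ^ k := by
          rw [← ENNReal.ofReal_mul (inv_pos.2 (hκ k)).le, ← ENNReal.ofReal_add (by positivity)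
            (mul_nonneg (inv_pos.2 (hκ k)).le hlam.le), h2k]
          congr 1
          simp only [lam]
          rw [inv_mul_cancel_left₀ (hκ k).ne']
          ring
    have hw1 := hweak (fun η => w η ^ q) (ENNReal.ofReal lam)
    calc (2 : ℝ≥0∞) ^ (k + 1) * surf n {ξ | (2 : ℝ≥0∞) ^ k < capMax w ξ}
        ≤ (2 : ℝ≥0∞) ^ (k + 1) *
            surf n {ξ | ENNReal.ofReal lam < capMax (fun η => w η ^ q) ξ} := by gcongr
      _ = ENNReal.ofReal (4 * (κ k)⁻¹) * (ENNReal.ofReal lam *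
            surf n {ξ | ENNReal.ofReal lam < capMax (fun η => w η ^ q) ξ}) := by
          have h2 : (2 : ℝ≥0∞) ^ (k + 1) = ENNReal.ofReal (2 ^ k * 2) := by
            rw [pow_succ, h2k, ENNReal.ofReal_mul (by positivity)]
            simp
          rw [← mul_assoc, ← ENNReal.ofReal_mul (by have := hκ k; positivity), h2]
          congr 2
          simp only [lam]
          rw [mul_assoc 4, inv_mul_cancel_left₀ (hκ k).ne']
          ring
      _ ≤ ENNReal.ofReal (4 * (κ k)⁻¹) * (ENNReal.ofReal C * I) := mul_le_mul' le_rfl hw1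
      _ = _ := by
          rw [← mul_assoc, mul_right_comm _ I, ← ENNReal.ofReal_mul (by have := hκ k; positivity),
            ← ENNReal.ofReal_mul (by positivity)]
          congr 2
          ring
  have hset : ∀ k : ℕ, MeasurableSet {ξ | (2 : ℝ≥0∞) ^ k < capMax w ξ} := fun k =>
    measurableSet_lt measurable_const (measurable_capMax_right hw)
  calc ∫⁻ ξ, capMax w ξ ∂(surf n)
      ≤ ∫⁻ ξ, (1 + ∑' k : ℕ, {ξ | (2 : ℝ≥0∞) ^ k < capMax w ξ}.indicator
          (fun _ => (2 : ℝ≥0∞) ^ (k + 1)) ξ) ∂(surf n) := by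
        refine lintegral_mono fun ξ => (le_one_add_tsum_indicator _).trans (le_of_eq ?_)
        simp only [Set.indicator_apply, Set.mem_ofPred_eq]
    _ = surf n Set.univ + ∑' k : ℕ, (2 : ℝ≥0∞) ^ (k + 1) *
          surf n {ξ | (2 : ℝ≥0∞) ^ k < capMax w ξ} := by
        rw [lintegral_add_left measurable_const, lintegral_one, lintegral_tsum fun k =>
          (measurable_const.indicator (hset k)).aemeasurable]
        congr 2
        ext k
        rw [lintegral_indicator_const (hset k)]
    _ ≤ ENNReal.ofReal (sigma n) + ∑' k : ℕ, ENNReal.ofReal (4 * C) * I * ENNReal.ofReal (κ k)⁻¹ := by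
        rw [surf_univ hn]
        exact add_le_add le_rfl (ENNReal.tsum_le_tsum hterm)
    _ = ENNReal.ofReal (sigma n) + ENNReal.ofReal (4 * C * T) * I := by
        rw [ENNReal.tsum_mul_left, ← ENNReal.ofReal_tsum_of_nonneg
          (fun k => (inv_pos.2 (hκ k)).le) hsum, mul_right_comm, ← ENNReal.ofReal_mul (by positivity)]
    _ ≤ _ := by
        rw [mul_add, mul_one]
        gcongr
        · exact le_add_of_nonneg_right (by positivity)
        · exact le_add_of_nonneg_left hσ.le

/-! ### Almost everywhere boundary values of Poisson integrals. -/

/-- The Poisson integral, in complex-valued form. -/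
def pint {n : ℕ} (ψ : Sph n → ℂ) (r : ℝ) (ξ : Sph n) : ℂ := ∫ η, pker r ξ.1 η.1 • ψ η ∂(surf n)

theorem integrable_pker_smul {n : ℕ} {r : ℝ} (hr : 0 ≤ r) (hr1 : r < 1)
    {ψ : Sph n → ℂ} (hψ : Integrable ψ (surf n)) (ξ : Sph n) :
    Integrable (fun η => pker r ξ.1 η.1 • ψ η) (surf n) := by
  have hc := continuous_pker_right hr hr1 ξ
  obtain ⟨B, hB⟩ := isCompact_univ.exists_bound_of_continuousOn hc.continuousOn
  exact hψ.bdd_smul B hc.aestronglyMeasurable (Eventually.of_forall fun η => hB η trivial)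

theorem enorm_pint_le {n : ℕ} (hn : 0 < n) {r : ℝ} (hr : 0 ≤ r) (hr1 : r < 1) (ψ : Sph n → ℂ)
    (ξ : Sph n) :
    ‖pint ψ r ξ‖ₑ ≤ ∫⁻ η, ENNReal.ofReal (pker r ξ.1 η.1) * ‖ψ η‖ₑ ∂(surf n) := by
  refine (enorm_integral_le_lintegral_enorm _).trans (le_of_eq ?_)
  refine lintegral_congr fun η => ?_
  rw [enorm_smul, Real.enorm_of_nonneg (pker_pos hn hr hr1 ξ η).le]

/-- Poisson integrals of integrable functions converge almost everywhere. -/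
theorem ae_tendsto_pint {n : ℕ} (hn : 0 < n) {ψ : Sph n → ℂ} (hψ : Integrable ψ (surf n))
    (hm : Measurable ψ) :
    ∀ᵐ ξ ∂(surf n), Tendsto (fun r => pint ψ r ξ) (𝓝[<] 1) (𝓝 (ψ ξ)) := by
  obtain ⟨C, hC, hweak⟩ := exists_mul_meas_capMax_le hn
  obtain ⟨C', hC', hdom⟩ := exists_lintegral_pker_le_capMax hn
  -- Continuous approximants with `L^1` error `4^{-k}`, compared with thresholds `2^{-k}`: the sets
  -- where the error or its maximal function is large have measure of order `2^{-k}`, and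
  -- Borel–Cantelli discards them.
  have happ : ∀ k : ℕ, ∃ h : Sph n → ℂ, Continuous h ∧
      ∫⁻ x, ‖ψ x - h x‖ₑ ∂(surf n) ≤ ENNReal.ofReal ((1 / 4) ^ k) := fun k => by
    obtain ⟨h, -, h1, h2, -⟩ := hψ.exists_hasCompactSupport_lintegral_sub_le
      (ε := ENNReal.ofReal ((1 / 4) ^ k)) (by simp)
    exact ⟨h, h2, h1⟩
  choose h hcont happ using happ
  set w : ℕ → Sph n → ℝ≥0∞ := fun k x => ‖ψ x - h k x‖ₑ
  have hw : ∀ k, Measurable (w k) := fun k => (hm.sub (hcont k).measurable).enorm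
  set lam : ℕ → ℝ≥0∞ := fun k => ENNReal.ofReal ((1 / 2) ^ k)
  have hlam : ∀ k, lam k ≠ 0 := fun k => by simp [lam]
  have hquot : ∀ k, ENNReal.ofReal ((1 / 4) ^ k) / lam k = ENNReal.ofReal ((1 / 2) ^ k) := fun k => by
    rw [← ENNReal.ofReal_div_of_pos (by positivity), ← div_pow]
    norm_num
  have hsum : ∑' k : ℕ, ENNReal.ofReal ((1 / 2) ^ k) ≠ ∞ := by
    rw [← ENNReal.ofReal_tsum_of_nonneg (fun k => by positivity) summable_geometric_two]
    exact ENNReal.ofReal_ne_top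
  have h1 : ∀ k, surf n {ξ | lam k < capMax (w k) ξ} ≤
      ENNReal.ofReal C * ENNReal.ofReal ((1 / 2) ^ k) := fun k => by
    rw [← hquot, ← mul_div_assoc, ENNReal.le_div_iff_mul_le (.inl (hlam k)) (.inl ENNReal.ofReal_ne_top),
      mul_comm]
    exact (hweak (w k) (lam k)).trans (mul_le_mul' le_rfl (happ k))
  have h2 : ∀ k, surf n {ξ | lam k ≤ w k ξ} ≤ ENNReal.ofReal ((1 / 2) ^ k) := fun k => by
    rw [← hquot, ENNReal.le_div_iff_mul_le (.inl (hlam k)) (.inl ENNReal.ofReal_ne_top), mul_comm]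
    exact (mul_meas_ge_le_lintegral (hw k) (lam k)).trans (happ k)
  have hae1 : ∀ᵐ ξ ∂(surf n), ∀ᶠ k in atTop, ξ ∉ {ξ | lam k < capMax (w k) ξ} := by
    refine ae_eventually_notMem (ne_top_of_le_ne_top ?_ (ENNReal.tsum_le_tsum h1))
    rw [ENNReal.tsum_mul_left]
    exact ENNReal.mul_ne_top ENNReal.ofReal_ne_top hsum
  have hae2 : ∀ᵐ ξ ∂(surf n), ∀ᶠ k in atTop, ξ ∉ {ξ | lam k ≤ w k ξ} :=
    ae_eventually_notMem (ne_top_of_le_ne_top hsum (ENNReal.tsum_le_tsum h2))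
  filter_upwards [hae1, hae2] with ξ hξ1 hξ2
  rw [Metric.tendsto_nhds]
  intro ε hε
  have hgeo : Tendsto (fun k : ℕ => (C' + 1) * (1 / 2 : ℝ) ^ k) atTop (𝓝 ((C' + 1) * 0)) :=
    (tendsto_pow_atTop_nhds_zero_of_lt_one (by norm_num) (by norm_num)).const_mul _
  rw [mul_zero] at hgeo
  obtain ⟨k, hk1, hk2, hk3⟩ := (hξ1.and (hξ2.and (hgeo.eventually (gt_mem_nhds (half_pos hε))))).exists
  simp only [not_lt, not_le] at hk1 hk2
  obtain ⟨B, hB⟩ := isCompact_univ.exists_bound_of_continuousOn (hcont k).continuousOn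
  have hlim := tendsto_integral_pker_smul hn (k := fun _ => h k) (ξ := ξ) (L := h k ξ) (B := B)
    ((hcont k).continuousAt.tendsto.comp tendsto_snd)
    (Eventually.of_forall fun _ ζ => hB ζ trivial)
    (Eventually.of_forall fun _ => (hcont k).aestronglyMeasurable)
  simp_rw [pker_comm _ _ ξ] at hlim
  have hev := (Metric.tendsto_nhds.1 hlim) (ε / 2) (half_pos hε)
  filter_upwards [hev, Ioo_mem_nhdsLT one_pos] with r hr hr01
  have hsub : pint ψ r ξ = pint (fun η => ψ η - h k η) r ξ + pint (h k) r ξ := by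
    unfold pint
    rw [← integral_add]
    · refine integral_congr_ae (Eventually.of_forall fun η => ?_)
      simp only
      rw [← smul_add, sub_add_cancel]
    · exact integrable_pker_smul hr01.1.le hr01.2
        (hψ.sub (integrable_of_continuous_sphere (hcont k))) ξ
    · exact integrable_pker_smul hr01.1.le hr01.2 (integrable_of_continuous_sphere (hcont k)) ξ
  have e1 : ‖pint (fun η => ψ η - h k η) r ξ‖ ≤ C' * (1 / 2) ^ k := by
    rw [← ENNReal.ofReal_le_ofReal_iff (by positivity), ofReal_norm,
      ENNReal.ofReal_mul hC'.le]
    refine (enorm_pint_le hn hr01.1.le hr01.2 _ ξ).trans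
      ((hdom (w k) (hw k) r hr01.1.le hr01.2 ξ).trans ?_)
    exact mul_le_mul' le_rfl hk1
  have e2 : ‖h k ξ - ψ ξ‖ ≤ (1 / 2) ^ k := by
    rw [← ENNReal.ofReal_le_ofReal_iff (by positivity), ofReal_norm, enorm_sub_rev]
    exact hk2.le
  rw [dist_eq_norm] at hr ⊢
  calc ‖pint ψ r ξ - ψ ξ‖ = ‖pint (fun η => ψ η - h k η) r ξ + (pint (h k) r ξ - h k ξ) +
        (h k ξ - ψ ξ)‖ := by rw [hsub]; congr 1; ring
    _ ≤ ‖pint (fun η => ψ η - h k η) r ξ‖ + ‖pint (h k) r ξ - h k ξ‖ + ‖h k ξ - ψ ξ‖ := norm_add₃_le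
    _ < C' * (1 / 2) ^ k + ε / 2 + (1 / 2) ^ k := by
        exact add_lt_add_of_lt_of_le (add_lt_add_of_le_of_lt e1 hr) e2
    _ ≤ ε := by linarith

/-! ### The truncated Marchaud integral of a fractional integral and its averaging kernel. -/

/-- The truncated power `x_+ ^ β`. -/
def ppow (β x : ℝ) : ℝ := if 0 < x then x ^ β else 0

theorem ppow_of_pos {β x : ℝ} (hx : 0 < x) : ppow β x = x ^ β := if_pos hx

theorem ppow_of_nonpos {β x : ℝ} (hx : x ≤ 0) : ppow β x = 0 := if_neg (not_lt.2 hx)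

theorem ppow_nonneg (β x : ℝ) : 0 ≤ ppow β x := by
  unfold ppow
  split_ifs with h
  · exact Real.rpow_nonneg h.le _
  · exact le_rfl

theorem measurable_ppow (β : ℝ) : Measurable (ppow β) :=
  Measurable.ite measurableSet_Ioi (by fun_prop) measurable_const

theorem ppow_mul {β c : ℝ} (hc : 0 < c) (x : ℝ) : ppow β (c * x) = c ^ β * ppow β x := by
  rcases lt_or_ge 0 x with h | h
  · rw [ppow_of_pos h, ppow_of_pos (by positivity), Real.mul_rpow hc.le h.le]
  · rw [ppow_of_nonpos h, ppow_of_nonpos (mul_nonpos_of_nonneg_of_nonpos hc.le h), mul_zero]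

theorem ppow_le_rpow {β x y : ℝ} (hβ : 0 ≤ β) (hxy : x ≤ y) (hy : 0 ≤ y) : ppow β x ≤ y ^ β := by
  rcases lt_or_ge 0 x with h | h
  · rw [ppow_of_pos h]
    gcongr
  · rw [ppow_of_nonpos h]
    positivity

/-- The function being differentiated is `-(y/τ - j)^α / (α y)`, with numerator and denominator kept
apart. -/
theorem hasDerivAt_div_rpow {α j y τ : ℝ} (hα : 0 < α) (hy : 0 < y) (hτ : 0 < τ)
    (h : 0 < y - j * τ) :
    HasDerivAt (fun τ => -((α * y)⁻¹ * ((y - j * τ) ^ α * τ ^ (-α))))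
      (τ ^ (-1 - α) * (y - j * τ) ^ (α - 1)) τ := by
  have h1 : HasDerivAt (fun τ => y - j * τ) (-j) τ := by
    simpa using ((hasDerivAt_id τ).const_mul j).const_sub y
  have h2 := h1.rpow_const (p := α) (.inl h.ne')
  have h3 := Real.hasDerivAt_rpow_const (x := τ) (p := -α) (.inl hτ.ne')
  refine (((h2.mul h3).const_mul ((α * y)⁻¹)).neg).congr_deriv ?_
  have e1 : τ ^ (-α) = τ ^ (-1 - α) * τ := by
    rw [← Real.rpow_add_one hτ.ne']
    ring_nf
  have e2 : (y - j * τ) ^ α = (y - j * τ) ^ (α - 1) * (y - j * τ) := by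
    rw [← Real.rpow_add_one h.ne']
    ring_nf
  rw [show -α - 1 = -1 - α by ring, e1, e2]
  field_simp
  ring

theorem lintegral_Ioi_rpow {α ε : ℝ} (hα : 0 < α) (hε : 0 < ε) :
    ∫⁻ τ in Set.Ioi ε, ENNReal.ofReal (τ ^ (-1 - α)) = ENNReal.ofReal (ε ^ (-α) / α) := by
  have h2 := integrableOn_Ioi_rpow_of_lt (show -1 - α < -1 by linarith) hε
  rw [← ofReal_integral_eq_lintegral_ofReal h2, integral_Ioi_rpow_of_lt (by linarith) hε]
  · congr 1
    rw [show -1 - α + 1 = -α by ring, neg_div_neg_eq]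
  · filter_upwards [ae_restrict_mem measurableSet_Ioi] with ρ hρ
    exact Real.rpow_nonneg (hε.trans hρ).le _

/-- The explicit primitive evaluates what is left of one term of the Marchaud integral once `τ` is
integrated first. For `j > 0` the integrand lives on `(ε, y/j)`; for `j = 0` it has no upper cutoff
and is treated as a pure power. -/
theorem lintegral_rpow_mul_ppow {α ε y : ℝ} (hα : 0 < α) (hε : 0 < ε) (hy : 0 < y) (j : ℕ) :
    ∫⁻ τ in Set.Ioi ε, ENNReal.ofReal (τ ^ (-1 - α) * ppow (α - 1) (y - j * τ)) =
      ENNReal.ofReal (ε ^ (-α) / (α * y) * ppow α (y - j * ε)) := by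
  rcases Nat.eq_zero_or_pos j with rfl | hj
  · simp only [Nat.cast_zero, zero_mul, sub_zero]
    rw [ppow_of_pos hy, ppow_of_pos hy]
    simp_rw [fun τ : ℝ => mul_comm (τ ^ (-1 - α)) (y ^ (α - 1)), ENNReal.ofReal_mul (Real.rpow_nonneg hy.le (α - 1))]
    rw [lintegral_const_mul _ (by fun_prop), lintegral_Ioi_rpow hα hε,
      ← ENNReal.ofReal_mul (by positivity)]
    congr 1
    rw [Real.rpow_sub_one hy.ne']
    field_simp
  have hj' : (0 : ℝ) < j := by exact_mod_cast hj
  rcases le_or_gt y (j * ε) with hyε | hyε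
  · rw [ppow_of_nonpos (by linarith), mul_zero, ENNReal.ofReal_zero, setLIntegral_congr_fun
      measurableSet_Ioi (g := fun _ => 0), lintegral_zero]
    intro τ hτ
    have : (j : ℝ) * ε ≤ j * τ := by gcongr; exact le_of_lt hτ
    simp only
    rw [ppow_of_nonpos (by linarith), mul_zero, ENNReal.ofReal_zero]
  · set b := y / j with hb
    have hεb : ε < b := by rw [hb, lt_div_iff₀ hj']; linarith
    have hpos : ∀ τ ∈ Set.Ioo ε b, 0 < τ ∧ 0 < y - j * τ := fun τ hτ => by
      refine ⟨hε.trans hτ.1, ?_⟩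
      have := hτ.2
      rw [hb, lt_div_iff₀ hj'] at this
      linarith
    have hcont : ContinuousOn (fun τ : ℝ => -((α * y)⁻¹ * ((y - j * τ) ^ α * τ ^ (-α))))
        (Set.Icc ε b) := by
      refine (continuousOn_const.mul (ContinuousOn.mul ?_ ?_)).neg
      · exact ContinuousOn.rpow_const (by fun_prop) fun _ _ => .inr hα.le
      · exact ContinuousOn.rpow_const (by fun_prop) fun τ hτ => .inl (hε.trans_le hτ.1).ne'
    have hder := fun τ (hτ : τ ∈ Set.Ioo ε b) =>
      hasDerivAt_div_rpow hα hy (hpos τ hτ).1 (hpos τ hτ).2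
    have hnn : ∀ τ ∈ Set.Ioo ε b, 0 ≤ τ ^ (-1 - α) * (y - j * τ) ^ (α - 1) := fun τ hτ => by
      have := hpos τ hτ
      exact mul_nonneg (Real.rpow_nonneg this.1.le _) (Real.rpow_nonneg this.2.le _)
    -- At `τ = y/j` the integrand may be singular when `α < 1`; integrability follows because it is
    -- the nonnegative derivative of a function continuous up to the endpoint.
    have hint := intervalIntegral.integrableOn_deriv_of_nonneg hcont hder hnn
    have hval := intervalIntegral.integral_eq_sub_of_hasDerivAt_of_le hεb.le hcont hder
      ((intervalIntegrable_iff_integrableOn_Ioc_of_le hεb.le).2 hint)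
    have hz : y - j * b = 0 := by rw [hb]; field_simp; ring
    rw [hz, Real.zero_rpow hα.ne', intervalIntegral.integral_of_le hεb.le, integral_Ioc_eq_integral_Ioo] at hval
    calc ∫⁻ τ in Set.Ioi ε, ENNReal.ofReal (τ ^ (-1 - α) * ppow (α - 1) (y - j * τ))
        = ∫⁻ τ in Set.Ioo ε b, ENNReal.ofReal (τ ^ (-1 - α) * (y - j * τ) ^ (α - 1)) := by
          rw [← lintegral_indicator measurableSet_Ioi, ← lintegral_indicator measurableSet_Ioo]
          refine lintegral_congr fun τ => ?_
          by_cases h1 : τ ∈ Set.Ioo ε b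
          · rw [Set.indicator_of_mem h1, Set.indicator_of_mem (Set.mem_Ioi.2 h1.1),
              ppow_of_pos (hpos τ h1).2]
          · rw [Set.indicator_of_notMem h1]
            by_cases h2 : τ ∈ Set.Ioi ε
            · have h3 : b ≤ τ := by
                by_contra! h
                exact h1 ⟨h2, h⟩
              rw [hb, div_le_iff₀ hj'] at h3
              rw [Set.indicator_of_mem h2, ppow_of_nonpos (by linarith), mul_zero,
                ENNReal.ofReal_zero]
            · rw [Set.indicator_of_notMem h2]
      _ = _ := by
          rw [← ofReal_integral_eq_lintegral_ofReal (hint.mono_set Set.Ioo_subset_Ioc_self)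
            ((ae_restrict_iff' measurableSet_Ioo).2 (Eventually.of_forall hnn)), hval,
            ppow_of_pos (by linarith)]
          congr 1
          field_simp
          ring

/-- Fubini for a single term of the Marchaud integral of a fractional integral. -/
theorem marchaud_term {α ε : ℝ} (hα : 0 < α) (hε : 0 < ε) (j : ℕ) {G : ℝ → ℂ}
    (hG : Measurable G) (hint : IntegrableOn (fun y => y ^ (α - 1) • G y) (Set.Ioi 0)) :
    IntegrableOn (fun τ => τ ^ (-1 - α) • ∫ y in Set.Ioi (0 : ℝ), ppow (α - 1) (y - j * τ) • G y)
      (Set.Ioi ε) ∧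
    IntegrableOn (fun y => (ε ^ (-α) / (α * y) * ppow α (y - j * ε)) • G y) (Set.Ioi 0) ∧
    ∫ τ in Set.Ioi ε, τ ^ (-1 - α) • ∫ y in Set.Ioi (0 : ℝ), ppow (α - 1) (y - j * τ) • G y =
      ∫ y in Set.Ioi (0 : ℝ), (ε ^ (-α) / (α * y) * ppow α (y - j * ε)) • G y := by
  set k : ℝ → ℝ → ℝ := fun τ y => τ ^ (-1 - α) * ppow (α - 1) (y - j * τ)
  have hk : Measurable (Function.uncurry k) := by
    have h1 : Measurable fun p : ℝ × ℝ => p.1 ^ (-1 - α) := by fun_prop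
    exact h1.mul ((measurable_ppow _).comp (by fun_prop))
  have hkG : Measurable (Function.uncurry fun τ y => k τ y • G y) :=
    hk.smul (hG.comp measurable_snd)
  have hknn : ∀ τ ∈ Set.Ioi ε, ∀ y, 0 ≤ k τ y := fun τ hτ y =>
    mul_nonneg (Real.rpow_nonneg (hε.trans hτ).le _) (ppow_nonneg _ _)
  have hcoef : ∀ y ∈ Set.Ioi (0 : ℝ), 0 ≤ ε ^ (-α) / (α * y) * ppow α (y - j * ε) := fun y hy => by
    have : (0 : ℝ) < y := hy
    have := ppow_nonneg α (y - j * ε)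
    positivity
  have hinner : ∀ y ∈ Set.Ioi (0 : ℝ), ∫⁻ τ in Set.Ioi ε, ‖k τ y • G y‖ₑ =
      ‖(ε ^ (-α) / (α * y) * ppow α (y - j * ε)) • G y‖ₑ := by
    intro y hy
    rw [enorm_smul, Real.enorm_of_nonneg (hcoef y hy), ← lintegral_rpow_mul_ppow hα hε hy j,
      ← lintegral_mul_const]
    · refine setLIntegral_congr_fun measurableSet_Ioi fun τ hτ => ?_
      rw [enorm_smul, Real.enorm_of_nonneg (hknn τ hτ y)]
    · exact (hk.comp (f := fun τ : ℝ => (τ, y)) (by fun_prop)).ennreal_ofReal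
  have hI2 : IntegrableOn (fun y => (ε ^ (-α) / (α * y) * ppow α (y - j * ε)) • G y)
      (Set.Ioi 0) := by
    refine Integrable.mono (hint.smul (ε ^ (-α) / α : ℝ)) ?_ ?_
    · refine Measurable.aestronglyMeasurable (Measurable.smul
        (Measurable.mul (by fun_prop) ((measurable_ppow _).comp (by fun_prop))) hG)
    · filter_upwards [ae_restrict_mem measurableSet_Ioi] with y hy
      have hy0 : (0 : ℝ) < y := hy
      rw [norm_smul, Real.norm_of_nonneg (hcoef y hy), Pi.smul_apply, norm_smul, norm_smul,
        Real.norm_of_nonneg (Real.rpow_nonneg hy0.le _), ← mul_assoc,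
        Real.norm_of_nonneg (show 0 ≤ ε ^ (-α) / α by positivity)]
      refine mul_le_mul_of_nonneg_right ?_ (norm_nonneg _)
      have h1 : ppow α (y - j * ε) ≤ y ^ α := ppow_le_rpow hα.le (by
        have : (0 : ℝ) ≤ j * ε := by positivity
        linarith) hy0.le
      calc ε ^ (-α) / (α * y) * ppow α (y - j * ε) ≤ ε ^ (-α) / (α * y) * y ^ α := by gcongr
        _ = _ := by rw [Real.rpow_sub_one hy0.ne']; field_simp
  have hprod : Integrable (Function.uncurry fun τ y => k τ y • G y)
      ((volume.restrict (Set.Ioi ε)).prod (volume.restrict (Set.Ioi 0))) := by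
    refine ⟨hkG.aestronglyMeasurable, ?_⟩
    rw [hasFiniteIntegral_iff_enorm, lintegral_prod_symm _ hkG.enorm.aemeasurable]
    calc _ = ∫⁻ y in Set.Ioi (0 : ℝ), ‖(ε ^ (-α) / (α * y) * ppow α (y - j * ε)) • G y‖ₑ :=
          setLIntegral_congr_fun measurableSet_Ioi hinner
      _ < ∞ := hI2.2
  have hsm : ∀ τ, ∫ y in Set.Ioi (0 : ℝ), k τ y • G y =
      τ ^ (-1 - α) • ∫ y in Set.Ioi (0 : ℝ), ppow (α - 1) (y - j * τ) • G y := fun τ => by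
    rw [← integral_smul]
    simp_rw [smul_smul]
    rfl
  refine ⟨?_, hI2, ?_⟩
  · have := hprod.integral_prod_left
    simp only [Function.uncurry_apply_pair, hsm] at this
    exact this
  · simp_rw [← hsm]
    rw [integral_integral_swap hprod]
    refine setIntegral_congr_fun measurableSet_Ioi fun y hy => ?_
    rw [integral_smul_const]
    congr 1
    rw [integral_eq_lintegral_of_nonneg_ae, lintegral_rpow_mul_ppow hα hε hy j,
      ENNReal.toReal_ofReal (hcoef y hy)]
    · filter_upwards [ae_restrict_mem measurableSet_Ioi] with τ hτ using hknn τ hτ y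
    · exact (hk.comp (f := fun τ : ℝ => (τ, y)) (by fun_prop)).aestronglyMeasurable

/-- The averaging kernel of the truncated Marchaud derivative (up to normalization). -/
def mker (α : ℝ) (l : ℕ) (w : ℝ) : ℝ :=
  w⁻¹ * ∑ j ∈ Finset.range (l + 1), ((-1) ^ j * (l.choose j : ℝ)) * ppow α (w - j)

theorem measurable_mker (α : ℝ) (l : ℕ) : Measurable (mker α l) := by
  unfold mker
  refine measurable_inv.mul (Finset.measurable_fun_sum _ fun j _ => measurable_const.mul ?_)
  exact (measurable_ppow α).comp (by fun_prop)

/-- By homogeneity `ε^{-α} (y - jε)_+^α = (y/ε - j)_+^α`, so summing the terms over `j` produces the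
kernel `mker` rescaled by `ε`. The single summands of the kernel grow like `w^(α-1)` and are not
integrable at infinity; only their alternating sum decays. -/
theorem marchaud_sum {α ε : ℝ} (hα : 0 < α) (hε : 0 < ε) (l : ℕ) {G : ℝ → ℂ}
    (hG : Measurable G) (hint : IntegrableOn (fun y => y ^ (α - 1) • G y) (Set.Ioi 0)) :
    IntegrableOn (fun τ => τ ^ (-1 - α) • ∑ j ∈ Finset.range (l + 1),
      ((-1) ^ j * (l.choose j : ℂ)) * ∫ y in Set.Ioi (0 : ℝ), ppow (α - 1) (y - j * τ) • G y)
      (Set.Ioi ε) ∧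
    IntegrableOn (fun y => (α⁻¹ * (ε⁻¹ * mker α l (ε⁻¹ * y))) • G y) (Set.Ioi 0) ∧
    ∫ τ in Set.Ioi ε, τ ^ (-1 - α) • ∑ j ∈ Finset.range (l + 1),
      ((-1) ^ j * (l.choose j : ℂ)) * ∫ y in Set.Ioi (0 : ℝ), ppow (α - 1) (y - j * τ) • G y =
      ∫ y in Set.Ioi (0 : ℝ), (α⁻¹ * (ε⁻¹ * mker α l (ε⁻¹ * y))) • G y := by
  have hterm := fun j => marchaud_term hα hε j hG hint
  have e1 : ∀ τ : ℝ, τ ^ (-1 - α) • ∑ j ∈ Finset.range (l + 1), ((-1) ^ j * (l.choose j : ℂ)) *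
      ∫ y in Set.Ioi (0 : ℝ), ppow (α - 1) (y - j * τ) • G y =
      ∑ j ∈ Finset.range (l + 1), ((-1) ^ j * (l.choose j : ℂ)) *
        (τ ^ (-1 - α) • ∫ y in Set.Ioi (0 : ℝ), ppow (α - 1) (y - j * τ) • G y) := fun τ => by
    rw [Finset.smul_sum]
    exact Finset.sum_congr rfl fun j _ => (mul_smul_comm _ _ _).symm
  have e2 : ∀ y ∈ Set.Ioi (0 : ℝ), (α⁻¹ * (ε⁻¹ * mker α l (ε⁻¹ * y))) • G y =
      ∑ j ∈ Finset.range (l + 1), ((-1) ^ j * (l.choose j : ℂ)) *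
        ((ε ^ (-α) / (α * y) * ppow α (y - j * ε)) • G y) := by
    intro y hy
    have hy0 : (0 : ℝ) < y := hy
    have h1 : ∀ j : ℕ, ppow α (ε⁻¹ * y - j) = ε ^ (-α) * ppow α (y - j * ε) := fun j => by
      rw [show ε⁻¹ * y - j = ε⁻¹ * (y - j * ε) by field_simp, ppow_mul (by positivity),
        Real.inv_rpow hε.le, Real.rpow_neg hε.le]
    simp only [mker, h1, Complex.real_smul, Finset.mul_sum]
    push_cast
    rw [Finset.sum_mul]
    refine Finset.sum_congr rfl fun j _ => ?_
    have hε' : (ε : ℂ) ≠ 0 := by exact_mod_cast hε.ne'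
    have hα' : (α : ℂ) ≠ 0 := by exact_mod_cast hα.ne'
    have hy' : (y : ℂ) ≠ 0 := by exact_mod_cast hy0.ne'
    field_simp
  simp_rw [e1]
  have hi1 : ∀ j ∈ Finset.range (l + 1), IntegrableOn (fun τ => ((-1) ^ j * (l.choose j : ℂ)) *
      (τ ^ (-1 - α) • ∫ y in Set.Ioi (0 : ℝ), ppow (α - 1) (y - j * τ) • G y)) (Set.Ioi ε) :=
    fun j _ => (hterm j).1.const_mul _
  have hi2 : ∀ j ∈ Finset.range (l + 1), IntegrableOn (fun y => ((-1) ^ j * (l.choose j : ℂ)) *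
      ((ε ^ (-α) / (α * y) * ppow α (y - j * ε)) • G y)) (Set.Ioi 0) :=
    fun j _ => (hterm j).2.1.const_mul _
  refine ⟨integrable_finsetSum _ hi1, ?_, ?_⟩
  · rw [integrableOn_congr_fun e2 measurableSet_Ioi]
    exact integrable_finsetSum _ hi2
  · rw [setIntegral_congr_fun measurableSet_Ioi e2, integral_finsetSum _ hi1,
      integral_finsetSum _ hi2]
    refine Finset.sum_congr rfl fun j _ => ?_
    rw [integral_const_mul, integral_const_mul, (hterm j).2.2]

theorem fwdDiff_neg_one_iter (l : ℕ) (f : ℝ → ℝ) (w : ℝ) :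
    (fwdDiff (-1 : ℝ))^[l] f w =
      ∑ j ∈ Finset.range (l + 1), ((-1) ^ (l - j) * (l.choose j : ℝ)) * f (w - j) := by
  rw [fwdDiff_iter_eq_sum_shift]
  refine Finset.sum_congr rfl fun j _ => ?_
  simp [sub_eq_add_neg]

theorem hasDerivAt_fwdDiff_rpow (l : ℕ) (β : ℝ) {w : ℝ} (hw : l < w) :
    HasDerivAt ((fwdDiff (-1 : ℝ))^[l] fun x => x ^ β)
      (β * (fwdDiff (-1 : ℝ))^[l] (fun x => x ^ (β - 1)) w) w := by
  have h : ((fwdDiff (-1 : ℝ))^[l] fun x : ℝ => x ^ β) = fun w => ∑ j ∈ Finset.range (l + 1),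
      ((-1) ^ (l - j) * (l.choose j : ℝ)) * (w - j) ^ β := funext fun w => fwdDiff_neg_one_iter l _ w
  rw [h, fwdDiff_neg_one_iter, Finset.mul_sum]
  refine HasDerivAt.fun_sum fun j hj => ?_
  have hjl : (j : ℝ) ≤ l := by exact_mod_cast Nat.lt_succ_iff.1 (Finset.mem_range.1 hj)
  have h1 := (((hasDerivAt_id w).sub_const (j : ℝ)).rpow_const (p := β)
    (.inl (by simp only [id]; linarith))).const_mul ((-1) ^ (l - j) * (l.choose j : ℝ))
  refine h1.congr_deriv ?_
  simp only [id]
  ring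

/-- Each difference gains one power of `w`: by the mean value theorem on `[w - 1, w]`, one more
difference is bounded by the derivative of the previous ones, which is `β` times the same difference
of `x^(β-1)`. This is why the induction runs over all exponents. -/
theorem exists_abs_fwdDiff_rpow_le (l : ℕ) : ∀ β : ℝ, ∃ C : ℝ, 0 ≤ C ∧ ∀ w : ℝ, l + 1 ≤ w →
    |(fwdDiff (-1 : ℝ))^[l] (fun x => x ^ β) w| ≤ C * w ^ (β - l) := by
  induction l with
  | zero =>
    intro β
    refine ⟨1, zero_le_one, fun w hw => ?_⟩
    have : 0 < w := by norm_num at hw; linarith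
    simp [abs_of_pos (Real.rpow_pos_of_pos this β)]
  | succ l ih =>
    intro β
    obtain ⟨C, hC, hb⟩ := ih (β - 1)
    -- The power of `2` pays for replacing a point `v` of `[w - 1, w]` by `w`: here `w ≥ 2`, so `v ≥
    -- w/2`.
    refine ⟨|β| * (C * 2 ^ |β - 1 - l|), by positivity, fun w hw => ?_⟩
    push_cast at hw ⊢
    have hl : (0 : ℝ) ≤ l := Nat.cast_nonneg l
    have hw0 : 0 < w := by linarith
    rw [Function.iterate_succ_apply', fwdDiff]
    have hbd : ∀ v ∈ Set.Icc (w + -1) w, ‖β * (fwdDiff (-1 : ℝ))^[l] (fun x => x ^ (β - 1)) v‖ ≤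
        |β| * (C * 2 ^ |β - 1 - l|) * w ^ (β - (l + 1)) := by
      intro v hv
      have hv0 : 0 < v := by linarith [hv.1]
      rw [norm_mul, Real.norm_eq_abs, Real.norm_eq_abs, mul_assoc]
      refine mul_le_mul_of_nonneg_left ?_ (abs_nonneg _)
      refine (hb v (by linarith [hv.1])).trans ?_
      rw [mul_assoc, show β - (l + 1) = β - 1 - l by ring]
      refine mul_le_mul_of_nonneg_left ?_ hC
      set e := β - 1 - (l : ℝ)
      rcases le_total 0 e with he | he
      · refine (Real.rpow_le_rpow hv0.le hv.2 he).trans (le_mul_of_one_le_left (by positivity) ?_)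
        exact Real.one_le_rpow one_le_two (abs_nonneg _)
      · rw [abs_of_nonpos he, Real.rpow_neg zero_le_two, ← Real.inv_rpow zero_le_two,
          ← Real.mul_rpow (by norm_num) hw0.le]
        exact Real.rpow_le_rpow_of_nonpos (by positivity) (by linarith [hv.1]) he
    have hmv := Convex.norm_image_sub_le_of_norm_hasDerivWithin_le (s := Set.Icc (w + -1) w)
      (f := (fwdDiff (-1 : ℝ))^[l] fun x => x ^ β) (x := w) (y := w + -1)
      (fun v hv => (hasDerivAt_fwdDiff_rpow l β (by linarith [hv.1])).hasDerivWithinAt) hbd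
      (convex_Icc _ _) ⟨by linarith, le_rfl⟩ ⟨le_rfl, by linarith⟩
    rw [Real.norm_eq_abs] at hmv
    refine hmv.trans (le_of_eq ?_)
    simp

/-- The bounds for the averaging kernel at zero and at infinity. -/
theorem exists_abs_mker_le {α : ℝ} (hα : 0 < α) {l : ℕ} (hl : α < l) : ∃ C : ℝ, 0 < C ∧
    ∀ w : ℝ, 0 < w → |mker α l w| ≤ C * (w⁻¹ * min (w ^ α) (w ^ (-(l - α)))) := by
  obtain ⟨C, hC, hfar⟩ := exists_abs_fwdDiff_rpow_le l α
  have hnear : ∀ w : ℝ, 0 < w →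
      |∑ j ∈ Finset.range (l + 1), ((-1) ^ j * (l.choose j : ℝ)) * ppow α (w - j)| ≤
        2 ^ l * w ^ α := by
    intro w hw
    refine (Finset.abs_sum_le_sum_abs _ _).trans ?_
    have h2 : (2 : ℝ) ^ l = ∑ j ∈ Finset.range (l + 1), (l.choose j : ℝ) := by
      exact_mod_cast (Nat.sum_range_choose l).symm
    rw [h2, Finset.sum_mul]
    refine Finset.sum_le_sum fun j _ => ?_
    rw [abs_mul, abs_mul, abs_pow, abs_neg, abs_one, one_pow, one_mul, Nat.abs_cast,
      abs_of_nonneg (ppow_nonneg _ _)]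
    refine mul_le_mul_of_nonneg_left ?_ (Nat.cast_nonneg _)
    exact ppow_le_rpow hα.le (by have : (0 : ℝ) ≤ j := Nat.cast_nonneg j; linarith) hw.le
  -- For `w ≥ l + 1` all truncated powers are genuine powers and the decay of differences applies.
  -- For smaller `w` the trivial bound is used in the form `2^l w^α = 2^l w^l w^{-(l-α)}`, at the
  -- cost of `(l + 1)^l`.
  set K : ℝ := 2 ^ l * (l + 1) ^ l + C
  have hK1 : (2 : ℝ) ^ l ≤ K := by
    have : (1 : ℝ) ≤ (l + 1) ^ l := one_le_pow₀ (by linarith [(Nat.cast_nonneg l : (0 : ℝ) ≤ l)])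
    have h2 : (0 : ℝ) < 2 ^ l := by positivity
    nlinarith
  refine ⟨K, by positivity, fun w hw => ?_⟩
  rw [mker, abs_mul, abs_of_pos (inv_pos.2 hw), mul_left_comm]
  refine mul_le_mul_of_nonneg_left ?_ (by positivity)
  rw [mul_min_of_nonneg _ _ (by positivity)]
  refine le_min ((hnear w hw).trans (by gcongr)) ?_
  rcases le_or_gt ((l : ℝ) + 1) w with h | h
  · have h1 : |∑ j ∈ Finset.range (l + 1), ((-1) ^ j * (l.choose j : ℝ)) * ppow α (w - j)| =
        |(fwdDiff (-1 : ℝ))^[l] (fun x => x ^ α) w| := by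
      have h2 : (fwdDiff (-1 : ℝ))^[l] (fun x => x ^ α) w = (-1) ^ l *
          ∑ j ∈ Finset.range (l + 1), ((-1) ^ j * (l.choose j : ℝ)) * ppow α (w - j) := by
        rw [fwdDiff_neg_one_iter, Finset.mul_sum]
        refine Finset.sum_congr rfl fun j hj => ?_
        have hjl := Nat.lt_succ_iff.1 (Finset.mem_range.1 hj)
        have hjl' : (j : ℝ) ≤ l := by exact_mod_cast hjl
        rw [ppow_of_pos (by linarith), ← mul_assoc, ← mul_assoc, ← pow_add]
        congr 2
        rw [show l + j = (l - j) + 2 * j by omega, pow_add, pow_mul]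
        simp
      rw [h2, abs_mul, abs_pow, abs_neg, abs_one, one_pow, one_mul]
    rw [h1]
    refine (hfar w h).trans ?_
    rw [show -((l : ℝ) - α) = α - l by ring]
    gcongr
    exact le_add_of_nonneg_left (by positivity)
  · refine (hnear w hw).trans ?_
    have h1 : w ^ α = w ^ l * w ^ (-((l : ℝ) - α)) := by
      rw [← Real.rpow_natCast, ← Real.rpow_add hw]
      ring_nf
    rw [h1, ← mul_assoc]
    refine mul_le_mul_of_nonneg_right ?_ (by positivity)
    calc (2 : ℝ) ^ l * w ^ l ≤ 2 ^ l * (l + 1) ^ l := by gcongr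
      _ ≤ K := le_add_of_nonneg_right hC

/-- The Haar-type integrability of `min (ρ ^ α) (ρ ^ (-b)) / ρ`. -/
theorem integrableOn_inv_mul_min {α b : ℝ} (hα : 0 < α) (hb : 0 < b) :
    IntegrableOn (fun w : ℝ => w⁻¹ * min (w ^ α) (w ^ (-b))) (Set.Ioi 0) := by
  have hm : Measurable fun w : ℝ => w⁻¹ * min (w ^ α) (w ^ (-b)) := by fun_prop
  rw [← Set.Ioc_union_Ioi_eq_Ioi zero_le_one]
  refine IntegrableOn.union ?_ ?_
  · have h1 : IntegrableOn (fun w : ℝ => w ^ (α - 1)) (Set.Ioc 0 1) :=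
      (intervalIntegrable_iff_integrableOn_Ioc_of_le zero_le_one).1
        (intervalIntegral.intervalIntegrable_rpow' (by linarith))
    refine Integrable.mono h1 hm.aestronglyMeasurable ?_
    filter_upwards [ae_restrict_mem measurableSet_Ioc] with w hw
    have hw0 := hw.1
    rw [Real.norm_of_nonneg (by positivity), Real.norm_of_nonneg (by positivity),
      Real.rpow_sub_one hw0.ne', div_eq_inv_mul]
    gcongr
    exact min_le_left _ _
  · have h1 := integrableOn_Ioi_rpow_of_lt (show -b - 1 < -1 by linarith) one_pos
    refine Integrable.mono h1 hm.aestronglyMeasurable ?_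
    filter_upwards [ae_restrict_mem measurableSet_Ioi] with w hw
    have hw0 : (0 : ℝ) < w := one_pos.trans hw
    rw [Real.norm_of_nonneg (by positivity), Real.norm_of_nonneg (by positivity),
      Real.rpow_sub_one hw0.ne', div_eq_inv_mul]
    gcongr
    exact min_le_right _ _

theorem integrableOn_mker {α : ℝ} (hα : 0 < α) {l : ℕ} (hl : α < l) :
    IntegrableOn (mker α l) (Set.Ioi 0) := by
  obtain ⟨C, hC, h⟩ := exists_abs_mker_le hα hl
  refine Integrable.mono' ((integrableOn_inv_mul_min hα (sub_pos.2 hl)).const_mul C)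
    (measurable_mker α l).aestronglyMeasurable ?_
  filter_upwards [ae_restrict_mem measurableSet_Ioi] with w hw using h w hw

/-- Exponentials are eigenfunctions of fractional integration. They are the test case that fixes the
integral of the averaging kernel. -/
theorem integral_ppow_mul_exp {α c : ℝ} (hα : 0 < α) (hc : 0 ≤ c) :
    ∫ y in Set.Ioi (0 : ℝ), ppow (α - 1) (y - c) * Real.exp (-y) =
      Real.Gamma α * Real.exp (-c) := by
  have h1 : ∫ y in Set.Ioi (0 : ℝ), ppow (α - 1) (y - c) * Real.exp (-y) =
      ∫ y, (ppow (α - 1) (y - c) * Real.exp (-(y - c))) * Real.exp (-c) := by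
    rw [setIntegral_eq_integral_of_forall_compl_eq_zero]
    · refine integral_congr_ae (Eventually.of_forall fun y => ?_)
      simp only
      rw [mul_assoc, ← Real.exp_add]
      ring_nf
    · intro y hy
      rw [ppow_of_nonpos (by simp only [Set.mem_Ioi, not_lt] at hy; linarith), zero_mul]
  rw [h1, integral_mul_const, integral_sub_right_eq_self
    (fun y => ppow (α - 1) y * Real.exp (-y)) c,
    ← setIntegral_eq_integral_of_forall_compl_eq_zero (s := Set.Ioi (0 : ℝ))]
  · congr 1
    rw [Real.Gamma_eq_integral hα]
    refine setIntegral_congr_fun measurableSet_Ioi fun y hy => ?_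
    rw [ppow_of_pos hy, mul_comm]
  · intro y hy
    rw [ppow_of_nonpos (by simpa using hy), zero_mul]

theorem integrableOn_kappa {α : ℝ} (hα : 0 < α) {l : ℕ} (hl : α < l) :
    IntegrableOn (fun τ : ℝ => (1 - Real.exp (-τ)) ^ l / τ ^ (1 + α)) (Set.Ioi 0) := by
  refine Integrable.mono' (integrableOn_inv_mul_min (sub_pos.2 hl) hα)
    (Measurable.aestronglyMeasurable (by fun_prop)) ?_
  filter_upwards [ae_restrict_mem measurableSet_Ioi] with τ hτ
  have hτ0 : (0 : ℝ) < τ := hτ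
  have h1 : 0 ≤ 1 - Real.exp (-τ) := by
    have : Real.exp (-τ) ≤ 1 := Real.exp_le_one_iff.2 (by linarith)
    linarith
  have h2 : 1 - Real.exp (-τ) ≤ τ := by linarith [Real.add_one_le_exp (-τ)]
  have h3 : 1 - Real.exp (-τ) ≤ 1 := by linarith [Real.exp_pos (-τ)]
  rw [Real.norm_of_nonneg (by positivity), Real.rpow_add hτ0, Real.rpow_one, div_mul_eq_div_div,
    div_right_comm, div_eq_inv_mul]
  refine mul_le_mul_of_nonneg_left (le_min ?_ ?_) (inv_nonneg.2 hτ0.le)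
  · rw [Real.rpow_sub hτ0, Real.rpow_natCast]
    gcongr
  · rw [Real.rpow_neg hτ0.le, ← one_div]
    gcongr
    exact pow_le_one₀ h1 h3

theorem kappa_pos {α : ℝ} (hα : 0 < α) {l : ℕ} (hl : α < l) : 0 < kappa α l := by
  have hpos : ∀ τ ∈ Set.Ioi (0 : ℝ), 0 < (1 - Real.exp (-τ)) ^ l / τ ^ (1 + α) := fun τ hτ => by
    have hτ0 : (0 : ℝ) < τ := hτ
    have : Real.exp (-τ) < 1 := by
      rw [← Real.exp_zero]
      exact Real.exp_lt_exp.2 (by linarith)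
    have h1 : 0 < 1 - Real.exp (-τ) := by linarith
    positivity
  rw [kappa, setIntegral_pos_iff_support_of_nonneg_ae _ (integrableOn_kappa hα hl)]
  · rw [Set.inter_eq_right.2 (show Set.Ioi (0 : ℝ) ⊆ Function.support
      (fun τ : ℝ => (1 - Real.exp (-τ)) ^ l / τ ^ (1 + α)) from fun τ hτ => (hpos τ hτ).ne')]
    simp
  · filter_upwards [ae_restrict_mem measurableSet_Ioi] with τ hτ using (hpos τ hτ).le

/-- The integral of the averaging kernel. -/
theorem integral_mker {α : ℝ} (hα : 0 < α) {l : ℕ} (hl : α < l) :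
    α⁻¹ * ∫ w in Set.Ioi (0 : ℝ), mker α l w = Real.Gamma α * kappa α l := by
  -- For this `G` the differences sum to `Γ(α) (1 - e^{-τ})^l` by the binomial theorem. Letting `ε`
  -- tend to `0` on both sides of `marchaud_sum` gives `Γ(α) ϰ(α, l)` on one side and the integral
  -- of the kernel on the other.
  set G : ℝ → ℂ := fun y => (Real.exp (-y) : ℝ)
  have hint : IntegrableOn (fun y : ℝ => y ^ (α - 1) • G y) (Set.Ioi 0) := by
    have h := (Real.GammaIntegral_convergent hα).ofReal (𝕜 := ℂ)
    refine h.congr (Eventually.of_forall fun y => ?_)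
    simp [G, mul_comm]
  have hF : ∀ τ ∈ Set.Ioi (0 : ℝ), ∑ j ∈ Finset.range (l + 1), ((-1) ^ j * (l.choose j : ℂ)) *
      ∫ y in Set.Ioi (0 : ℝ), ppow (α - 1) (y - j * τ) • G y =
      ((Real.Gamma α * (1 - Real.exp (-τ)) ^ l : ℝ) : ℂ) := by
    intro τ hτ
    have hτ0 : (0 : ℝ) < τ := hτ
    have h1 : ∀ j : ℕ, ∫ y in Set.Ioi (0 : ℝ), ppow (α - 1) (y - j * τ) • G y =
        ((Real.Gamma α * Real.exp (-τ) ^ j : ℝ) : ℂ) := fun j => by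
      rw [← Real.exp_nat_mul, mul_neg, ← integral_ppow_mul_exp hα (by positivity), ← integral_complex_ofReal]
      refine integral_congr_ae (Eventually.of_forall fun y => ?_)
      simp [G]
    simp_rw [h1]
    rw [sub_eq_neg_add, add_pow]
    push_cast
    rw [Finset.mul_sum]
    refine Finset.sum_congr rfl fun j _ => ?_
    rw [neg_pow (Complex.exp _)]
    ring
  have key : ∀ ε ∈ Set.Ioi (0 : ℝ),
      Real.Gamma α * ∫ τ in Set.Ioi ε, (1 - Real.exp (-τ)) ^ l / τ ^ (1 + α) =
        α⁻¹ * ∫ w in Set.Ioi (0 : ℝ), mker α l w * Real.exp (-(ε * w)) := by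
    intro ε hε
    have hε0 : (0 : ℝ) < ε := hε
    have h := (marchaud_sum hα hε0 l (by fun_prop) hint).2.2
    have hl : ∫ τ in Set.Ioi ε, τ ^ (-1 - α) • ∑ j ∈ Finset.range (l + 1),
        ((-1) ^ j * (l.choose j : ℂ)) * ∫ y in Set.Ioi (0 : ℝ), ppow (α - 1) (y - j * τ) • G y =
        ((Real.Gamma α * ∫ τ in Set.Ioi ε, (1 - Real.exp (-τ)) ^ l / τ ^ (1 + α) : ℝ) : ℂ) := by
      rw [← integral_const_mul, ← integral_complex_ofReal]
      refine setIntegral_congr_fun measurableSet_Ioi fun τ hτ => ?_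
      have hτ0 : (0 : ℝ) < τ := hε0.trans hτ
      rw [hF τ hτ0, Complex.real_smul, ← Complex.ofReal_mul]
      congr 1
      rw [show -1 - α = -(1 + α) by ring, Real.rpow_neg hτ0.le]
      field_simp
    have hr : ∫ y in Set.Ioi (0 : ℝ), (α⁻¹ * (ε⁻¹ * mker α l (ε⁻¹ * y))) • G y =
        ((α⁻¹ * ∫ w in Set.Ioi (0 : ℝ), mker α l w * Real.exp (-(ε * w)) : ℝ) : ℂ) := by
      have h2 := integral_comp_mul_left_Ioi (fun w => mker α l w * Real.exp (-(ε * w))) 0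
        (inv_pos.2 hε0)
      rw [mul_zero, inv_inv, smul_eq_mul, ← inv_mul_eq_iff_eq_mul₀ hε0.ne'] at h2
      rw [← h2, ← integral_const_mul, ← integral_const_mul, ← integral_complex_ofReal]
      refine setIntegral_congr_fun measurableSet_Ioi fun y hy => ?_
      simp only [G]
      rw [mul_inv_cancel_left₀ hε0.ne', Complex.real_smul, ← Complex.ofReal_mul]
      congr 1
      ring
    rw [hl, hr] at h
    exact_mod_cast h
  have hlim1 : Tendsto (fun ε : ℝ => Real.Gamma α * ∫ τ in Set.Ioi ε,
      (1 - Real.exp (-τ)) ^ l / τ ^ (1 + α)) (𝓝[>] 0) (𝓝 (Real.Gamma α * kappa α l)) := by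
    refine Tendsto.const_mul _ ?_
    have h0 : ∀ ε ∈ Set.Ioi (0 : ℝ), ∫ τ in Set.Ioi ε, (1 - Real.exp (-τ)) ^ l / τ ^ (1 + α) =
        ∫ τ in Set.Ioi (0 : ℝ), (Set.Ioi ε).indicator
          (fun τ => (1 - Real.exp (-τ)) ^ l / τ ^ (1 + α)) τ := fun ε hε => by
      rw [setIntegral_indicator measurableSet_Ioi, Set.inter_eq_right.2
        (Set.Ioi_subset_Ioi (le_of_lt hε))]
    refine Tendsto.congr' (eventually_nhdsWithin_of_forall fun ε hε => (h0 ε hε).symm) ?_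
    refine tendsto_integral_filter_of_dominated_convergence
      (fun τ => ‖(1 - Real.exp (-τ)) ^ l / τ ^ (1 + α)‖) ?_ ?_ (integrableOn_kappa hα hl).norm ?_
    · exact Eventually.of_forall fun ε => ((integrableOn_kappa hα hl).1.indicator measurableSet_Ioi)
    · exact Eventually.of_forall fun ε => Eventually.of_forall fun τ => norm_indicator_le_norm_self _ _
    · filter_upwards [ae_restrict_mem measurableSet_Ioi] with τ hτ
      refine tendsto_const_nhds.congr' ?_
      filter_upwards [Ioo_mem_nhdsGT (show (0 : ℝ) < τ from hτ)] with ε hε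
      rw [Set.indicator_of_mem (Set.mem_Ioi.2 hε.2)]
  have hlim2 : Tendsto (fun ε : ℝ => α⁻¹ * ∫ w in Set.Ioi (0 : ℝ), mker α l w * Real.exp (-(ε * w)))
      (𝓝[>] 0) (𝓝 (α⁻¹ * ∫ w in Set.Ioi (0 : ℝ), mker α l w)) := by
    refine Tendsto.const_mul _ ?_
    refine tendsto_integral_filter_of_dominated_convergence (fun w => ‖mker α l w‖) ?_ ?_
      (integrableOn_mker hα hl).norm ?_
    · exact Eventually.of_forall fun ε => ((measurable_mker α l).mul (by fun_prop)).aestronglyMeasurable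
    · filter_upwards [self_mem_nhdsWithin] with ε hε
      filter_upwards [ae_restrict_mem measurableSet_Ioi] with w hw
      rw [norm_mul, Real.norm_of_nonneg (Real.exp_pos _).le]
      refine mul_le_of_le_one_right (norm_nonneg _) (Real.exp_le_one_iff.2 ?_)
      have : 0 < ε * w := mul_pos hε hw
      linarith
    · refine Eventually.of_forall fun w => ?_
      have : Tendsto (fun ε : ℝ => mker α l w * Real.exp (-(ε * w))) (𝓝 0)
        (𝓝 (mker α l w * Real.exp (-(0 * w)))) := Continuous.tendsto (by fun_prop) 0
      simp only [zero_mul, neg_zero, Real.exp_zero, mul_one] at this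
      exact this.mono_left nhdsWithin_le_nhds
  exact tendsto_nhds_unique (hlim2.congr' (eventually_nhdsWithin_of_forall fun ε hε =>
    (key ε hε).symm)) hlim1

/-! ### Convergence of the averages at right Lebesgue points. -/

/-- The values `ρ` in `[w, 2w]` alone suffice, because the weight is nearly constant there. The
radial majorant of the kernel is thereby a superposition of normalized indicators of `(0, ρ]`, which
brings in the Lebesgue averages. -/
theorem inv_mul_min_le_lintegral {α b w : ℝ} (hα : 0 < α) (hb : 0 < b) (hw : 0 < w) :
    ENNReal.ofReal (w⁻¹ * min (w ^ α) (w ^ (-b))) ≤ ENNReal.ofReal (4 * 2 ^ b) *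
      ∫⁻ ρ in Set.Ioi (0 : ℝ), (Set.Ici w).indicator
        (fun ρ => ENNReal.ofReal (ρ⁻¹ * (ρ⁻¹ * min (ρ ^ α) (ρ ^ (-b))))) ρ := by
  set m := min (w ^ α) (w ^ (-b))
  have hm : 0 < m := lt_min (by positivity) (by positivity)
  calc ENNReal.ofReal (w⁻¹ * m)
      = ENNReal.ofReal (4 * 2 ^ b) *
          ∫⁻ _ in Set.Icc w (2 * w), ENNReal.ofReal ((2 * w)⁻¹ * ((2 * w)⁻¹ * (2 ^ (-b) * m))) := by
        rw [setLIntegral_const, Real.volume_Icc, ← ENNReal.ofReal_mul (by positivity),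
          ← ENNReal.ofReal_mul (by positivity)]
        congr 1
        rw [Real.rpow_neg zero_le_two]
        field_simp
        ring
    _ ≤ ENNReal.ofReal (4 * 2 ^ b) *
          ∫⁻ ρ in Set.Icc w (2 * w), ENNReal.ofReal (ρ⁻¹ * (ρ⁻¹ * min (ρ ^ α) (ρ ^ (-b)))) := by
        refine mul_le_mul' le_rfl (setLIntegral_mono' measurableSet_Icc fun ρ hρ => ?_)
        have hρ0 : 0 < ρ := hw.trans_le hρ.1
        have h1 : 2 ^ (-b) * m ≤ min (ρ ^ α) (ρ ^ (-b)) := by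
          refine le_min ?_ ?_
          · have : (2 : ℝ) ^ (-b) ≤ 1 := Real.rpow_le_one_of_one_le_of_nonpos one_le_two (by linarith)
            calc 2 ^ (-b) * m ≤ 1 * w ^ α := by gcongr; exact min_le_left _ _
              _ ≤ ρ ^ α := by rw [one_mul]; gcongr; exact hρ.1
          · calc 2 ^ (-b) * m ≤ 2 ^ (-b) * w ^ (-b) := by gcongr; exact min_le_right _ _
              _ = (2 * w) ^ (-b) := (Real.mul_rpow zero_le_two hw.le).symm
              _ ≤ ρ ^ (-b) := Real.rpow_le_rpow_of_nonpos hρ0 hρ.2 (by linarith)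
        have h2 : (2 * w)⁻¹ ≤ ρ⁻¹ := by gcongr; exact hρ.2
        gcongr
    _ ≤ _ := by
        refine mul_le_mul' le_rfl ?_
        rw [setLIntegral_indicator measurableSet_Ici]
        exact lintegral_mono_set fun ρ hρ => ⟨hρ.1, hw.trans_le hρ.1⟩

/-- Averages against the rescaled kernel are controlled by means over short intervals. -/
theorem lintegral_kernel_mul_le {α b ε : ℝ} (hα : 0 < α) (hb : 0 < b) (hε : 0 < ε)
    {D : ℝ → ℝ≥0∞} (hD : Measurable D) :
    ∫⁻ y in Set.Ioi (0 : ℝ), ENNReal.ofReal (ε⁻¹ * ((ε⁻¹ * y)⁻¹ *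
        min ((ε⁻¹ * y) ^ α) ((ε⁻¹ * y) ^ (-b)))) * D y ≤
      ENNReal.ofReal (4 * 2 ^ b) * ∫⁻ ρ in Set.Ioi (0 : ℝ),
        ENNReal.ofReal (ρ⁻¹ * min (ρ ^ α) (ρ ^ (-b))) *
          ((∫⁻ y in Set.Ioc 0 (ε * ρ), D y) / ENNReal.ofReal (ε * ρ)) := by
  have hm : Measurable (Function.uncurry fun y ρ : ℝ => (Set.Ici (ε⁻¹ * y)).indicator
      (fun ρ => ENNReal.ofReal (ε⁻¹ * (ρ⁻¹ * (ρ⁻¹ * min (ρ ^ α) (ρ ^ (-b)))))) ρ * D y) := by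
    have : MeasurableSet {x : ℝ × ℝ | ε⁻¹ * x.1 ≤ x.2} := measurableSet_le (by fun_prop) (by fun_prop)
    exact (Measurable.indicator (f := fun x : ℝ × ℝ => ENNReal.ofReal
      (ε⁻¹ * (x.2⁻¹ * (x.2⁻¹ * min (x.2 ^ α) (x.2 ^ (-b)))))) (by fun_prop) this).mul
      (hD.comp measurable_fst)
  have hm2 : Measurable fun y : ℝ => ∫⁻ ρ in Set.Ioi (0 : ℝ), (Set.Ici (ε⁻¹ * y)).indicator
      (fun ρ => ENNReal.ofReal (ε⁻¹ * (ρ⁻¹ * (ρ⁻¹ * min (ρ ^ α) (ρ ^ (-b)))))) ρ * D y :=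
    hm.lintegral_prod_right'
  calc _ ≤ ∫⁻ y in Set.Ioi (0 : ℝ), ENNReal.ofReal (4 * 2 ^ b) * ∫⁻ ρ in Set.Ioi (0 : ℝ),
          (Set.Ici (ε⁻¹ * y)).indicator
          (fun ρ => ENNReal.ofReal (ε⁻¹ * (ρ⁻¹ * (ρ⁻¹ * min (ρ ^ α) (ρ ^ (-b)))))) ρ * D y := by
        refine setLIntegral_mono' measurableSet_Ioi fun y hy => ?_
        have hy0 : (0 : ℝ) < ε⁻¹ * y := mul_pos (inv_pos.2 hε) hy
        have hmi : Measurable ((Set.Ici (ε⁻¹ * y)).indicator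
            (fun ρ => ENNReal.ofReal (ρ⁻¹ * (ρ⁻¹ * min (ρ ^ α) (ρ ^ (-b)))))) :=
          Measurable.indicator (by fun_prop) measurableSet_Ici
        have e : ∀ ρ, (Set.Ici (ε⁻¹ * y)).indicator (fun ρ => ENNReal.ofReal (ε⁻¹ * (ρ⁻¹ * (ρ⁻¹ *
            min (ρ ^ α) (ρ ^ (-b)))))) ρ * D y = ENNReal.ofReal ε⁻¹ * (Set.Ici (ε⁻¹ * y)).indicator
            (fun ρ => ENNReal.ofReal (ρ⁻¹ * (ρ⁻¹ * min (ρ ^ α) (ρ ^ (-b))))) ρ * D y := fun ρ => by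
          by_cases h : ρ ∈ Set.Ici (ε⁻¹ * y)
          · rw [Set.indicator_of_mem h, Set.indicator_of_mem h, ENNReal.ofReal_mul (by positivity)]
          · rw [Set.indicator_of_notMem h, Set.indicator_of_notMem h, mul_zero]
        simp_rw [e]
        rw [lintegral_mul_const _ (hmi.const_mul _), lintegral_const_mul _ hmi,
          ENNReal.ofReal_mul (by positivity), ← mul_assoc, mul_left_comm (ENNReal.ofReal (4 * 2 ^ b))]
        gcongr
        exact inv_mul_min_le_lintegral hα hb hy0
    _ = ENNReal.ofReal (4 * 2 ^ b) * ∫⁻ ρ in Set.Ioi (0 : ℝ), ∫⁻ y in Set.Ioi (0 : ℝ),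
          (Set.Ici (ε⁻¹ * y)).indicator
          (fun ρ => ENNReal.ofReal (ε⁻¹ * (ρ⁻¹ * (ρ⁻¹ * min (ρ ^ α) (ρ ^ (-b)))))) ρ * D y := by
        rw [lintegral_const_mul _ hm2, lintegral_lintegral_swap hm.aemeasurable]
    _ = _ := by
        congr 1
        refine setLIntegral_congr_fun measurableSet_Ioi fun ρ hρ => ?_
        have hρ0 : (0 : ℝ) < ρ := hρ
        have e : ∀ y ∈ Set.Ioi (0 : ℝ), (Set.Ici (ε⁻¹ * y)).indicator (fun ρ => ENNReal.ofReal (ε⁻¹ *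
            (ρ⁻¹ * (ρ⁻¹ * min (ρ ^ α) (ρ ^ (-b)))))) ρ * D y = ENNReal.ofReal (ε⁻¹ *
            (ρ⁻¹ * (ρ⁻¹ * min (ρ ^ α) (ρ ^ (-b))))) * (Set.Iic (ε * ρ)).indicator D y := fun y _ => by
          have hiff : ρ ∈ Set.Ici (ε⁻¹ * y) ↔ y ∈ Set.Iic (ε * ρ) := by
            rw [Set.mem_Ici, Set.mem_Iic, inv_mul_le_iff₀ hε]
          by_cases h : y ∈ Set.Iic (ε * ρ)
          · rw [Set.indicator_of_mem h, Set.indicator_of_mem (hiff.2 h)]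
          · rw [Set.indicator_of_notMem h, Set.indicator_of_notMem (fun h' => h (hiff.1 h')),
              mul_zero, zero_mul]
        rw [setLIntegral_congr_fun measurableSet_Ioi e, lintegral_const_mul _
          (hD.indicator measurableSet_Iic), setLIntegral_indicator measurableSet_Iic,
          Set.inter_comm, Set.Ioi_inter_Iic, div_eq_mul_inv, mul_left_comm,
          mul_comm (∫⁻ y in Set.Ioc 0 (ε * ρ), D y), ← ENNReal.ofReal_inv_of_pos (by positivity),
          mul_left_comm, ← mul_assoc (ENNReal.ofReal _) (ENNReal.ofReal _),
          ← ENNReal.ofReal_mul (by positivity)]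
        congr 2
        field_simp

/-- Convergence of the averages at a one-sided Lebesgue point. -/
theorem tendsto_integral_mker {α : ℝ} (hα : 0 < α) {l : ℕ} (hl : α < l) {G : ℝ → ℂ} {γ : ℂ}
    (hG : Measurable G) (hGi : ∫⁻ y in Set.Ioi (0 : ℝ), ‖G y‖ₑ ≠ ∞)
    (hint : ∀ ε : ℝ, 0 < ε →
      IntegrableOn (fun y => (α⁻¹ * (ε⁻¹ * mker α l (ε⁻¹ * y))) • G y) (Set.Ioi 0))
    (hleb : Tendsto (fun δ : ℝ => (∫⁻ y in Set.Ioc 0 δ, ‖G y - γ‖ₑ) / ENNReal.ofReal δ)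
      (𝓝[>] 0) (𝓝 0)) :
    Tendsto (fun ε : ℝ => ∫ y in Set.Ioi (0 : ℝ), (α⁻¹ * (ε⁻¹ * mker α l (ε⁻¹ * y))) • G y)
      (𝓝[>] 0) (𝓝 ((Real.Gamma α * kappa α l : ℝ) • γ)) := by
  obtain ⟨C, hC, hker⟩ := exists_abs_mker_le hα hl
  have hb : 0 < (l : ℝ) - α := sub_pos.2 hl
  set b := (l : ℝ) - α
  set D : ℝ → ℝ≥0∞ := fun y => ‖G y - γ‖ₑ
  have hD : Measurable D := (hG.sub_const γ).enorm
  set A : ℝ → ℝ≥0∞ := fun δ => ∫⁻ y in Set.Ioc 0 δ, D y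
  have hA : Measurable A := Monotone.measurable fun s t hst =>
    lintegral_mono_set (Set.Ioc_subset_Ioc_right hst)
  set η : ℝ → ℝ≥0∞ := fun δ => A δ / ENNReal.ofReal δ
  have hη : Measurable η := hA.div (by fun_prop)
  -- The averages are bounded for small `δ` by the Lebesgue point condition and for larger `δ` by
  -- the integrability of `G`. This bound makes dominated convergence in `ρ` possible.
  obtain ⟨B, hB, hηB⟩ : ∃ B : ℝ≥0∞, B ≠ ∞ ∧ ∀ δ, 0 < δ → η δ ≤ B := by
    have h1 := hleb.eventually (gt_mem_nhds one_pos)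
    obtain ⟨δ₀, hδ₀, hsub⟩ := mem_nhdsGT_iff_exists_Ioo_subset.1 h1
    have hδ₀ : (0 : ℝ) < δ₀ := hδ₀
    refine ⟨max 1 ((∫⁻ y in Set.Ioi (0 : ℝ), ‖G y‖ₑ) / ENNReal.ofReal δ₀ + ‖γ‖ₑ), ?_, fun δ hδ => ?_⟩
    · refine (max_lt ENNReal.one_lt_top (ENNReal.add_lt_top.2 ⟨?_, enorm_lt_top⟩)).ne
      exact ENNReal.div_lt_top hGi (by simpa using hδ₀)
    · rcases lt_or_ge δ δ₀ with h | h
      · exact (le_of_lt (hsub ⟨hδ, h⟩)).trans (le_max_left _ _)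
      · refine le_trans ?_ (le_max_right _ _)
        have h2 : A δ ≤ (∫⁻ y in Set.Ioi (0 : ℝ), ‖G y‖ₑ) + ‖γ‖ₑ * ENNReal.ofReal δ := by
          calc A δ ≤ ∫⁻ y in Set.Ioc 0 δ, (‖G y‖ₑ + ‖γ‖ₑ) := lintegral_mono fun y => enorm_sub_le
            _ ≤ _ := by
              rw [lintegral_add_left hG.enorm, setLIntegral_const, Real.volume_Ioc, sub_zero]
              gcongr
              exact Set.Ioc_subset_Ioi_self
        have hδ' : ENNReal.ofReal δ ≠ 0 := by simpa using hδ
        calc η δ ≤ ((∫⁻ y in Set.Ioi (0 : ℝ), ‖G y‖ₑ) + ‖γ‖ₑ * ENNReal.ofReal δ) /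
              ENNReal.ofReal δ := ENNReal.div_le_div_right h2 _
          _ = (∫⁻ y in Set.Ioi (0 : ℝ), ‖G y‖ₑ) / ENNReal.ofReal δ + ‖γ‖ₑ := by
            rw [ENNReal.add_div, ENNReal.mul_div_cancel_right hδ' ENNReal.ofReal_ne_top]
          _ ≤ _ := add_le_add (ENNReal.div_le_div_left (ENNReal.ofReal_le_ofReal h) _) le_rfl
  set m : ℝ → ℝ := fun ρ => ρ⁻¹ * min (ρ ^ α) (ρ ^ (-b))
  have hmm : Measurable m := by fun_prop
  have hconst : ∀ ε : ℝ, 0 < ε → IntegrableOn (fun y => (α⁻¹ * (ε⁻¹ * mker α l (ε⁻¹ * y))) • γ)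
      (Set.Ioi 0) ∧ ∫ y in Set.Ioi (0 : ℝ), (α⁻¹ * (ε⁻¹ * mker α l (ε⁻¹ * y))) • γ =
        (Real.Gamma α * kappa α l : ℝ) • γ := by
    intro ε hε
    have h1 : IntegrableOn (fun y => mker α l (ε⁻¹ * y)) (Set.Ioi 0) := by
      rw [integrableOn_Ioi_comp_mul_left_iff _ _ (inv_pos.2 hε), mul_zero]
      exact integrableOn_mker hα hl
    refine ⟨((h1.const_mul _).const_mul _).smul_const γ, ?_⟩
    rw [integral_smul_const, integral_const_mul, integral_const_mul,
      integral_comp_mul_left_Ioi _ _ (inv_pos.2 hε), mul_zero, inv_inv, smul_eq_mul,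
      inv_mul_cancel_left₀ hε.ne', integral_mker hα hl]
  have hDCT : Tendsto (fun ε : ℝ => ∫⁻ ρ in Set.Ioi (0 : ℝ), ENNReal.ofReal (m ρ) * η (ε * ρ))
      (𝓝[>] 0) (𝓝 0) := by
    have h0 : ∫⁻ _ in Set.Ioi (0 : ℝ), (0 : ℝ≥0∞) = 0 := lintegral_zero
    rw [← h0]
    refine tendsto_lintegral_filter_of_dominated_convergence (fun ρ => ENNReal.ofReal (m ρ) * B)
      ?_ ?_ ?_ ?_
    · exact Eventually.of_forall fun ε => hmm.ennreal_ofReal.mul (hη.comp (by fun_prop))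
    · filter_upwards [self_mem_nhdsWithin] with ε hε
      filter_upwards [ae_restrict_mem measurableSet_Ioi] with ρ hρ
      exact mul_le_mul' le_rfl (hηB _ (mul_pos hε hρ))
    · rw [lintegral_mul_const _ hmm.ennreal_ofReal]
      refine ENNReal.mul_ne_top ?_ hB
      have := (integrableOn_inv_mul_min hα hb).2
      rw [hasFiniteIntegral_iff_ofReal] at this
      · exact this.ne
      · filter_upwards [ae_restrict_mem measurableSet_Ioi] with ρ hρ
        have hρ0 : (0 : ℝ) < ρ := hρ
        simp only [Pi.zero_apply]
        positivity
    · filter_upwards [ae_restrict_mem measurableSet_Ioi] with ρ hρ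
      have hρ0 : (0 : ℝ) < ρ := hρ
      have h1 : Tendsto (fun ε : ℝ => ε * ρ) (𝓝[>] 0) (𝓝[>] 0) := by
        refine tendsto_nhdsWithin_iff.2 ⟨?_, ?_⟩
        · have : Tendsto (fun ε : ℝ => ε * ρ) (𝓝 0) (𝓝 (0 * ρ)) := Continuous.tendsto (by fun_prop) 0
          rw [zero_mul] at this
          exact this.mono_left nhdsWithin_le_nhds
        · filter_upwards [self_mem_nhdsWithin] with ε hε using mul_pos hε hρ0
      have h2 := ENNReal.Tendsto.const_mul (a := ENNReal.ofReal (m ρ)) (hleb.comp h1)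
        (.inr ENNReal.ofReal_ne_top)
      rw [mul_zero] at h2
      exact h2
  rw [tendsto_iff_edist_tendsto_0]
  have hsq := ENNReal.Tendsto.const_mul (a := ENNReal.ofReal (α⁻¹ * C) * ENNReal.ofReal (4 * 2 ^ b))
    hDCT (.inr (ENNReal.mul_ne_top ENNReal.ofReal_ne_top ENNReal.ofReal_ne_top))
  rw [mul_zero] at hsq
  refine tendsto_of_tendsto_of_tendsto_of_le_of_le' tendsto_const_nhds hsq
    (Eventually.of_forall fun _ => zero_le) ?_
  filter_upwards [self_mem_nhdsWithin] with ε hε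
  have hε0 : (0 : ℝ) < ε := hε
  rw [← (hconst ε hε0).2, edist_eq_enorm_sub, ← integral_sub (hint ε hε0) (hconst ε hε0).1]
  refine (enorm_integral_le_lintegral_enorm _).trans ?_
  calc ∫⁻ y in Set.Ioi (0 : ℝ), ‖(α⁻¹ * (ε⁻¹ * mker α l (ε⁻¹ * y))) • G y -
        (α⁻¹ * (ε⁻¹ * mker α l (ε⁻¹ * y))) • γ‖ₑ
      ≤ ∫⁻ y in Set.Ioi (0 : ℝ), ENNReal.ofReal (α⁻¹ * C) *
          (ENNReal.ofReal (ε⁻¹ * m (ε⁻¹ * y)) * D y) := by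
        refine setLIntegral_mono' measurableSet_Ioi fun y hy => ?_
        have hy0 : (0 : ℝ) < ε⁻¹ * y := mul_pos (inv_pos.2 hε0) hy
        rw [← smul_sub, enorm_smul]
        refine le_trans (mul_le_mul' ?_ le_rfl) (le_of_eq (mul_assoc _ _ _))
        rw [← ENNReal.ofReal_mul (by positivity)]
        rw [← ofReal_norm, Real.norm_eq_abs, abs_mul, abs_mul, abs_of_pos (inv_pos.2 hα),
          abs_of_pos (inv_pos.2 hε0)]
        refine ENNReal.ofReal_le_ofReal ?_
        calc α⁻¹ * (ε⁻¹ * |mker α l (ε⁻¹ * y)|) ≤ α⁻¹ * (ε⁻¹ * (C * m (ε⁻¹ * y))) := by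
              gcongr
              exact hker _ hy0
          _ = _ := by ring
    _ = ENNReal.ofReal (α⁻¹ * C) * ∫⁻ y in Set.Ioi (0 : ℝ),
          ENNReal.ofReal (ε⁻¹ * m (ε⁻¹ * y)) * D y := by
        rw [lintegral_const_mul]
        exact Measurable.mul (by fun_prop) hD
    _ ≤ _ := by
        rw [mul_assoc]
        exact mul_le_mul' le_rfl (lintegral_kernel_mul_le hα hb hε0 hD)

/-! ### The coordinates `(tan²(θ/2), ξ')` on the sphere. -/

/-- The vector `(v, h) ∈ ℝ^{n+1}`. -/
def join {n : ℕ} (v : EuclideanSpace ℝ (Fin n)) (h : ℝ) : EuclideanSpace ℝ (Fin (n + 1)) :=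
  WithLp.toLp 2 (Fin.snoc (α := fun _ => ℝ) (fun i => v i) h)

theorem join_castSucc {n : ℕ} (v : EuclideanSpace ℝ (Fin n)) (h : ℝ) (i : Fin n) :
    join v h i.castSucc = v i := by simp [join]

theorem join_last {n : ℕ} (v : EuclideanSpace ℝ (Fin n)) (h : ℝ) :
    join v h (Fin.last n) = h := by simp [join]

theorem norm_join_sq {n : ℕ} (v : EuclideanSpace ℝ (Fin n)) (h : ℝ) :
    ‖join v h‖ ^ 2 = ‖v‖ ^ 2 + h ^ 2 := by
  rw [EuclideanSpace.real_norm_sq_eq, EuclideanSpace.real_norm_sq_eq, Fin.sum_univ_castSucc]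
  simp only [join_castSucc, join_last]

theorem join_sub {n : ℕ} (v w : EuclideanSpace ℝ (Fin n)) (h k : ℝ) :
    join v h - join w k = join (v - w) (h - k) := by
  ext i
  refine Fin.lastCases ?_ (fun i => ?_) i
  · simp [join_last]
  · simp [join_castSucc]

theorem join_smul {n : ℕ} (c : ℝ) (v : EuclideanSpace ℝ (Fin n)) (h : ℝ) :
    join (c • v) (c * h) = c • join v h := by
  ext i
  refine Fin.lastCases ?_ (fun i => ?_) i
  · simp [join_last]
  · simp [join_castSucc]

theorem polarVec_eq_join {n : ℕ} (θ : ℝ) (η : Sph n) :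
    polarVec θ η = join (Real.sin θ • η.1) (-Real.cos θ) := by
  simp [polarVec, join]

theorem continuous_join {n : ℕ} :
    Continuous fun p : EuclideanSpace ℝ (Fin n) × ℝ => join p.1 p.2 := by
  refine (PiLp.continuous_toLp 2 _).comp (continuous_pi fun i => ?_)
  refine Fin.lastCases ?_ (fun i => ?_) i
  · simpa using continuous_snd
  · simp only [Fin.snoc_castSucc]
    fun_prop

theorem lintegral_join {n : ℕ} {F : EuclideanSpace ℝ (Fin (n + 1)) → ℝ≥0∞} (hF : Measurable F) :
    ∫⁻ x, F x = ∫⁻ h : ℝ, ∫⁻ v : EuclideanSpace ℝ (Fin n), F (join v h) := by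
  have h1 := (PiLp.volume_preserving_toLp (Fin (n + 1))).lintegral_comp hF
  have h2 := (volume_preserving_piFinSuccAbove (fun _ : Fin (n + 1) => ℝ) (Fin.last n)).symm
    |>.lintegral_comp (hF.comp (PiLp.volume_preserving_toLp (Fin (n + 1))).measurable)
  rw [← h1]
  simp only [Function.comp_apply] at h2
  rw [← h2, Measure.volume_eq_prod, lintegral_prod]
  · refine lintegral_congr fun h => ?_
    have hm : Measurable fun v : EuclideanSpace ℝ (Fin n) => F (join v h) :=
      hF.comp (continuous_join.comp (by fun_prop : Continuous fun v : EuclideanSpace ℝ (Fin n) =>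
        (v, h))).measurable
    rw [← (PiLp.volume_preserving_toLp (Fin n)).lintegral_comp hm]
    refine lintegral_congr fun v => ?_
    rw [MeasurableEquiv.piFinSuccAbove_symm_apply]
    have : (Fin.insertNthEquiv (fun _ : Fin (n + 1) => ℝ) (Fin.last n)) (h, v) =
        Fin.snoc (α := fun _ => ℝ) v h := Fin.insertNth_last' h v
    rw [this]
    rfl
  · exact ((hF.comp (PiLp.volume_preserving_toLp (Fin (n + 1))).measurable).comp
      (MeasurableEquiv.measurable _)).aemeasurable

theorem lintegral_comp_mul_left {f : ℝ → ℝ≥0∞} (hf : Measurable f) {a : ℝ} (ha : 0 < a) :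
    ∫⁻ x, f (a * x) = ENNReal.ofReal a⁻¹ * ∫⁻ x, f x := by
  have := lintegral_map (μ := volume) hf (measurable_const_mul a)
  rw [← this, Real.map_volume_mul_left ha.ne', lintegral_smul_measure, abs_of_pos (inv_pos.2 ha),
    smul_eq_mul]

theorem lintegral_Ioi_comp_mul_left {f : ℝ → ℝ≥0∞} (hf : Measurable f) {a : ℝ} (ha : 0 < a) :
    ∫⁻ x in Set.Ioi (0 : ℝ), f (a * x) = ENNReal.ofReal a⁻¹ * ∫⁻ x in Set.Ioi (0 : ℝ), f x := by
  rw [← lintegral_indicator measurableSet_Ioi, ← lintegral_indicator measurableSet_Ioi,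
    ← lintegral_comp_mul_left (hf.indicator measurableSet_Ioi) ha]
  refine lintegral_congr fun x => ?_
  by_cases hx : 0 < x
  · rw [Set.indicator_of_mem (show x ∈ Set.Ioi (0 : ℝ) from hx),
      Set.indicator_of_mem (show a * x ∈ Set.Ioi (0 : ℝ) from mul_pos ha hx)]
  · rw [Set.indicator_of_notMem (show x ∉ Set.Ioi (0 : ℝ) from hx),
      Set.indicator_of_notMem (show a * x ∉ Set.Ioi (0 : ℝ) from
        fun h => hx ((pos_iff_pos_of_mul_pos h).1 ha))]

/-- Central projection of the sphere to the cylinder. -/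
theorem lintegral_surf_cylinder {n : ℕ} (hn : 0 < n)
    {G : EuclideanSpace ℝ (Fin (n + 1)) → ℝ≥0∞} (hG : Measurable G) :
    ∫⁻ x : Sph (n + 1), G x.1 ∂(surf (n + 1)) =
      ∫⁻ c : ℝ, ENNReal.ofReal ((√(1 + c ^ 2))⁻¹ ^ (n + 1)) *
        ∫⁻ η : Sph n, G ((√(1 + c ^ 2))⁻¹ • join η.1 c) ∂(surf n) := by
  -- The function `w(‖X‖) G(X/‖X‖)` is integrated over `ℝ^{n+1}` in spherical and in cylindrical
  -- coordinates. The radial weight contributes the same finite nonzero constant `K` to both results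
  -- and cancels.
  set w : ℝ → ℝ≥0∞ := (Set.Iio 1).indicator 1
  have hw : Measurable w := measurable_one.indicator measurableSet_Iio
  set K : ℝ≥0∞ := ∫⁻ R in Set.Ioi (0 : ℝ), ENNReal.ofReal (R ^ n) * w R
  have hK0 : K ≠ 0 := by
    have : 0 < K := by
      refine (setLIntegral_pos_iff (by fun_prop)).2 ?_
      refine lt_of_lt_of_le ?_ (measure_mono (s := Set.Ioo (0 : ℝ) 1) ?_)
      · simp
      · rintro R ⟨h0, h1⟩
        refine ⟨?_, h0⟩
        simp only [w, Function.mem_support]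
        rw [Set.indicator_of_mem (show R ∈ Set.Iio (1 : ℝ) from h1)]
        simp [pow_pos h0 n]
    exact this.ne'
  have hK1 : K ≠ ∞ := by
    have : K ≤ ∫⁻ R in Set.Ioi (0 : ℝ), (Set.Ioo (0 : ℝ) 1).indicator 1 R := by
      refine setLIntegral_mono' measurableSet_Ioi fun R hR => ?_
      by_cases h : R < 1
      · simp only [w]
        rw [Set.indicator_of_mem (show R ∈ Set.Iio (1 : ℝ) from h),
          Set.indicator_of_mem (show R ∈ Set.Ioo (0 : ℝ) 1 from ⟨hR, h⟩)]
        simpa using pow_le_one₀ (le_of_lt hR) h.le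
      · simp only [w]
        rw [Set.indicator_of_notMem (show R ∉ Set.Iio (1 : ℝ) from h), mul_zero]
        exact zero_le
    refine (this.trans_lt ?_).ne
    rw [lintegral_indicator_one measurableSet_Ioo]
    exact (Measure.restrict_apply_le _ _).trans_lt (by simp)
  set F : EuclideanSpace ℝ (Fin (n + 1)) → ℝ≥0∞ := fun X => w ‖X‖ * G (‖X‖⁻¹ • X)
  have hF : Measurable F := (hw.comp measurable_norm).mul (hG.comp (by fun_prop))
  have hl : ∫⁻ X, F X = K * ∫⁻ x : Sph (n + 1), G x.1 ∂(surf (n + 1)) := by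
    rw [lintegral_polar n.succ_pos hF, ← lintegral_mul_const _ (by fun_prop)]
    refine setLIntegral_congr_fun measurableSet_Ioi fun R hR => ?_
    have hR0 : (0 : ℝ) < R := hR
    have e : ∀ ζ : Sph (n + 1), F (R • ζ.1) = w R * G ζ.1 := fun ζ => by
      have hζ : ‖ζ.1‖ = 1 := by simp
      simp only [F]
      rw [norm_smul, hζ, mul_one, Real.norm_of_nonneg hR0.le, inv_smul_smul₀ hR0.ne']
    simp_rw [e]
    rw [lintegral_const_mul _ (by fun_prop), mul_assoc]
    rfl
  set k : ℝ → ℝ := fun c => √(1 + c ^ 2)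
  have hk : ∀ c, 0 < k c := fun c => by positivity
  have hkm : Measurable k := by fun_prop
  have hj : ∀ (η : Sph n) c, ‖join η.1 c‖ = k c := fun η c => by
    have hη : ‖η.1‖ = 1 := by simp
    simp only [k]
    rw [← Real.sqrt_sq (norm_nonneg _), norm_join_sq, hη, one_pow]
  have hjm : Measurable fun q : ℝ × Sph n => join q.2.1 q.1 :=
    (continuous_join.comp (by fun_prop : Continuous fun q : ℝ × Sph n => (q.2.1, q.1))).measurable
  have hMm : Measurable fun c => ∫⁻ η : Sph n, G ((k c)⁻¹ • join η.1 c) ∂(surf n) := by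
    refine Measurable.lintegral_prod_right'
      (f := fun q : ℝ × Sph n => G ((k q.1)⁻¹ • join q.2.1 q.1)) ?_
    exact hG.comp (((hkm.comp measurable_fst).inv).smul hjm)
  set M : ℝ → ℝ≥0∞ := fun c => ∫⁻ η : Sph n, G ((k c)⁻¹ • join η.1 c) ∂(surf n)
  have hr : ∫⁻ X, F X = ∫⁻ c : ℝ, K * (ENNReal.ofReal ((k c)⁻¹ ^ (n + 1)) * M c) := by
    calc ∫⁻ X, F X = ∫⁻ h : ℝ, ∫⁻ ρ in Set.Ioi (0 : ℝ), ENNReal.ofReal (ρ ^ (n - 1)) *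
          ∫⁻ η : Sph n, F (join (ρ • η.1) h) ∂(surf n) := by
          rw [lintegral_join hF]
          refine lintegral_congr fun h => ?_
          exact lintegral_polar hn (F := fun v => F (join v h)) (hF.comp (continuous_join.comp
            (by fun_prop : Continuous fun v : EuclideanSpace ℝ (Fin n) => (v, h))).measurable)
      _ = ∫⁻ ρ in Set.Ioi (0 : ℝ), ∫⁻ h : ℝ, ENNReal.ofReal (ρ ^ (n - 1)) *
          ∫⁻ η : Sph n, F (join (ρ • η.1) h) ∂(surf n) := by
          refine lintegral_lintegral_swap (Measurable.aemeasurable ?_)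
          refine Measurable.mul (by fun_prop) ?_
          refine Measurable.lintegral_prod_right'
            (f := fun q : (ℝ × ℝ) × Sph n => F (join (q.1.2 • q.2.1) q.1.1)) ?_
          exact hF.comp (continuous_join.comp (by fun_prop : Continuous fun q : (ℝ × ℝ) × Sph n =>
            (q.1.2 • q.2.1, q.1.1))).measurable
      -- The substitution `h = ρ c` turns the point into `ρ (η, c)`, whose direction no longer
      -- depends on `ρ`.
      _ = ∫⁻ ρ in Set.Ioi (0 : ℝ), ∫⁻ c : ℝ, ENNReal.ofReal (ρ ^ n) * w (k c * ρ) * M c := by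
          refine setLIntegral_congr_fun measurableSet_Ioi fun ρ hρ => ?_
          have hρ0 : (0 : ℝ) < ρ := hρ
          have e : ∀ c, ∫⁻ η : Sph n, F (join (ρ • η.1) (ρ * c)) ∂(surf n) = w (k c * ρ) * M c :=
            fun c => by
              have hGm : Measurable fun η : Sph n => G ((k c)⁻¹ • join η.1 c) :=
                by
                have h0 : Measurable fun η : Sph n => join η.1 c := hjm.comp measurable_prodMk_left
                fun_prop
              rw [← lintegral_const_mul _ hGm]
              refine lintegral_congr fun η => ?_
              simp only [F]
              rw [join_smul, norm_smul, hj, Real.norm_of_nonneg hρ0.le, mul_comm ρ, smul_smul,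
                mul_inv, mul_assoc, inv_mul_cancel₀ hρ0.ne', mul_one]
          have hmeas : Measurable fun h : ℝ => ∫⁻ η : Sph n, F (join (ρ • η.1) h) ∂(surf n) := by
            refine Measurable.lintegral_prod_right'
              (f := fun q : ℝ × Sph n => F (join (ρ • q.2.1) q.1)) ?_
            exact hF.comp (continuous_join.comp (by fun_prop : Continuous fun q : ℝ × Sph n =>
              (ρ • q.2.1, q.1))).measurable
          have h3 := lintegral_comp_mul_left hmeas hρ0
          simp_rw [e] at h3
          have h4 : ∫⁻ h : ℝ, ∫⁻ η : Sph n, F (join (ρ • η.1) h) ∂(surf n) =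
              ENNReal.ofReal ρ * ∫⁻ c, w (k c * ρ) * M c := by
            rw [h3, ← mul_assoc, ← ENNReal.ofReal_mul hρ0.le, mul_inv_cancel₀ hρ0.ne',
              ENNReal.ofReal_one, one_mul]
          rw [lintegral_const_mul _ hmeas, h4, ← mul_assoc, ← ENNReal.ofReal_mul (by positivity),
            ← pow_succ, Nat.sub_add_cancel hn, ← lintegral_const_mul _ (by fun_prop)]
          simp_rw [mul_assoc]
      _ = ∫⁻ c : ℝ, ∫⁻ ρ in Set.Ioi (0 : ℝ), ENNReal.ofReal (ρ ^ n) * w (k c * ρ) * M c := by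
          refine lintegral_lintegral_swap (Measurable.aemeasurable ?_)
          refine Measurable.mul (Measurable.mul (by fun_prop) (hw.comp ?_)) (hMm.comp measurable_snd)
          exact (hkm.comp measurable_snd).mul measurable_fst
      _ = _ := by
          refine lintegral_congr fun c => ?_
          rw [lintegral_mul_const _ (by fun_prop),
            ← mul_assoc]
          congr 1
          have h5 := lintegral_Ioi_comp_mul_left (f := fun R => ENNReal.ofReal (R ^ n) * w R)
            (by fun_prop) (hk c)
          have e : ∀ ρ : ℝ, ENNReal.ofReal (ρ ^ n) * w (k c * ρ) = ENNReal.ofReal ((k c)⁻¹ ^ n) *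
              (ENNReal.ofReal ((k c * ρ) ^ n) * w (k c * ρ)) := fun ρ => by
            rw [← mul_assoc, ← ENNReal.ofReal_mul (pow_nonneg (inv_nonneg.2 (hk c).le) n), ← mul_pow,
              inv_mul_cancel_left₀ (hk c).ne']
          simp_rw [e]
          rw [lintegral_const_mul _ (by fun_prop), h5,
            ← mul_assoc, ← ENNReal.ofReal_mul (pow_nonneg (inv_nonneg.2 (hk c).le) n), ← pow_succ,
            mul_comm]
  rw [hl, lintegral_const_mul _ (by fun_prop)] at hr
  exact (ENNReal.mul_right_inj hK0 hK1).1 hr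

/-- The point of `S^n` whose polar angle `θ` satisfies `tan²(θ/2) = s`. -/
def slice {n : ℕ} (s : ℝ) (η : Sph n) : Sph (n + 1) := polar (2 * Real.arctan (√s)) η

/-- The density of the surface measure in the coordinates `(tan²(θ/2), ξ')`. -/
def sliceDensity (n : ℕ) (s : ℝ) : ℝ := 2 ^ (n - 1) * s ^ ((n : ℝ) / 2 - 1) / (1 + s) ^ n

theorem sliceDensity_pos {n : ℕ} {s : ℝ} (hs : 0 < s) : 0 < sliceDensity n s := by
  unfold sliceDensity
  positivity

theorem measurable_sliceDensity (n : ℕ) : Measurable (sliceDensity n) := by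
  unfold sliceDensity
  fun_prop

theorem continuous_polar {n : ℕ} {X : Type*} [TopologicalSpace X] {f : X → ℝ} {g : X → Sph n}
    (hf : Continuous f) (hg : Continuous g) : Continuous fun x => polar (f x) (g x) := by
  refine Continuous.subtype_mk ?_ _
  simp_rw [polarVec_eq_join]
  exact continuous_join.comp (by fun_prop : Continuous fun x =>
    (Real.sin (f x) • (g x).1, -Real.cos (f x)))

theorem continuous_slice {n : ℕ} : Continuous fun p : ℝ × Sph n => slice p.1 p.2 :=
  continuous_polar (by fun_prop) continuous_snd

theorem continuous_slice_right {n : ℕ} (s : ℝ) : Continuous fun η : Sph n => slice s η :=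
  continuous_polar continuous_const continuous_id

theorem sin_two_arctan_sqrt {s : ℝ} (hs : 0 ≤ s) :
    Real.sin (2 * Real.arctan (√s)) = 2 * √s / (1 + s) := by
  have h1 : 0 < 1 + s := by linarith
  rw [Real.sin_two_mul, Real.sin_arctan, Real.cos_arctan, Real.sq_sqrt hs, mul_assoc, div_mul_div_comm,
    mul_one, Real.mul_self_sqrt h1.le, mul_div_assoc]

theorem cos_two_arctan_sqrt {s : ℝ} (hs : 0 ≤ s) :
    Real.cos (2 * Real.arctan (√s)) = (1 - s) / (1 + s) := by
  have h1 : 1 + s ≠ 0 := by linarith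
  rw [Real.cos_two_mul, Real.cos_sq_arctan, Real.sq_sqrt hs]
  field_simp
  ring

theorem slice_val {n : ℕ} {s : ℝ} (hs : 0 ≤ s) (η : Sph n) :
    (slice s η).1 = join ((2 * √s / (1 + s)) • η.1) ((s - 1) / (1 + s)) := by
  change polarVec _ _ = _
  rw [polarVec_eq_join, sin_two_arctan_sqrt hs, cos_two_arctan_sqrt hs, ← neg_div, neg_sub]

theorem height_slice {n : ℕ} {s : ℝ} (hs : 0 ≤ s) (η : Sph n) :
    height (slice s η) = (s - 1) / (1 + s) := by
  rw [height, slice_val hs, join_last]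

theorem horiz_slice {n : ℕ} {s : ℝ} (hs : 0 ≤ s) (η : Sph n) :
    horiz (slice s η) = (2 * √s / (1 + s)) • η.1 := by
  ext i
  simp only [horiz]
  rw [slice_val hs, join_castSucc]

theorem dir_slice {n : ℕ} {s : ℝ} (hs : 0 < s) (η : Sph n) : dir (slice s η) = η.1 := by
  have hη : ‖η.1‖ = 1 := by simp
  have h : 0 < 2 * √s / (1 + s) := by positivity
  rw [dir, horiz_slice hs.le, norm_smul, hη, mul_one, Real.norm_of_nonneg h.le,
    inv_smul_smul₀ h.ne']

theorem theta_slice {n : ℕ} {s : ℝ} (hs : 0 ≤ s) (η : Sph n) :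
    theta (slice s η) = 2 * Real.arctan (√s) := by
  rw [theta, height_slice hs, ← neg_div, neg_sub, ← cos_two_arctan_sqrt hs, Real.arccos_cos]
  · have := Real.arctan_nonneg.2 (Real.sqrt_nonneg s)
    linarith
  · linarith [Real.arctan_lt_pi_div_two (√s)]

theorem tsq_slice {n : ℕ} {s : ℝ} (hs : 0 ≤ s) (η : Sph n) : tsq (slice s η) = s := by
  rw [tsq, theta_slice hs, mul_div_cancel_left₀ _ two_ne_zero, Real.tan_arctan, Real.sq_sqrt hs]

/-- The cylinder coordinate is `c = -cot θ = (s - 1)/(2√s)`, an increasing bijection of the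
half-line onto `ℝ` with inverse `s = (c + √(1 + c²))²`. Its Jacobian times the weight of the
cylindrical projection is `sliceDensity`. -/
theorem lintegral_surf_slice {n : ℕ} (hn : 0 < n) {g : Sph (n + 1) → ℝ≥0∞} (hg : Measurable g) :
    ∫⁻ x, g x ∂(surf (n + 1)) = ∫⁻ s in Set.Ioi (0 : ℝ), ENNReal.ofReal (sliceDensity n s) *
      ∫⁻ η, g (slice s η) ∂(surf n) := by
  have hemb : MeasurableEmbedding (Subtype.val : Sph (n + 1) → EuclideanSpace ℝ (Fin (n + 1))) :=
    MeasurableEmbedding.subtype_coe Metric.isClosed_sphere.measurableSet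
  obtain ⟨G, hG, hGg⟩ := hemb.exists_measurable_extend hg fun _ => ⟨0⟩
  have hGg' : ∀ x : Sph (n + 1), g x = G x.1 := fun x => (congrFun hGg x).symm
  simp_rw [hGg']
  rw [lintegral_surf_cylinder hn hG]
  set c : ℝ → ℝ := fun s => (s - 1) / (2 * √s)
  have hd : ∀ s ∈ Set.Ioi (0 : ℝ), HasDerivWithinAt c ((1 + s) / (4 * (s * √s))) (Set.Ioi 0) s := by
    intro s hs
    have hs0 : (0 : ℝ) < s := hs
    have hq : 0 < √s := Real.sqrt_pos.2 hs0
    have h1 := ((hasDerivAt_id s).sub_const 1).div ((Real.hasDerivAt_sqrt hs0.ne').const_mul 2)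
      (by positivity)
    refine (h1.congr_deriv ?_).hasDerivWithinAt
    simp only [id]
    have h2 : √s ^ 2 = s := Real.sq_sqrt hs0.le
    field_simp
    ring_nf
    simp only [h2]
    ring
  have hcsq : ∀ s ∈ Set.Ioi (0 : ℝ), √(1 + c s ^ 2) = (1 + s) / (2 * √s) := by
    intro s hs
    have hs0 : (0 : ℝ) < s := hs
    have hq : 0 < √s := Real.sqrt_pos.2 hs0
    rw [Real.sqrt_eq_iff_mul_self_eq (by positivity) (by positivity)]
    simp only [c]
    have h2 : √s ^ 2 = s := Real.sq_sqrt hs0.le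
    field_simp
    rw [h2]
    ring
  have hsq : ∀ s ∈ Set.Ioi (0 : ℝ), c s + √(1 + c s ^ 2) = √s := by
    intro s hs
    have hs0 : (0 : ℝ) < s := hs
    have hq : 0 < √s := Real.sqrt_pos.2 hs0
    have h2 : √s ^ 2 = s := Real.sq_sqrt hs0.le
    rw [hcsq s hs]
    simp only [c]
    field_simp
    rw [h2]
    ring
  have hinj : Set.InjOn c (Set.Ioi 0) := by
    intro s hs u hu h
    have h1 : √s = √u := by rw [← hsq s hs, ← hsq u hu, h]
    exact (Real.sqrt_inj (le_of_lt hs) (le_of_lt hu)).1 h1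
  have himg : c '' Set.Ioi 0 = Set.univ := by
    refine Set.eq_univ_of_forall fun y => ⟨(y + √(1 + y ^ 2)) ^ 2, ?_, ?_⟩
    · have : |y| < √(1 + y ^ 2) := by
        rw [← Real.sqrt_sq_eq_abs]
        exact Real.sqrt_lt_sqrt (sq_nonneg y) (by linarith)
      have h := neg_abs_le y
      have : 0 < y + √(1 + y ^ 2) := by linarith
      exact pow_pos this 2
    · have : |y| < √(1 + y ^ 2) := by
        rw [← Real.sqrt_sq_eq_abs]
        exact Real.sqrt_lt_sqrt (sq_nonneg y) (by linarith)
      have h := neg_abs_le y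
      have h0 : 0 < y + √(1 + y ^ 2) := by linarith
      have h2 : √(1 + y ^ 2) ^ 2 = 1 + y ^ 2 := Real.sq_sqrt (by positivity)
      simp only [c]
      rw [Real.sqrt_sq h0.le, div_eq_iff (by positivity)]
      nlinarith
  rw [← setLIntegral_univ, ← himg, lintegral_image_eq_lintegral_abs_deriv_mul measurableSet_Ioi hd hinj]
  refine setLIntegral_congr_fun measurableSet_Ioi fun s hs => ?_
  have hs0 : (0 : ℝ) < s := hs
  have hq : 0 < √s := Real.sqrt_pos.2 hs0
  have e : ∀ η : Sph n, ((1 + s) / (2 * √s))⁻¹ • join η.1 (c s) = (slice s η).1 := fun η => by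
    rw [slice_val hs0.le, ← join_smul, inv_div]
    congr 1
    simp only [c]
    field_simp
  rw [hcsq s hs]
  simp_rw [e]
  rw [← mul_assoc, ← ENNReal.ofReal_mul (abs_nonneg _)]
  congr 2
  rw [abs_of_pos (by positivity), sliceDensity, Real.rpow_sub hs0, Real.rpow_one,
    show (n : ℝ) / 2 = (1 / 2) * n by ring, Real.rpow_mul_natCast hs0.le, ← Real.sqrt_eq_rpow,
    inv_div, div_pow, mul_pow, pow_succ, pow_succ, pow_succ (1 + s)]
  obtain ⟨k, rfl⟩ : ∃ k, n = k + 1 := ⟨n - 1, by omega⟩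
  rw [Nat.add_sub_cancel, pow_succ (2 : ℝ) k]
  field_simp
  norm_num

/-- The product measure `ds dη` on the half line times the sphere. -/
def cyl (n : ℕ) : Measure (ℝ × Sph n) := (volume.restrict (Set.Ioi (0 : ℝ))).prod (surf n)

theorem measurable_sliceDensity_fst (n : ℕ) :
    Measurable fun p : ℝ × Sph n => ENNReal.ofReal (sliceDensity n p.1) :=
  ((measurable_sliceDensity n).comp measurable_fst).ennreal_ofReal

theorem ae_cyl_pos (n : ℕ) : ∀ᵐ p ∂(cyl n), 0 < p.1 :=
  Measure.quasiMeasurePreserving_fst.ae (ae_restrict_mem measurableSet_Ioi)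

theorem map_slice {n : ℕ} (hn : 0 < n) :
    ((cyl n).withDensity fun p => ENNReal.ofReal (sliceDensity n p.1)).map
      (fun p => slice p.1 p.2) = surf (n + 1) := by
  refine Measure.ext_of_lintegral _ fun g hg => ?_
  have hm : Measurable fun p : ℝ × Sph n => g (slice p.1 p.2) := hg.comp continuous_slice.measurable
  rw [lintegral_map hg continuous_slice.measurable, lintegral_surf_slice hn hg,
    lintegral_withDensity_eq_lintegral_mul _ (measurable_sliceDensity_fst n) hm, cyl,
    lintegral_prod _ ((measurable_sliceDensity_fst n).mul hm).aemeasurable]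
  refine lintegral_congr fun s => ?_
  simp only [Pi.mul_apply]
  have hs : Measurable fun η : Sph n => g (slice s η) :=
    hg.comp (continuous_slice_right s).measurable
  rw [lintegral_const_mul _ hs]

theorem cyl_absolutelyContinuous (n : ℕ) :
    cyl n ≪ (cyl n).withDensity fun p => ENNReal.ofReal (sliceDensity n p.1) := by
  refine withDensity_absolutelyContinuous' (measurable_sliceDensity_fst n).aemeasurable ?_
  filter_upwards [ae_cyl_pos n] with p hp
  simpa using sliceDensity_pos hp

theorem quasiMeasurePreserving_slice {n : ℕ} (hn : 0 < n) :
    Measure.QuasiMeasurePreserving (fun p : ℝ × Sph n => slice p.1 p.2) (cyl n) (surf (n + 1)) :=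
  ⟨continuous_slice.measurable, by
    rw [← map_slice hn]
    exact (cyl_absolutelyContinuous n).map continuous_slice.measurable⟩

theorem measurable_height {n : ℕ} : Measurable (height : Sph (n + 1) → ℝ) := by
  have : Continuous fun x : Sph (n + 1) => x.1 (Fin.last n) := by fun_prop
  exact this.measurable

theorem measurable_horiz {n : ℕ} : Measurable (horiz : Sph (n + 1) → _) := by
  have : Continuous fun x : Sph (n + 1) =>
      (WithLp.toLp 2 (fun i : Fin n => x.1 i.castSucc) : EuclideanSpace ℝ (Fin n)) :=
    (PiLp.continuous_toLp 2 _).comp (by fun_prop)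
  exact this.measurable

theorem measurable_tsq {n : ℕ} : Measurable (tsq : Sph (n + 1) → ℝ) := by
  have h : Measurable (theta : Sph (n + 1) → ℝ) :=
    Real.continuous_arccos.measurable.comp measurable_height.neg
  have : Measurable Real.tan := by
    have : Real.tan = fun x => Real.sin x / Real.cos x := funext Real.tan_eq_sin_div_cos
    rw [this]
    fun_prop
  exact (this.comp (h.div_const 2)).pow_const 2

/-- Null sets of the sphere in the coordinates `(tan²(θ/2), ξ')`. -/
theorem ae_surf_iff {n : ℕ} (hn : 0 < n) {P : Sph (n + 1) → Prop} :
    (∀ᵐ x ∂(surf (n + 1)), P x) ↔ ∀ᵐ p ∂(cyl n), P (slice p.1 p.2) := by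
  refine ⟨fun h => (quasiMeasurePreserving_slice hn).ae h, fun h => ?_⟩
  have hemb : MeasurableEmbedding (Subtype.val : Sph n → EuclideanSpace ℝ (Fin n)) :=
    MeasurableEmbedding.subtype_coe Metric.isClosed_sphere.measurableSet
  have : Nonempty (Sph n) := by
    have : Nonempty (Fin n) := ⟨⟨0, hn⟩⟩
    exact (NormedSpace.sphere_nonempty (E := EuclideanSpace ℝ (Fin n)).2 zero_le_one).to_subtype
  -- `P` need not be measurable, so its exceptional set is transported by an almost everywhere
  -- inverse `Φ` of `slice`. Since `dir` takes values in the ambient space, a measurable retraction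
  -- `π` onto the sphere is required.
  obtain ⟨π, hπ, hπi⟩ := hemb.exists_measurable_extend measurable_id fun _ => inferInstance
  set Φ : Sph (n + 1) → ℝ × Sph n := fun x => (tsq x, π (dir x))
  have hΦ : Measurable Φ := by
    refine measurable_tsq.prodMk (hπ.comp ?_)
    exact measurable_horiz.norm.inv.smul measurable_horiz
  set μ := (cyl n).withDensity fun p => ENNReal.ofReal (sliceDensity n p.1)
  have hμ : μ ≪ cyl n := withDensity_absolutelyContinuous _ _
  have hinv : ∀ᵐ p ∂μ, Φ (slice p.1 p.2) = p := by
    filter_upwards [hμ.ae_le (ae_cyl_pos n)] with p hp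
    refine Prod.ext (tsq_slice hp.le p.2) ?_
    simp only [Φ]
    rw [dir_slice hp]
    exact congrFun hπi p.2
  have h1 : ∀ᵐ x ∂(surf (n + 1)), slice (Φ x).1 (Φ x).2 = x := by
    have hset : MeasurableSet {x : Sph (n + 1) | slice (Φ x).1 (Φ x).2 = x} :=
      measurableSet_eq_fun (continuous_slice.measurable.comp hΦ) measurable_id
    rw [← map_slice hn, ae_map_iff continuous_slice.measurable.aemeasurable hset]
    filter_upwards [hinv] with p hp
    rw [hp]
  have h2 : (surf (n + 1)).map Φ = μ := by
    rw [← map_slice hn, Measure.map_map hΦ continuous_slice.measurable]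
    exact (Measure.map_congr hinv).trans Measure.map_id
  have h3 : ∀ᵐ p ∂μ, P (slice p.1 p.2) := hμ.ae_le h
  rw [← h2] at h3
  filter_upwards [ae_of_ae_map hΦ.aemeasurable h3, h1] with x hx hx1
  rwa [hx1] at hx

theorem integrable_surf_iff {n : ℕ} (hn : 0 < n) {f : Sph (n + 1) → ℂ} (hf : Measurable f) :
    Integrable f (surf (n + 1)) ↔
      Integrable (fun p : ℝ × Sph n => sliceDensity n p.1 • f (slice p.1 p.2)) (cyl n) := by
  rw [← map_slice hn, integrable_map_measure hf.aestronglyMeasurable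
    continuous_slice.measurable.aemeasurable, integrable_withDensity_iff_integrable_smul'
    (measurable_sliceDensity_fst n) (Eventually.of_forall fun _ => ENNReal.ofReal_lt_top)]
  refine integrable_congr ?_
  filter_upwards [ae_cyl_pos n] with p hp
  rw [ENNReal.toReal_ofReal (sliceDensity_pos hp).le]
  rfl

theorem integral_surf_slice {n : ℕ} (hn : 0 < n) {f : Sph (n + 1) → ℂ} (hf : Measurable f) :
    ∫ x, f x ∂(surf (n + 1)) = ∫ p, sliceDensity n p.1 • f (slice p.1 p.2) ∂(cyl n) := by
  rw [← map_slice hn, integral_map continuous_slice.measurable.aemeasurable hf.aestronglyMeasurable,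
    integral_withDensity_eq_integral_toReal_smul
    (measurable_sliceDensity_fst n) (Eventually.of_forall fun _ => ENNReal.ofReal_lt_top)]
  refine integral_congr_ae ?_
  filter_upwards [ae_cyl_pos n] with p hp
  rw [ENNReal.toReal_ofReal (sliceDensity_pos hp).le]

/-- Distances on the sphere in terms of the coordinates `(tan²(θ/2), ξ')`. -/
theorem norm_slice_sub {n : ℕ} {s t : ℝ} (hs : 0 < s) (ht : 0 < t) (ξ η : Sph n) :
    ‖(slice t ξ).1 - (slice s η).1‖ =
      2 * √t * ‖(√(s / t)) • ξ.1 - η.1‖ / (√(1 + t) * √(1 + s)) := by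
  have hξ : ‖ξ.1‖ = 1 := by simp
  have hη : ‖η.1‖ = 1 := by simp
  have hp : 0 < √t := Real.sqrt_pos.2 ht
  have hq : 0 < √s := Real.sqrt_pos.2 hs
  have hp2 : √t ^ 2 = t := Real.sq_sqrt ht.le
  have hq2 : √s ^ 2 = s := Real.sq_sqrt hs.le
  refine (sq_eq_sq₀ (norm_nonneg _) (by positivity)).1 ?_
  rw [slice_val hs.le, slice_val ht.le, join_sub, norm_join_sq, div_pow, mul_pow, mul_pow, mul_pow,
    Real.sq_sqrt (by linarith : 0 ≤ 1 + t), Real.sq_sqrt (by linarith : 0 ≤ 1 + s),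
    norm_sub_sq_real, norm_sub_sq_real, norm_smul, norm_smul, norm_smul, inner_smul_left,
    inner_smul_left, inner_smul_right, hξ, hη, Real.sqrt_div hs.le]
  simp only [Real.norm_eq_abs, mul_one, sq_abs, conj_trivial]
  generalize inner ℝ ξ.1 η.1 = κ
  generalize √t = p at *
  generalize √s = q at *
  subst hp2 hq2
  field_simp
  ring

theorem height_slice_sub {n : ℕ} {s t : ℝ} (hs : 0 ≤ s) (ht : 0 ≤ t) (ξ η : Sph n) :
    height (slice t ξ) - height (slice s η) = 2 * (t - s) / ((1 + t) * (1 + s)) := by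
  rw [height_slice hs, height_slice ht]
  have h1 : 1 + t ≠ 0 := by linarith
  have h2 : 1 + s ≠ 0 := by linarith
  field_simp
  ring

theorem slice_mem_seg {n : ℕ} {a : ℝ} (ha' : a < 1) {s t : ℝ} (hs : 0 ≤ s)
    (ht : 0 ≤ t) (ξ η : Sph n) :
    slice s η ∈ seg n a (height (slice t ξ)) ↔ (1 + a) / (1 - a) < s ∧ s < t := by
  have h1 : 0 < 1 + t := by linarith
  have h2 : 0 < 1 + s := by linarith
  have h3 : 0 < 1 - a := by linarith
  rw [seg, Set.mem_ofPred_eq, height_slice hs, height_slice ht, lt_div_iff₀ h2, div_lt_iff₀ h3,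
    div_lt_div_iff₀ h2 h1]
  constructor <;> rintro ⟨h4, h5⟩ <;> constructor <;> nlinarith

theorem slice_mem_cap {n : ℕ} {a : ℝ} (ha' : a < 1) {s : ℝ} (hs : 0 ≤ s)
    (η : Sph n) : slice s η ∈ seg n a 1 ↔ (1 + a) / (1 - a) < s := by
  have h2 : 0 < 1 + s := by linarith
  have h3 : 0 < 1 - a := by linarith
  rw [seg, Set.mem_ofPred_eq, height_slice hs, lt_div_iff₀ h2, div_lt_iff₀ h3, div_lt_one h2]
  constructor
  · rintro ⟨h4, h5⟩
    nlinarith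
  · intro h4
    constructor <;> nlinarith

/-! ### One-sided Lebesgue points in one variable of a product. -/

/-- A one-sided average over dyadic intervals controls all small one-sided averages. -/
theorem tendsto_average_of_dyadic {D : ℝ → ℝ≥0∞}
    (h : Tendsto (fun j : ℕ => (∫⁻ y in Set.Ioc (0 : ℝ) ((1 / 2) ^ j), D y) /
      ENNReal.ofReal ((1 / 2) ^ j)) atTop (𝓝 0)) :
    Tendsto (fun δ : ℝ => (∫⁻ y in Set.Ioc 0 δ, D y) / ENNReal.ofReal δ) (𝓝[>] 0) (𝓝 0) := by
  rw [ENNReal.tendsto_nhds_zero] at h ⊢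
  intro ε hε
  obtain ⟨J, hJ⟩ := eventually_atTop.1 (h (ε / 2) (ENNReal.half_pos hε.ne'))
  filter_upwards [Ioo_mem_nhdsGT (show (0 : ℝ) < (1 / 2) ^ J by positivity)] with δ hδ
  obtain ⟨j, hj1, hj2⟩ := exists_nat_pow_near_of_lt_one hδ.1
    (hδ.2.le.trans (pow_le_one₀ (by norm_num) (by norm_num))) (by norm_num : (0 : ℝ) < 1 / 2)
    (by norm_num)
  have hjJ : J ≤ j := by
    by_contra hlt
    have h1 : (1 / 2 : ℝ) ^ J ≤ (1 / 2) ^ (j + 1) :=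
      pow_le_pow_of_le_one (by norm_num) (by norm_num) (by omega)
    linarith [hδ.2]
  have h2 : ENNReal.ofReal ((1 / 2) ^ (j + 1)) = ENNReal.ofReal ((1 / 2) ^ j) / 2 := by
    rw [pow_succ, ENNReal.ofReal_mul (by positivity), ENNReal.div_eq_inv_mul, mul_comm]
    congr 1
    rw [one_div, ENNReal.ofReal_inv_of_pos two_pos, ENNReal.ofReal_ofNat]
  calc (∫⁻ y in Set.Ioc 0 δ, D y) / ENNReal.ofReal δ
      ≤ (∫⁻ y in Set.Ioc (0 : ℝ) ((1 / 2) ^ j), D y) / (ENNReal.ofReal ((1 / 2) ^ j) / 2) := by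
        rw [← h2]
        exact ENNReal.div_le_div (lintegral_mono_set (Set.Ioc_subset_Ioc_right hj2))
          (ENNReal.ofReal_le_ofReal hj1.le)
    _ = (∫⁻ y in Set.Ioc (0 : ℝ) ((1 / 2) ^ j), D y) / ENNReal.ofReal ((1 / 2) ^ j) * 2 := by
        generalize ENNReal.ofReal ((1 / 2) ^ j) = b
        generalize ∫⁻ y in Set.Ioc (0 : ℝ) ((1 / 2) ^ j), D y = A
        rw [div_eq_mul_inv, div_eq_mul_inv _ b, ENNReal.inv_div (by simp) (by simp),
          div_eq_mul_inv, mul_comm 2, mul_assoc]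
    _ ≤ ε / 2 * 2 := mul_le_mul' (hJ j hjJ) le_rfl
    _ = ε := ENNReal.div_mul_cancel (by simp) (by simp)

/-- The one-sided interval `[x - d, x]` is the closed ball of radius `d/2` about `x - d/2`, which
contains `x`; Lebesgue's theorem for off-center balls applies to it. -/
theorem ae_dyadic_lebesgue_point {E : Type*} [NormedAddCommGroup E] {f : ℝ → E}
    (hf : LocallyIntegrable f) :
    ∀ᵐ x : ℝ, Tendsto (fun j : ℕ => (∫⁻ y in Set.Ioc (0 : ℝ) ((1 / 2) ^ j), ‖f (x - y) - f x‖ₑ) /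
      ENNReal.ofReal ((1 / 2) ^ j)) atTop (𝓝 0) := by
  filter_upwards [IsUnifLocDoublingMeasure.ae_tendsto_average_norm_sub volume hf 1] with x hx
  set d : ℕ → ℝ := fun j => (1 / 2) ^ j
  have hd : ∀ j, 0 < d j := fun j => by positivity
  have hd0 : Tendsto d atTop (𝓝 0) :=
    tendsto_pow_atTop_nhds_zero_of_lt_one (by norm_num) (by norm_num)
  have hlim := hx (l := atTop) (fun j : ℕ => x - d j / 2) (fun j => d j / 2)
    (tendsto_nhdsWithin_iff.2 ⟨by simpa using hd0.div_const 2,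
      Eventually.of_forall fun j => half_pos (hd j)⟩)
    (Eventually.of_forall fun j => by
      rw [Metric.mem_closedBall, Real.dist_eq, one_mul, sub_sub_cancel, abs_of_pos (half_pos (hd j))])
  have hball : ∀ j, Metric.closedBall (x - d j / 2) (d j / 2) = Set.Icc (x - d j) x := fun j => by
    rw [Real.closedBall_eq_Icc]
    congr 1 <;> ring
  have h := ENNReal.tendsto_ofReal hlim
  rw [ENNReal.ofReal_zero] at h
  refine tendsto_of_tendsto_of_tendsto_of_le_of_le tendsto_const_nhds h (fun _ => zero_le)
    fun j => ?_
  simp only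
  rw [hball, setAverage_eq, smul_eq_mul, Measure.real, Real.volume_Icc, sub_sub_cancel,
    ENNReal.toReal_ofReal (hd j).le, ENNReal.ofReal_mul (inv_nonneg.2 (hd j).le),
    ENNReal.ofReal_inv_of_pos (hd j), mul_comm, ← div_eq_mul_inv]
  refine ENNReal.div_le_div_right ?_ _
  have hint : IntegrableOn (fun y => f y - f x) (Set.Icc (x - d j) x) :=
    (hf.integrableOn_isCompact isCompact_Icc).sub (integrableOn_const (by simp))
  rw [ofReal_integral_norm_eq_lintegral_enorm hint, ← lintegral_indicator measurableSet_Ioc, ← lintegral_indicator measurableSet_Icc,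
    ← lintegral_sub_left_eq_self _ x]
  refine lintegral_mono fun y => ?_
  by_cases hy : x - y ∈ Set.Ioc 0 (d j)
  · rw [Set.indicator_of_mem hy, Set.indicator_of_mem
      (show y ∈ Set.Icc (x - d j) x from ⟨by linarith [hy.2], by linarith [hy.1]⟩), sub_sub_cancel]
  · rw [Set.indicator_of_notMem hy]
    exact zero_le

theorem ae_prod_of_ae_ae_swap {X S : Type*} [MeasurableSpace X] [MeasurableSpace S]
    {ν : Measure X} {μ : Measure S} [SFinite ν] [SFinite μ] {Q : X → S → Prop}
    (hQ : MeasurableSet {p : X × S | Q p.1 p.2}) (h : ∀ᵐ ξ ∂μ, ∀ᵐ x ∂ν, Q x ξ) :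
    ∀ᵐ p ∂(ν.prod μ), Q p.1 p.2 :=
  (Measure.ae_prod_iff_ae_ae hQ).2 ((Measure.ae_ae_comm hQ).2 h)

/-- Lebesgue's differentiation theorem in one of the variables. -/
theorem ae_prod_dyadic_lebesgue_point {S : Type*} [MeasurableSpace S] {μ : Measure S} [SFinite μ]
    {E : Type*} [NormedAddCommGroup E] [MeasurableSpace E] [BorelSpace E]
    [SecondCountableTopology E] {F : ℝ → S → E} (hF : Measurable (Function.uncurry F))
    (hloc : ∀ᵐ ξ ∂μ, LocallyIntegrable fun s => F s ξ) :
    ∀ᵐ p ∂((volume : Measure ℝ).prod μ), Tendsto (fun j : ℕ =>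
      (∫⁻ y in Set.Ioc (0 : ℝ) ((1 / 2) ^ j), ‖F (p.1 - y) p.2 - F p.1 p.2‖ₑ) /
        ENNReal.ofReal ((1 / 2) ^ j)) atTop (𝓝 0) := by
  let Q : ℝ → S → Prop := fun x ξ => Tendsto (fun j : ℕ =>
      (∫⁻ y in Set.Ioc (0 : ℝ) ((1 / 2) ^ j), ‖F (x - y) ξ - F x ξ‖ₑ) /
        ENNReal.ofReal ((1 / 2) ^ j)) atTop (𝓝 0)
  -- Dyadic lengths make the condition a limit along a sequence, so the set of good points is
  -- measurable and Fubini can exchange the order of the almost everywhere quantifiers.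
  have hmeas : MeasurableSet {p : ℝ × S | Q p.1 p.2} := by
    refine measurableSet_tendsto _ fun j => Measurable.div_const ?_ _
    refine Measurable.lintegral_prod_right'
      (f := fun q : (ℝ × S) × ℝ => ‖F (q.1.1 - q.2) q.1.2 - F q.1.1 q.1.2‖ₑ) ?_
    have h1 : Measurable fun q : (ℝ × S) × ℝ => (q.1.1 - q.2, q.1.2) := by fun_prop
    have h2 : Measurable fun q : (ℝ × S) × ℝ => F (q.1.1 - q.2) q.1.2 := hF.comp h1
    have h3 : Measurable fun q : (ℝ × S) × ℝ => F q.1.1 q.1.2 := hF.comp measurable_fst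
    exact (h2.sub h3).enorm
  have hae : ∀ᵐ ξ ∂μ, ∀ᵐ x, Q x ξ := by
    filter_upwards [hloc] with ξ hξ
    have h := ae_dyadic_lebesgue_point hξ
    beta_reduce at h
    filter_upwards [h] with x hx
    exact hx
  exact ae_prod_of_ae_ae_swap hmeas hae

theorem le_one_add_rpow {q : ℝ} (hq : 1 ≤ q) (x : ℝ≥0∞) : x ≤ 1 + x ^ q := by
  rcases le_total x 1 with h | h
  · exact h.trans le_self_add
  · calc x = x ^ (1 : ℝ) := (ENNReal.rpow_one x).symm
      _ ≤ x ^ q := ENNReal.rpow_le_rpow_of_exponent_le h hq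
      _ ≤ _ := le_add_self

/-- Tonelli: a bound on the integral over each slice gives local integrability in `s` for almost
every direction. It is used both for `g` and for its maximal function. -/
theorem ae_lintegral_Ioo_ne_top {n : ℕ} {q : ℝ} {g : ℝ → Sph n → ℂ}
    (hgq : ∀ N : ℕ, ∫⁻ s in Set.Ioo (0 : ℝ) N, ∫⁻ η, ‖g s η‖ₑ ^ q ∂(surf n) ≠ ∞)
    {Φ : ℝ → Sph n → ℝ≥0∞} (hΦ : Measurable (Function.uncurry Φ)) {c : ℝ≥0∞} (hc : c ≠ ∞)
    (hle : ∀ s, ∫⁻ ξ, Φ s ξ ∂(surf n) ≤ c * (1 + ∫⁻ η, ‖g s η‖ₑ ^ q ∂(surf n))) :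
    ∀ᵐ ξ ∂(surf n), ∀ N : ℕ, ∫⁻ s in Set.Ioo (0 : ℝ) N, Φ s ξ ≠ ∞ := by
  rw [ae_all_iff]
  intro N
  have hm : Measurable (Function.uncurry fun ξ s => Φ s ξ) := hΦ.comp measurable_swap
  have hfin : ∫⁻ ξ, (∫⁻ s in Set.Ioo (0 : ℝ) N, Φ s ξ) ∂(surf n) ≠ ∞ := by
    rw [lintegral_lintegral_swap hm.aemeasurable]
    refine ne_top_of_le_ne_top ?_ (lintegral_mono hle)
    rw [lintegral_const_mul' _ _ hc, lintegral_add_left measurable_const]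
    exact ENNReal.mul_ne_top hc (ENNReal.add_ne_top.2 ⟨by simp, hgq N⟩)
  filter_upwards [ae_lt_top hm.lintegral_prod_right' hfin] with ξ hξ using hξ.ne

theorem lintegral_le_mul_one_add {n : ℕ} {q : ℝ} (hq : 1 < q) (w : Sph n → ℝ≥0∞) :
    ∫⁻ ξ, w ξ ∂(surf n) ≤ (1 + surf n Set.univ) * (1 + ∫⁻ η, w η ^ q ∂(surf n)) := by
  calc ∫⁻ ξ, w ξ ∂(surf n) ≤ ∫⁻ ξ, (1 + w ξ ^ q) ∂(surf n) :=
        lintegral_mono fun ξ => le_one_add_rpow hq.le _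
    _ = surf n Set.univ + ∫⁻ η, w η ^ q ∂(surf n) := by
        rw [lintegral_add_left measurable_const, lintegral_one]
    _ ≤ _ := by
        rw [mul_add, mul_one]
        refine add_le_add le_add_self ?_
        exact le_mul_of_one_le_left zero_le le_self_add

theorem ae_of_ae_Ioo {P : ℝ → Prop} (h : ∀ N : ℕ, ∀ᵐ s ∂(volume.restrict (Set.Ioo (0 : ℝ) N)), P s) :
    ∀ᵐ s ∂(volume.restrict (Set.Ioi (0 : ℝ))), P s := by
  have hU : Set.Ioi (0 : ℝ) = ⋃ N : ℕ, Set.Ioo (0 : ℝ) N := by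
    ext s
    simp only [Set.mem_Ioi, Set.mem_iUnion, Set.mem_Ioo]
    refine ⟨fun hs => ?_, fun ⟨_, hs⟩ => hs.1⟩
    obtain ⟨N, hN⟩ := exists_nat_gt s
    exact ⟨N, hs, hN⟩
  rw [hU, ae_restrict_iUnion_iff]
  exact h

theorem ae_integrable_of_lintegral_rpow {n : ℕ} {q : ℝ} (hq : 1 < q) {g : ℝ → Sph n → ℂ}
    (hg : Measurable (Function.uncurry g))
    (hgq : ∀ N : ℕ, ∫⁻ s in Set.Ioo (0 : ℝ) N, ∫⁻ η, ‖g s η‖ₑ ^ q ∂(surf n) ≠ ∞) :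
    ∀ᵐ s ∂(volume.restrict (Set.Ioi (0 : ℝ))), Integrable (g s) (surf n) := by
  refine ae_of_ae_Ioo fun N => ?_
  have hm : Measurable fun s => ∫⁻ η, ‖g s η‖ₑ ^ q ∂(surf n) :=
    (hg.enorm.pow_const q).lintegral_prod_right'
  filter_upwards [ae_lt_top hm (hgq N)] with s hs
  refine ⟨(hg.comp measurable_prodMk_left).aestronglyMeasurable, ?_⟩
  refine (lintegral_le_mul_one_add hq fun η => ‖g s η‖ₑ).trans_lt ?_
  exact ENNReal.mul_lt_top (by simp [measure_lt_top]) (by simp [hs])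

theorem measurable_pint_comp {n : ℕ} {X : Type*} [MeasurableSpace X] {g : X → Sph n → ℂ}
    (hg : Measurable (Function.uncurry g)) {r : X → ℝ} (hr : Measurable r) {ξ : X → Sph n}
    (hξ : Measurable ξ) : Measurable fun x => pint (g x) (r x) (ξ x) := by
  unfold pint
  refine StronglyMeasurable.measurable (StronglyMeasurable.integral_prod_right
    (f := fun x η => pker (r x) (ξ x).1 η.1 • g x η) ?_)
  have h1 : Measurable fun p : X × Sph n => (r p.1, (ξ p.1).1, p.2.1) := by fun_prop
  exact ((measurable_pker.comp h1).smul hg).stronglyMeasurable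

/-! ### The oscillation of Poisson integrals and the Lebesgue points of the profile. -/

/-- The oscillation of Poisson integrals near the boundary. -/
def osc {n : ℕ} (ψ : Sph n → ℂ) (k : ℕ) (ξ : Sph n) : ℝ≥0∞ :=
  ⨆ r : {r : ℚ // (1 - 1 / (k + 1) : ℝ) < r ∧ (r : ℝ) < 1}, ‖pint ψ (r.1 : ℝ) ξ - ψ ξ‖ₑ

theorem measurable_osc_comp {n : ℕ} {X : Type*} [MeasurableSpace X] {g : X → Sph n → ℂ}
    (hg : Measurable (Function.uncurry g)) (k : ℕ) :
    Measurable fun p : X × Sph n => osc (g p.1) k p.2 := by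
  unfold osc
  refine Measurable.iSup fun r => Measurable.enorm (Measurable.sub ?_ hg)
  refine measurable_pint_comp (g := fun p : X × Sph n => g p.1) ?_ measurable_const measurable_snd
  have : Measurable fun p : (X × Sph n) × Sph n => (p.1.1, p.2) := by fun_prop
  exact hg.comp this

theorem measurable_osc_left {n : ℕ} {X : Type*} [MeasurableSpace X] {g : X → Sph n → ℂ}
    (hg : Measurable (Function.uncurry g)) (k : ℕ) (ξ : Sph n) :
    Measurable fun x => osc (g x) k ξ := by
  have h1 : Measurable fun x : X => (x, ξ) := measurable_prodMk_right
  have h2 := (measurable_osc_comp hg k).comp h1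
  exact h2

theorem one_sub_inv_nonneg (k : ℕ) : (0 : ℝ) ≤ 1 - 1 / (k + 1) := by
  rw [sub_nonneg, div_le_one (by positivity)]
  linarith [Nat.cast_nonneg (α := ℝ) k]

theorem osc_le {n : ℕ} {C : ℝ} {ψ : Sph n → ℂ} {ξ : Sph n}
    (h : ∀ r : ℝ, 0 ≤ r → r < 1 → ‖pint ψ r ξ‖ₑ ≤ ENNReal.ofReal C * capMax (fun η => ‖ψ η‖ₑ) ξ)
    (k : ℕ) : osc ψ k ξ ≤ ENNReal.ofReal C * capMax (fun η => ‖ψ η‖ₑ) ξ + ‖ψ ξ‖ₑ := by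
  refine iSup_le fun r => enorm_sub_le.trans (add_le_add (h _ ?_ r.2.2) le_rfl)
  exact (one_sub_inv_nonneg k).trans r.2.1.le

theorem continuousOn_pint {n : ℕ} {ψ : Sph n → ℂ} (hψ : Integrable ψ (surf n)) (ξ : Sph n) :
    ContinuousOn (fun r => pint ψ r ξ) (Set.Ioo 0 1) := by
  intro r hr
  obtain ⟨r', hr', hr1⟩ := exists_between hr.2
  have hcomp : IsCompact (Set.Icc (0 : ℝ) r' ×ˢ (Set.univ : Set (Sph n))) :=
    isCompact_Icc.prod isCompact_univ
  have hcont : ContinuousOn (fun p : ℝ × Sph n => pker p.1 ξ.1 p.2.1)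
      (Set.Ico (0 : ℝ) 1 ×ˢ (Set.univ : Set (Sph n))) := by
    refine (continuousOn_pker (n := n)).comp (f := fun p : ℝ × Sph n => (p.1, (ξ, p.2)))
      (by fun_prop) fun p hp => ⟨hp.1, trivial⟩
  obtain ⟨B, hB⟩ := hcomp.exists_bound_of_continuousOn (hcont.mono
    (Set.prod_mono (fun x hx => ⟨hx.1, hx.2.trans_lt hr1⟩) le_rfl))
  have hnhds : Set.Ioo 0 r' ∈ 𝓝 r := Ioo_mem_nhds hr.1 hr'
  refine ContinuousAt.continuousWithinAt ?_
  refine continuousAt_of_dominated (bound := fun η => B * ‖ψ η‖) ?_ ?_ (hψ.norm.const_mul B) ?_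
  · filter_upwards [hnhds] with x hx
    exact (integrable_pker_smul hx.1.le (hx.2.trans hr1) hψ ξ).1
  · filter_upwards [hnhds] with x hx
    refine Eventually.of_forall fun η => ?_
    rw [norm_smul]
    exact mul_le_mul_of_nonneg_right (hB (x, η) ⟨⟨hx.1.le, hx.2.le⟩, trivial⟩) (norm_nonneg _)
  · refine Eventually.of_forall fun η => ?_
    have h1 : ContinuousOn (fun x : ℝ => pker x ξ.1 η.1) (Set.Ico 0 1) :=
      hcont.comp (f := fun x : ℝ => (x, η)) (by fun_prop) fun x hx => ⟨hx, trivial⟩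
    exact (h1.continuousAt (Ico_mem_nhds hr.1 hr.2)).smul continuousAt_const

/-- Rational radii, which keep `osc` measurable, lose nothing: the Poisson integral is continuous in
the radius and the rationals are dense. -/
theorem enorm_pint_sub_le_osc {n : ℕ} {ψ : Sph n → ℂ} (hψ : Integrable ψ (surf n)) (ξ : Sph n)
    {k : ℕ} {r : ℝ} (hr : (1 - 1 / (k + 1) : ℝ) < r) (hr1 : r < 1) :
    ‖pint ψ r ξ - ψ ξ‖ₑ ≤ osc ψ k ξ := by
  have hk := one_sub_inv_nonneg k
  have hmem : r ∈ closure (Set.Ioo (1 - 1 / (k + 1) : ℝ) 1 ∩ Set.range ((↑) : ℚ → ℝ)) :=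
    (Rat.denseRange_cast (𝕜 := ℝ)).open_subset_closure_inter isOpen_Ioo ⟨hr, hr1⟩
  have hc : ContinuousWithinAt (fun r => ‖pint ψ r ξ - ψ ξ‖ₑ)
      (Set.Ioo (1 - 1 / (k + 1) : ℝ) 1 ∩ Set.range ((↑) : ℚ → ℝ)) r := by
    have h1 : ContinuousOn (fun r => ‖pint ψ r ξ - ψ ξ‖ₑ) (Set.Ioo 0 1) :=
      ((continuousOn_pint hψ ξ).sub continuousOn_const).enorm
    exact (h1 r ⟨hk.trans_lt hr, hr1⟩).mono fun x hx => ⟨hk.trans_lt hx.1.1, hx.1.2⟩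
  refine hc.closure_le hmem continuousWithinAt_const ?_
  rintro _ ⟨⟨h1, h2⟩, ρ, rfl⟩
  exact le_iSup (fun r : {r : ℚ // (1 - 1 / (k + 1) : ℝ) < r ∧ (r : ℝ) < 1} =>
    ‖pint ψ (r.1 : ℝ) ξ - ψ ξ‖ₑ) ⟨ρ, h1, h2⟩

theorem tendsto_osc {n : ℕ} {ψ : Sph n → ℂ} {ξ : Sph n}
    (h : Tendsto (fun r => pint ψ r ξ) (𝓝[<] 1) (𝓝 (ψ ξ))) :
    Tendsto (fun k => osc ψ k ξ) atTop (𝓝 0) := by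
  rw [ENNReal.tendsto_nhds_zero]
  intro ε hε
  rw [tendsto_iff_edist_tendsto_0, ENNReal.tendsto_nhds_zero] at h
  obtain ⟨r₀, hr₀, hsub⟩ := mem_nhdsLT_iff_exists_Ioo_subset.1 (h ε hε)
  have h1 : Tendsto (fun k : ℕ => 1 - 1 / ((k : ℝ) + 1)) atTop (𝓝 (1 - 0)) :=
    tendsto_const_nhds.sub tendsto_one_div_add_atTop_nhds_zero_nat
  rw [sub_zero] at h1
  filter_upwards [h1.eventually (lt_mem_nhds hr₀)] with k hk
  refine iSup_le fun r => ?_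
  have := hsub ⟨hk.trans r.2.1, r.2.2⟩
  simpa only [Set.mem_ofPred_eq, edist_eq_enorm_sub] using this

theorem locallyIntegrable_of_Ioo {E : Type*} [NormedAddCommGroup E] {f : ℝ → E}
    (hf : AEStronglyMeasurable f) (h0 : ∀ s ≤ 0, f s = 0)
    (h : ∀ N : ℕ, ∫⁻ s in Set.Ioo (0 : ℝ) N, ‖f s‖ₑ ≠ ∞) : LocallyIntegrable f := by
  intro x
  obtain ⟨N, hN⟩ := exists_nat_gt x
  refine ⟨Set.Iio N, Iio_mem_nhds hN, hf.restrict, ?_⟩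
  refine lt_of_le_of_lt ?_ (h N).lt_top
  rw [← lintegral_indicator measurableSet_Iio, ← lintegral_indicator measurableSet_Ioo]
  refine lintegral_mono fun s => ?_
  by_cases hs : s ∈ Set.Ioo (0 : ℝ) N
  · rw [Set.indicator_of_mem hs, Set.indicator_of_mem (show s ∈ Set.Iio (N : ℝ) from hs.2)]
  · by_cases hs0 : s ≤ 0
    · rw [Set.indicator_apply, h0 s hs0]
      simp
    · rw [Set.indicator_of_notMem (show s ∉ Set.Iio (N : ℝ) from
        fun h => hs ⟨not_le.1 hs0, h⟩)]
      exact zero_le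

/-- Here `q > 1` is essential, as the maximal function of a merely integrable slice need not be
integrable. -/
theorem ae_lintegral_capMax_ne_top {n : ℕ} (hn : 0 < n) {q : ℝ} (hq : 1 < q) {g : ℝ → Sph n → ℂ}
    (hg : Measurable (Function.uncurry g))
    (hgq : ∀ N : ℕ, ∫⁻ s in Set.Ioo (0 : ℝ) N, ∫⁻ η, ‖g s η‖ₑ ^ q ∂(surf n) ≠ ∞) :
    ∀ᵐ ξ ∂(surf n), ∀ N : ℕ,
      ∫⁻ s in Set.Ioo (0 : ℝ) N, capMax (fun η => ‖g s η‖ₑ) ξ ≠ ∞ := by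
  obtain ⟨C, -, hC⟩ := exists_lintegral_capMax_le hn hq
  have hm : Measurable (Function.uncurry fun (s : ℝ) (ξ : Sph n) => capMax (fun η => ‖g s η‖ₑ) ξ) :=
    measurable_capMax (W := fun s η => ‖g s η‖ₑ) hg.enorm
  refine ae_lintegral_Ioo_ne_top hgq hm (ENNReal.ofReal_ne_top (r := C)) fun s => ?_
  exact hC _ (hg.comp measurable_prodMk_left).enorm

theorem ae_lintegral_enorm_ne_top {n : ℕ} {q : ℝ} (hq : 1 < q) {g : ℝ → Sph n → ℂ}
    (hg : Measurable (Function.uncurry g))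
    (hgq : ∀ N : ℕ, ∫⁻ s in Set.Ioo (0 : ℝ) N, ∫⁻ η, ‖g s η‖ₑ ^ q ∂(surf n) ≠ ∞) :
    ∀ᵐ ξ ∂(surf n), ∀ N : ℕ, ∫⁻ s in Set.Ioo (0 : ℝ) N, ‖g s ξ‖ₑ ≠ ∞ :=
  ae_lintegral_Ioo_ne_top hgq hg.enorm (c := 1 + surf n Set.univ) (by simp)
    fun s => lintegral_le_mul_one_add hq fun η => ‖g s η‖ₑ

theorem exists_enorm_pint_le_capMax {n : ℕ} (hn : 0 < n) : ∃ C : ℝ, 0 < C ∧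
    ∀ ψ : Sph n → ℂ, Measurable ψ → ∀ ξ : Sph n, ∀ r : ℝ, 0 ≤ r → r < 1 →
      ‖pint ψ r ξ‖ₑ ≤ ENNReal.ofReal C * capMax (fun η => ‖ψ η‖ₑ) ξ := by
  obtain ⟨C, hC, h⟩ := exists_lintegral_pker_le_capMax hn
  exact ⟨C, hC, fun ψ hψ ξ r hr hr1 =>
    (enorm_pint_le hn hr hr1 ψ ξ).trans (h _ hψ.enorm r hr hr1 ξ)⟩

/-- The function `y ↦ Π[g(t - y, ·)](ξ, √((t - y)/t))` on `(0, t)`, extended by zero. -/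
def profile {n : ℕ} (g : ℝ → Sph n → ℂ) (t : ℝ) (ξ : Sph n) (y : ℝ) : ℂ :=
  if 0 < y ∧ y < t then pint (g (t - y)) (√((t - y) / t)) ξ else 0

theorem measurable_reflect {n : ℕ} {g : ℝ → Sph n → ℂ} (hg : Measurable (Function.uncurry g))
    (t : ℝ) : Measurable (Function.uncurry fun y => g (t - y)) := by
  have : Measurable fun p : ℝ × Sph n => (t - p.1, p.2) := by fun_prop
  exact hg.comp this

theorem measurable_profile {n : ℕ} {g : ℝ → Sph n → ℂ} (hg : Measurable (Function.uncurry g))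
    (t : ℝ) (ξ : Sph n) : Measurable (profile g t ξ) := by
  refine Measurable.ite (measurableSet_Ioo (a := (0 : ℝ)) (b := t)) ?_ measurable_const
  exact measurable_pint_comp (g := fun y => g (t - y)) (measurable_reflect hg t) (by fun_prop)
    measurable_const

theorem sqrt_sub_div_mem {t y : ℝ} (hy : 0 < y) (hyt : y < t) :
    0 ≤ √((t - y) / t) ∧ √((t - y) / t) < 1 ∧ 1 - y / t ≤ √((t - y) / t) := by
  have ht : 0 < t := hy.trans hyt
  have h1 : (t - y) / t = 1 - y / t := by field_simp
  have h2 : 0 < y / t := by positivity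
  have h3 : y / t < 1 := (div_lt_one ht).2 hyt
  refine ⟨Real.sqrt_nonneg _, ?_, ?_⟩
  · rw [Real.sqrt_lt' one_pos, h1]
    linarith
  · rw [h1]
    refine Real.le_sqrt_of_sq_le ?_
    nlinarith

theorem ae_volume_of_ae_Ioi {P : ℝ → Prop} (h : ∀ᵐ s ∂(volume.restrict (Set.Ioi (0 : ℝ))), P s)
    (t : ℝ) : ∀ᵐ y : ℝ, y < t → P (t - y) := by
  rw [ae_restrict_iff' measurableSet_Ioi] at h
  filter_upwards [(Measure.measurePreserving_sub_left volume t).quasiMeasurePreserving.ae h] with y hy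
    hyt using hy (sub_pos.2 hyt)

theorem cyl_le (n : ℕ) : cyl n ≪ (volume : Measure ℝ).prod (surf n) :=
  Measure.restrict_le_self.absolutelyContinuous.prod Measure.AbsolutelyContinuous.rfl

/-- The deviation of the profile from `g t ξ` is at most `‖g(t-y, ξ) - g(t, ξ)‖`, plus the change of
the `k`-th oscillation from `t` to `t - y`, plus the oscillation at `t`. The first two average to
zero for fixed `k`; the last is made small by choosing `k` first. -/
theorem tendsto_average_profile {n : ℕ} {g : ℝ → Sph n → ℂ} (hg : Measurable (Function.uncurry g))
    (hint : ∀ᵐ s ∂(volume.restrict (Set.Ioi (0 : ℝ))), Integrable (g s) (surf n))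
    {t : ℝ} (ht : 0 < t) {ξ : Sph n}
    (hfin : ∀ᵐ s ∂(volume.restrict (Set.Ioi (0 : ℝ))), ∀ k, osc (g s) k ξ ≠ ∞)
    (hosc : Tendsto (fun k => osc (g t) k ξ) atTop (𝓝 0))
    (h1 : Tendsto (fun j : ℕ => (∫⁻ y in Set.Ioc (0 : ℝ) ((1 / 2) ^ j), ‖g (t - y) ξ - g t ξ‖ₑ) /
      ENNReal.ofReal ((1 / 2) ^ j)) atTop (𝓝 0))
    (h2 : ∀ k, Tendsto (fun j : ℕ => (∫⁻ y in Set.Ioc (0 : ℝ) ((1 / 2) ^ j),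
      ‖(osc (g (t - y)) k ξ).toReal - (osc (g t) k ξ).toReal‖ₑ) /
      ENNReal.ofReal ((1 / 2) ^ j)) atTop (𝓝 0)) :
    Tendsto (fun δ : ℝ => (∫⁻ y in Set.Ioc 0 δ, ‖profile g t ξ y - g t ξ‖ₑ) / ENNReal.ofReal δ)
      (𝓝[>] 0) (𝓝 0) := by
  refine tendsto_average_of_dyadic ?_
  rw [ENNReal.tendsto_nhds_zero] at hosc h1 ⊢
  intro ε hε
  -- Capping at `1` keeps the thirds finite, so the chosen oscillation at `t` is finite and passes
  -- to real values without loss.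
  set ε' : ℝ≥0∞ := min ε 1
  have hε' : 0 < ε' / 3 := ENNReal.div_pos (lt_min hε one_pos).ne' (by simp)
  have hε1 : ε' / 3 ≠ ∞ := (ENNReal.div_lt_top (ne_top_of_le_ne_top ENNReal.one_ne_top
    (min_le_right _ _)) (by simp)).ne
  obtain ⟨k, hk⟩ := (hosc (ε' / 3) hε').exists
  have hkfin : osc (g t) k ξ ≠ ∞ := ne_top_of_le_ne_top hε1 hk
  have h2k := h2 k
  rw [ENNReal.tendsto_nhds_zero] at h2k
  have hpow : Tendsto (fun j : ℕ => (1 / 2 : ℝ) ^ j) atTop (𝓝 0) :=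
    tendsto_pow_atTop_nhds_zero_of_lt_one (by norm_num) (by norm_num)
  have hκ : (0 : ℝ) < t / (k + 1) := by positivity
  filter_upwards [h1 _ hε', h2k _ hε', hpow.eventually (gt_mem_nhds hκ)] with j hj1 hj2 hj3
  set d : ℝ := (1 / 2) ^ j
  have hd : 0 < d := by positivity
  have hoscm : ∀ k, Measurable fun y => osc (g (t - y)) k ξ := fun k =>
    measurable_osc_left (g := fun y => g (t - y)) (measurable_reflect hg t) k ξ
  have hbound : ∀ᵐ y ∂(volume.restrict (Set.Ioc 0 d)), ‖profile g t ξ y - g t ξ‖ₑ ≤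
      ‖g (t - y) ξ - g t ξ‖ₑ + (‖(osc (g (t - y)) k ξ).toReal - (osc (g t) k ξ).toReal‖ₑ +
        osc (g t) k ξ) := by
    filter_upwards [ae_restrict_mem measurableSet_Ioc, ae_restrict_of_ae (ae_volume_of_ae_Ioi hint t),
      ae_restrict_of_ae (ae_volume_of_ae_Ioi hfin t)] with y hy hyi hyf
    have hyk : y < t / (k + 1) := hy.2.trans_lt hj3
    have hyt : y < t := hyk.trans_le (div_le_self ht.le (by simp))
    obtain ⟨-, hr1, hr2⟩ := sqrt_sub_div_mem hy.1 hyt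
    -- Once `y < t/(k + 1)`, the radius `√(1 - y/t) ≥ 1 - y/t` lies in the range over which `osc`
    -- with index `k` takes its supremum.
    have hr3 : (1 - 1 / (k + 1) : ℝ) < √((t - y) / t) := by
      refine lt_of_lt_of_le ?_ hr2
      have : y / t < 1 / (k + 1) := by
        rw [div_lt_iff₀ ht, one_div_mul_eq_div]
        exact hyk
      linarith
    have e1 : ‖pint (g (t - y)) (√((t - y) / t)) ξ - g (t - y) ξ‖ₑ ≤ osc (g (t - y)) k ξ :=
      enorm_pint_sub_le_osc (hyi hyt) ξ hr3 hr1
    have e2 : osc (g (t - y)) k ξ ≤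
        ‖(osc (g (t - y)) k ξ).toReal - (osc (g t) k ξ).toReal‖ₑ + osc (g t) k ξ := by
      rw [← ENNReal.ofReal_toReal (hyf hyt k), ← ENNReal.ofReal_toReal hkfin]
      generalize (osc (g (t - y)) k ξ).toReal = u at *
      generalize hv : (osc (g t) k ξ).toReal = v
      have hv0 : 0 ≤ v := hv ▸ ENNReal.toReal_nonneg
      by_cases hu : 0 ≤ u
      · rw [ENNReal.toReal_ofReal hu, ENNReal.toReal_ofReal hv0, ← ofReal_norm,
          ← ENNReal.ofReal_add (norm_nonneg _) hv0]
        refine ENNReal.ofReal_le_ofReal ?_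
        linarith [le_abs_self (u - v), Real.norm_eq_abs (u - v)]
      · rw [ENNReal.ofReal_of_nonpos (not_le.1 hu).le]
        exact zero_le
    rw [profile, if_pos ⟨hy.1, hyt⟩]
    calc ‖pint (g (t - y)) (√((t - y) / t)) ξ - g t ξ‖ₑ
        = ‖(g (t - y) ξ - g t ξ) + (pint (g (t - y)) (√((t - y) / t)) ξ - g (t - y) ξ)‖ₑ := by
          congr 1
          ring
      _ ≤ _ := (enorm_add_le _ _).trans (add_le_add le_rfl (e1.trans e2))
  have hgm : Measurable fun y => ‖g (t - y) ξ - g t ξ‖ₑ := by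
    have h3 : Measurable fun y : ℝ => g (t - y) ξ :=
      (measurable_reflect hg t).comp (measurable_prodMk_right (y := ξ))
    exact (h3.sub_const _).enorm
  calc (∫⁻ y in Set.Ioc 0 d, ‖profile g t ξ y - g t ξ‖ₑ) / ENNReal.ofReal d
      ≤ (∫⁻ y in Set.Ioc 0 d, (‖g (t - y) ξ - g t ξ‖ₑ +
          (‖(osc (g (t - y)) k ξ).toReal - (osc (g t) k ξ).toReal‖ₑ + osc (g t) k ξ))) /
          ENNReal.ofReal d := ENNReal.div_le_div_right (lintegral_mono_ae hbound) _
    _ = (∫⁻ y in Set.Ioc 0 d, ‖g (t - y) ξ - g t ξ‖ₑ) / ENNReal.ofReal d +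
        ((∫⁻ y in Set.Ioc 0 d, ‖(osc (g (t - y)) k ξ).toReal - (osc (g t) k ξ).toReal‖ₑ) /
          ENNReal.ofReal d + osc (g t) k ξ) := by
        rw [lintegral_add_left hgm, lintegral_add_left
          ((hoscm k).ennreal_toReal.sub_const _).enorm, setLIntegral_const, Real.volume_Ioc, sub_zero,
          ENNReal.add_div, ENNReal.add_div, ENNReal.mul_div_cancel_right (by simpa using hd)
          ENNReal.ofReal_ne_top]
    _ ≤ ε' / 3 + (ε' / 3 + ε' / 3) := add_le_add hj1 (add_le_add hj2 hk)
    _ = ε' := by rw [← add_assoc, ENNReal.add_thirds]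
    _ ≤ ε := min_le_left _ _

/-- Lebesgue's theorem in `s` is applied to `g` and to each of the countably many oscillations,
which are locally integrable since the maximal function dominates them. The oscillations tend to
zero by convergence of Poisson integrals on almost every slice. -/
theorem ae_tendsto_average_profile {n : ℕ} (hn : 0 < n) {q : ℝ} (hq : 1 < q) {g : ℝ → Sph n → ℂ}
    (hg : Measurable (Function.uncurry g)) (h0 : ∀ s ≤ 0, ∀ η, g s η = 0)
    (hgq : ∀ N : ℕ, ∫⁻ s in Set.Ioo (0 : ℝ) N, ∫⁻ η, ‖g s η‖ₑ ^ q ∂(surf n) ≠ ∞) :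
    ∀ᵐ p ∂(cyl n), Tendsto (fun δ : ℝ =>
      (∫⁻ y in Set.Ioc 0 δ, ‖profile g p.1 p.2 y - g p.1 p.2‖ₑ) / ENNReal.ofReal δ)
      (𝓝[>] 0) (𝓝 0) := by
  obtain ⟨C, hC, hpint⟩ := exists_enorm_pint_le_capMax hn
  have hgs : ∀ s, Measurable (g s) := fun s => hg.comp measurable_prodMk_left
  have hint := ae_integrable_of_lintegral_rpow hq hg hgq
  have hle : ∀ s ξ k, osc (g s) k ξ ≤
      ENNReal.ofReal C * capMax (fun η => ‖g s η‖ₑ) ξ + ‖g s ξ‖ₑ := fun s ξ k =>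
    osc_le (hpint (g s) (hgs s) ξ) k
  have hcm := ae_lintegral_capMax_ne_top hn hq hg hgq
  have hgn := ae_lintegral_enorm_ne_top hq hg hgq
  have hcapm : ∀ ξ, Measurable fun s => capMax (fun η => ‖g s η‖ₑ) ξ := fun ξ => by
    have h1 : Measurable fun s : ℝ => (s, ξ) := measurable_prodMk_right
    have h2 := (measurable_capMax (W := fun s η => ‖g s η‖ₑ) hg.enorm).comp h1
    exact h2
  have hgm : ∀ ξ, Measurable fun s => ‖g s ξ‖ₑ := fun ξ =>
    hg.enorm.comp (measurable_prodMk_right (y := ξ))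
  have hoscI : ∀ᵐ ξ ∂(surf n), ∀ N : ℕ, ∫⁻ s in Set.Ioo (0 : ℝ) N,
      (ENNReal.ofReal C * capMax (fun η => ‖g s η‖ₑ) ξ + ‖g s ξ‖ₑ) ≠ ∞ := by
    filter_upwards [hcm, hgn] with ξ h1 h2 N
    rw [lintegral_add_right _ (hgm ξ), lintegral_const_mul' _ _ ENNReal.ofReal_ne_top]
    exact ENNReal.add_ne_top.2 ⟨ENNReal.mul_ne_top ENNReal.ofReal_ne_top (h1 N), h2 N⟩
  have hfin : ∀ᵐ ξ ∂(surf n), ∀ᵐ s ∂(volume.restrict (Set.Ioi (0 : ℝ))),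
      ∀ k, osc (g s) k ξ ≠ ∞ := by
    filter_upwards [hoscI] with ξ h1
    refine ae_of_ae_Ioo fun N => ?_
    filter_upwards [ae_lt_top (((hcapm ξ).const_mul _).add (hgm ξ)) (h1 N)] with s hs k
    exact ((hle s ξ k).trans_lt hs).ne
  have hosc0 : ∀ s ≤ 0, ∀ k ξ, osc (g s) k ξ = 0 := fun s hs k ξ => by
    have : g s = fun _ => 0 := funext (h0 s hs)
    simp [osc, this, pint]
  have hL1 : ∀ᵐ p ∂(cyl n), Tendsto (fun j : ℕ => (∫⁻ y in Set.Ioc (0 : ℝ) ((1 / 2) ^ j),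
      ‖g (p.1 - y) p.2 - g p.1 p.2‖ₑ) / ENNReal.ofReal ((1 / 2) ^ j)) atTop (𝓝 0) := by
    refine (cyl_le n).ae_le (ae_prod_dyadic_lebesgue_point hg ?_)
    filter_upwards [hgn] with ξ hξ
    exact locallyIntegrable_of_Ioo (hg.comp (measurable_prodMk_right (y := ξ))).aestronglyMeasurable
      (fun s hs => h0 s hs ξ) hξ
  have hL2 : ∀ᵐ p ∂(cyl n), ∀ k : ℕ, Tendsto (fun j : ℕ =>
      (∫⁻ y in Set.Ioc (0 : ℝ) ((1 / 2) ^ j),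
      ‖(osc (g (p.1 - y)) k p.2).toReal - (osc (g p.1) k p.2).toReal‖ₑ) /
      ENNReal.ofReal ((1 / 2) ^ j)) atTop (𝓝 0) := by
    rw [ae_all_iff]
    intro k
    have hm : Measurable (Function.uncurry fun (s : ℝ) (ξ : Sph n) => (osc (g s) k ξ).toReal) :=
      (measurable_osc_comp hg k).ennreal_toReal
    have hloc : ∀ᵐ ξ ∂(surf n), LocallyIntegrable fun s => (osc (g s) k ξ).toReal := by
      filter_upwards [hoscI] with ξ hξ
      have hmξ : Measurable fun s => (osc (g s) k ξ).toReal :=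
        (measurable_osc_left hg k ξ).ennreal_toReal
      refine locallyIntegrable_of_Ioo hmξ.aestronglyMeasurable
        (fun s hs => by simp [hosc0 s hs])
        fun N => ne_top_of_le_ne_top (hξ N) (lintegral_mono fun s => ?_)
      rw [Real.enorm_of_nonneg ENNReal.toReal_nonneg]
      exact ENNReal.ofReal_toReal_le.trans (hle s ξ k)
    have h := ae_prod_dyadic_lebesgue_point hm hloc
    beta_reduce at h
    exact (cyl_le n).ae_le h
  have hL3 : ∀ᵐ p ∂(cyl n), Tendsto (fun k => osc (g p.1) k p.2) atTop (𝓝 0) := by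
    have hm : MeasurableSet {p : ℝ × Sph n | Tendsto (fun k => osc (g p.1) k p.2) atTop (𝓝 0)} :=
      measurableSet_tendsto _ fun k => measurable_osc_comp hg k
    refine (Measure.ae_prod_iff_ae_ae hm).2 ?_
    filter_upwards [hint] with s hs
    filter_upwards [ae_tendsto_pint hn hs (hgs s)] with ξ hξ using tendsto_osc hξ
  have hfin' : ∀ᵐ p ∂(cyl n), ∀ᵐ s ∂(volume.restrict (Set.Ioi (0 : ℝ))),
      ∀ k, osc (g s) k p.2 ≠ ∞ := Measure.quasiMeasurePreserving_snd.ae hfin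
  filter_upwards [hL1, hL2, hL3, hfin', ae_cyl_pos n] with p h1 h2 h3 h4 h5
  exact tendsto_average_profile hg hint h5 h4 h3 h1 h2

/-! ### Fractional potentials of Poisson integrals. -/

instance (n : ℕ) : SFinite (cyl n) := by
  unfold cyl
  infer_instance

/-- The Riemann–Liouville integral of the maximal function. -/
def capPotential {n : ℕ} (α : ℝ) (g : ℝ → Sph n → ℂ) (t : ℝ) (ξ : Sph n) : ℝ≥0∞ :=
  ∫⁻ s in Set.Ioi (0 : ℝ), ENNReal.ofReal (ppow (α - 1) (t - s)) * capMax (fun η => ‖g s η‖ₑ) ξ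

/-- The Riemann–Liouville integral of Poisson integrals. -/
def potential {n : ℕ} (α : ℝ) (g : ℝ → Sph n → ℂ) (t : ℝ) (ξ : Sph n) : ℂ :=
  ∫ p, (ppow (α - 1) (t - p.1) * pker (√(p.1 / t)) ξ.1 p.2.1) • g p.1 p.2 ∂(cyl n)

theorem lintegral_ppow_Ioo_ne_top {α : ℝ} (hα : 0 < α) (N : ℕ) :
    ∫⁻ u in Set.Ioo (0 : ℝ) N, ENNReal.ofReal (ppow (α - 1) u) ≠ ∞ := by
  have h : IntegrableOn (fun u : ℝ => u ^ (α - 1)) (Set.Ioo (0 : ℝ) N) := by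
    have := (intervalIntegral.intervalIntegrable_rpow' (a := 0) (b := N) (r := α - 1) (by linarith)).1
    exact this.mono_set Set.Ioo_subset_Ioc_self
  have h2 := h.2
  rw [hasFiniteIntegral_iff_ofReal] at h2
  · rw [setLIntegral_congr_fun measurableSet_Ioo
      fun u hu => by rw [ppow_of_pos (show 0 < u from hu.1)]]
    exact h2.ne
  · filter_upwards [ae_restrict_mem measurableSet_Ioo] with u hu
    exact Real.rpow_nonneg (le_of_lt hu.1) _

/-- Integrate over `t` in `(0, N)` and exchange: the power is integrable near `0` because `α > 0`,
and only values `s < N` contribute. -/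
theorem ae_lintegral_ppow_mul_ne_top {α : ℝ} (hα : 0 < α) {v : ℝ → ℝ≥0∞} (hv : Measurable v)
    (hfin : ∀ N : ℕ, ∫⁻ s in Set.Ioo (0 : ℝ) N, v s ≠ ∞) :
    ∀ᵐ t ∂(volume.restrict (Set.Ioi (0 : ℝ))),
      ∫⁻ s in Set.Ioi (0 : ℝ), ENNReal.ofReal (ppow (α - 1) (t - s)) * v s ≠ ∞ := by
  refine ae_of_ae_Ioo fun N => ?_
  have hp : Measurable fun q : ℝ × ℝ => ENNReal.ofReal (ppow (α - 1) (q.1 - q.2)) :=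
    ((measurable_ppow (α - 1)).comp (measurable_fst.sub measurable_snd)).ennreal_ofReal
  have hm : Measurable (Function.uncurry fun t s : ℝ =>
      ENNReal.ofReal (ppow (α - 1) (t - s)) * v s) := hp.mul (hv.comp measurable_snd)
  set K := ∫⁻ u in Set.Ioo (0 : ℝ) N, ENNReal.ofReal (ppow (α - 1) u)
  have hinner : ∀ s ∈ Set.Ioi (0 : ℝ),
      ∫⁻ t in Set.Ioo (0 : ℝ) N, ENNReal.ofReal (ppow (α - 1) (t - s)) * v s ≤
        (Set.Ioo (0 : ℝ) N).indicator (fun s => K * v s) s := by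
    intro s hs
    have hs0 : (0 : ℝ) < s := hs
    have hms : Measurable fun t => ENNReal.ofReal (ppow (α - 1) (t - s)) :=
      ((measurable_ppow (α - 1)).comp (measurable_id.sub_const s)).ennreal_ofReal
    rw [lintegral_mul_const _ hms]
    by_cases hsN : s < N
    · rw [Set.indicator_of_mem (show s ∈ Set.Ioo (0 : ℝ) N from ⟨hs0, hsN⟩)]
      refine mul_le_mul' ?_ le_rfl
      rw [← lintegral_indicator measurableSet_Ioo]
      simp only [K]
      rw [← lintegral_indicator measurableSet_Ioo, ← lintegral_sub_right_eq_self
        ((Set.Ioo (0 : ℝ) N).indicator fun u => ENNReal.ofReal (ppow (α - 1) u)) s]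
      refine lintegral_mono fun t => ?_
      by_cases ht : t ∈ Set.Ioo (0 : ℝ) N
      · rw [Set.indicator_of_mem ht]
        by_cases hts : 0 < t - s
        · rw [Set.indicator_of_mem (show t - s ∈ Set.Ioo (0 : ℝ) N from ⟨hts, by linarith [ht.2]⟩)]
        · rw [ppow_of_nonpos (not_lt.1 hts), ENNReal.ofReal_zero]
          exact zero_le
      · rw [Set.indicator_of_notMem ht]
        exact zero_le
    · rw [setLIntegral_congr_fun measurableSet_Ioo (g := fun _ => 0) fun t ht => by
        rw [ppow_of_nonpos (by linarith [ht.2, not_lt.1 hsN]), ENNReal.ofReal_zero]]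
      simp
  have hfin2 : ∫⁻ t in Set.Ioo (0 : ℝ) N, ∫⁻ s in Set.Ioi (0 : ℝ),
      ENNReal.ofReal (ppow (α - 1) (t - s)) * v s ≠ ∞ := by
    rw [lintegral_lintegral_swap hm.aemeasurable]
    refine ne_top_of_le_ne_top ?_ (setLIntegral_mono' measurableSet_Ioi hinner)
    rw [setLIntegral_indicator measurableSet_Ioo,
      Set.inter_eq_left.2 (Set.Ioo_subset_Ioi_self), lintegral_const_mul _ hv]
    exact ENNReal.mul_ne_top (lintegral_ppow_Ioo_ne_top hα N) (hfin N)
  filter_upwards [ae_lt_top hm.lintegral_prod_right' hfin2] with t ht using ht.ne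

theorem measurable_capMax_left {n : ℕ} {g : ℝ → Sph n → ℂ} (hg : Measurable (Function.uncurry g))
    (ξ : Sph n) : Measurable fun s => capMax (fun η => ‖g s η‖ₑ) ξ := by
  have h1 : Measurable fun s : ℝ => (s, ξ) := measurable_prodMk_right
  have h2 := (measurable_capMax (W := fun s η => ‖g s η‖ₑ) hg.enorm).comp h1
  exact h2

theorem ae_capPotential_ne_top_left {n : ℕ} {α : ℝ} (hα : 0 < α) {g : ℝ → Sph n → ℂ}
    (hg : Measurable (Function.uncurry g)) {ξ : Sph n}
    (h : ∀ N : ℕ, ∫⁻ s in Set.Ioo (0 : ℝ) N, capMax (fun η => ‖g s η‖ₑ) ξ ≠ ∞) :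
    ∀ᵐ t ∂(volume.restrict (Set.Ioi (0 : ℝ))), capPotential α g t ξ ≠ ∞ :=
  ae_lintegral_ppow_mul_ne_top hα (measurable_capMax_left hg ξ) h

theorem measurable_capPotential {n : ℕ} (α : ℝ) {g : ℝ → Sph n → ℂ}
    (hg : Measurable (Function.uncurry g)) :
    Measurable fun p : ℝ × Sph n => capPotential α g p.1 p.2 := by
  refine Measurable.lintegral_prod_right' (f := fun q : (ℝ × Sph n) × ℝ =>
    ENNReal.ofReal (ppow (α - 1) (q.1.1 - q.2)) * capMax (fun η => ‖g q.2 η‖ₑ) q.1.2) ?_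
  refine Measurable.mul ?_ ?_
  · exact ((measurable_ppow (α - 1)).comp
      (measurable_fst.fst.sub measurable_snd)).ennreal_ofReal
  · have h1 : Measurable fun q : (ℝ × Sph n) × ℝ => (q.2, q.1.2) := by fun_prop
    have h2 := (measurable_capMax (W := fun s η => ‖g s η‖ₑ) hg.enorm).comp h1
    exact h2

theorem ae_capPotential_ne_top {n : ℕ} {α : ℝ} (hα : 0 < α) {g : ℝ → Sph n → ℂ}
    (hg : Measurable (Function.uncurry g))
    (h : ∀ᵐ ξ ∂(surf n), ∀ N : ℕ, ∫⁻ s in Set.Ioo (0 : ℝ) N, capMax (fun η => ‖g s η‖ₑ) ξ ≠ ∞) :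
    ∀ᵐ p ∂(cyl n), capPotential α g p.1 p.2 ≠ ∞ := by
  have hm : MeasurableSet {p : ℝ × Sph n | capPotential α g p.1 p.2 ≠ ∞} :=
    (measurable_capPotential α hg) (measurableSet_singleton ∞).compl
  refine ae_prod_of_ae_ae_swap (Q := fun t ξ => capPotential α g t ξ ≠ ∞) hm ?_
  filter_upwards [h] with ξ hξ using ae_capPotential_ne_top_left hα hg hξ

theorem sqrt_div_mem {s t : ℝ} (hs : 0 ≤ s) (hst : s < t) : 0 ≤ √(s / t) ∧ √(s / t) < 1 := by
  refine ⟨Real.sqrt_nonneg _, ?_⟩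
  rw [Real.sqrt_lt' one_pos, one_pow, div_lt_one (hs.trans_lt hst)]
  exact hst

theorem measurable_pker_comp {n : ℕ} {X : Type*} [MeasurableSpace X] {r : X → ℝ} {ξ η : X → Sph n}
    (hr : Measurable r) (hξ : Measurable ξ) (hη : Measurable η) :
    Measurable fun x => pker (r x) (ξ x).1 (η x).1 := by
  have h1 : Measurable fun x => (r x, (ξ x).1, (η x).1) := by fun_prop
  have h2 := measurable_pker.comp h1
  exact h2

theorem measurable_potential_integrand {n : ℕ} (α : ℝ) {g : ℝ → Sph n → ℂ}
    (hg : Measurable (Function.uncurry g)) (w t : ℝ) :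
    Measurable fun q : Sph n × (ℝ × Sph n) =>
      (ppow (α - 1) (w - q.2.1) * pker (√(q.2.1 / t)) q.1.1 q.2.2.1) • g q.2.1 q.2.2 := by
  have h1 : Measurable fun q : Sph n × (ℝ × Sph n) => ppow (α - 1) (w - q.2.1) :=
    (measurable_ppow (α - 1)).comp (measurable_const.sub measurable_snd.fst)
  have h2 : Measurable fun q : Sph n × (ℝ × Sph n) => pker (√(q.2.1 / t)) q.1.1 q.2.2.1 :=
    measurable_pker_comp (by fun_prop) (by fun_prop) (by fun_prop)
  have h3 : Measurable fun q : Sph n × (ℝ × Sph n) => g q.2.1 q.2.2 := hg.comp measurable_snd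
  exact (h1.mul h2).smul h3

/-- The integral over `η` is bounded first by the maximal function; where the radius `√(s/t)` could
reach `1`, the power vanishes. The level `w` of the power and the reference level `t` of the radius
are kept apart since they differ after a Poisson integral is taken. -/
theorem lintegral_potential_integrand_le {n : ℕ} {α : ℝ} {g : ℝ → Sph n → ℂ}
    (hg : Measurable (Function.uncurry g)) {C : ℝ}
    (hC : ∀ w : Sph n → ℝ≥0∞, Measurable w → ∀ r : ℝ, 0 ≤ r → r < 1 → ∀ ξ : Sph n,
      ∫⁻ η, ENNReal.ofReal (pker r ξ.1 η.1) * w η ∂(surf n) ≤ ENNReal.ofReal C * capMax w ξ)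
    {w t : ℝ} (hwt : w ≤ t) (ξ : Sph n) :
    ∫⁻ p, ENNReal.ofReal (ppow (α - 1) (w - p.1)) *
      (ENNReal.ofReal (pker (√(p.1 / t)) ξ.1 p.2.1) * ‖g p.1 p.2‖ₑ) ∂(cyl n) ≤
      ENNReal.ofReal C * capPotential α g w ξ := by
  have h1 : Measurable fun p : ℝ × Sph n => ENNReal.ofReal (ppow (α - 1) (w - p.1)) :=
    ((measurable_ppow (α - 1)).comp (measurable_const.sub measurable_fst)).ennreal_ofReal
  have h2 : Measurable fun p : ℝ × Sph n => ENNReal.ofReal (pker (√(p.1 / t)) ξ.1 p.2.1) :=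
    (measurable_pker_comp (by fun_prop) measurable_const measurable_snd).ennreal_ofReal
  have h3 : Measurable fun p : ℝ × Sph n => ENNReal.ofReal (ppow (α - 1) (w - p.1)) *
      (ENNReal.ofReal (pker (√(p.1 / t)) ξ.1 p.2.1) * ‖g p.1 p.2‖ₑ) := h1.mul (h2.mul hg.enorm)
  rw [cyl, lintegral_prod _ h3.aemeasurable, capPotential,
    ← lintegral_const_mul' _ _ ENNReal.ofReal_ne_top]
  refine setLIntegral_mono' measurableSet_Ioi fun s hs => ?_
  have hs0 : (0 : ℝ) < s := hs
  have hgs : Measurable fun η => ‖g s η‖ₑ := (hg.comp measurable_prodMk_left).enorm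
  dsimp only
  rw [lintegral_const_mul' _ _ ENNReal.ofReal_ne_top, mul_left_comm]
  by_cases hsw : s < w
  · obtain ⟨hr0, hr1⟩ := sqrt_div_mem hs0.le (hsw.trans_le hwt)
    exact mul_le_mul' le_rfl (hC _ hgs _ hr0 hr1 ξ)
  · rw [ppow_of_nonpos (by linarith), ENNReal.ofReal_zero, zero_mul]
    exact zero_le

theorem enorm_potential_integrand {n : ℕ} (hn : 0 < n) (α : ℝ) (z : ℂ) {s w t : ℝ} (hs : 0 < s)
    (hwt : w ≤ t) (ξ η : Sph n) :
    ‖(ppow (α - 1) (w - s) * pker (√(s / t)) ξ.1 η.1) • z‖ₑ =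
      ENNReal.ofReal (ppow (α - 1) (w - s)) *
        (ENNReal.ofReal (pker (√(s / t)) ξ.1 η.1) * ‖z‖ₑ) := by
  rw [enorm_smul, enorm_mul, Real.enorm_of_nonneg (ppow_nonneg _ _), mul_assoc]
  by_cases hsw : s < w
  · obtain ⟨hr0, hr1⟩ := sqrt_div_mem hs.le (hsw.trans_le hwt)
    rw [Real.enorm_of_nonneg (pker_pos hn hr0 hr1 ξ η).le]
  · rw [ppow_of_nonpos (by linarith), ENNReal.ofReal_zero, zero_mul, zero_mul]

theorem integrable_potential_integrand {n : ℕ} (hn : 0 < n) {α : ℝ} {g : ℝ → Sph n → ℂ}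
    (hg : Measurable (Function.uncurry g)) {w t : ℝ} (hwt : w ≤ t) {ξ : Sph n}
    (hfin : capPotential α g w ξ ≠ ∞) :
    Integrable (fun p : ℝ × Sph n =>
      (ppow (α - 1) (w - p.1) * pker (√(p.1 / t)) ξ.1 p.2.1) • g p.1 p.2) (cyl n) := by
  obtain ⟨C, -, hC⟩ := exists_lintegral_pker_le_capMax hn
  have h1 : Measurable fun p : ℝ × Sph n => (ξ, p) := measurable_prodMk_left
  have h2 := (measurable_potential_integrand α hg w t).comp h1
  refine ⟨h2.aestronglyMeasurable, ?_⟩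
  refine lt_of_le_of_lt ?_ ((lintegral_potential_integrand_le hg hC hwt ξ).trans_lt
    (ENNReal.mul_lt_top ENNReal.ofReal_lt_top hfin.lt_top))
  refine le_of_eq (lintegral_congr_ae ?_)
  filter_upwards [ae_cyl_pos n] with p hp using enorm_potential_integrand hn α _ hp hwt ξ p.2

theorem integral_potential_integrand {n : ℕ} (hn : 0 < n) {α : ℝ} {g : ℝ → Sph n → ℂ}
    (hg : Measurable (Function.uncurry g)) {w t : ℝ} (hwt : w ≤ t) {ξ : Sph n}
    (hfin : capPotential α g w ξ ≠ ∞) :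
    ∫ p, (ppow (α - 1) (w - p.1) * pker (√(p.1 / t)) ξ.1 p.2.1) • g p.1 p.2 ∂(cyl n) =
      ∫ s in Set.Ioi (0 : ℝ), ppow (α - 1) (w - s) • pint (g s) (√(s / t)) ξ := by
  rw [cyl, integral_prod _ (integrable_potential_integrand hn hg hwt hfin)]
  refine integral_congr_ae (Eventually.of_forall fun s => ?_)
  simp only [pint]
  rw [← integral_smul]
  refine integral_congr_ae (Eventually.of_forall fun η => ?_)
  simp only
  rw [mul_smul]

theorem lintegral_pker_mul_pker {n : ℕ} (hn : 0 < n) {r ρ : ℝ} (hr : 0 ≤ r) (hr1 : r < 1)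
    (hρ : 0 ≤ ρ) (hρ1 : ρ < 1) (ξ η : Sph n) :
    ∫⁻ ζ : Sph n, ENNReal.ofReal (pker r ξ.1 ζ.1) * ENNReal.ofReal (pker ρ ζ.1 η.1) ∂(surf n) =
      ENNReal.ofReal (pker (r * ρ) ξ.1 η.1) := by
  have h := integral_pker_mul_pker hn hr hr1 hρ hρ1 ξ η
  have hpos : 0 < pker (r * ρ) ξ.1 η.1 :=
    pker_pos hn (mul_nonneg hr hρ) (mul_lt_one_of_nonneg_of_lt_one_left hr hr1 hρ1.le) ξ η
  -- A nonintegrable function would have integral `0` by convention, whereas the semigroup identity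
  -- gives a positive value.
  have hint : Integrable (fun ζ : Sph n => pker r ξ.1 ζ.1 * pker ρ ζ.1 η.1) (surf n) := by
    by_contra hni
    rw [integral_undef hni] at h
    exact hpos.ne h
  rw [← h, ofReal_integral_eq_lintegral_ofReal hint (Eventually.of_forall fun ζ =>
    mul_nonneg (pker_pos hn hr hr1 ξ ζ).le (pker_pos hn hρ hρ1 ζ η).le)]
  refine lintegral_congr fun ζ => ?_
  rw [ENNReal.ofReal_mul (pker_pos hn hr hr1 ξ ζ).le]

/-- Poisson integrals of potentials. -/
theorem pint_potential {n : ℕ} (hn : 0 < n) {α : ℝ} {g : ℝ → Sph n → ℂ}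
    (hg : Measurable (Function.uncurry g)) {w t : ℝ} (hw : 0 < w) (hwt : w < t) {ξ : Sph n}
    (hfin : capPotential α g w ξ ≠ ∞) :
    pint (potential α g w) (√(w / t)) ξ =
      ∫ s in Set.Ioi (0 : ℝ), ppow (α - 1) (w - s) • pint (g s) (√(s / t)) ξ := by
  obtain ⟨C, -, hC⟩ := exists_lintegral_pker_le_capMax hn
  obtain ⟨hρ0, hρ1⟩ := sqrt_div_mem hw.le hwt
  have hmul : ∀ s, 0 < s → √(w / t) * √(s / w) = √(s / t) := fun s hs => by
    have ht : 0 < t := hw.trans hwt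
    rw [← Real.sqrt_mul (div_nonneg hw.le ht.le)]
    congr 1
    field_simp
  rw [← integral_potential_integrand hn hg hwt.le hfin]
  set F : Sph n → ℝ × Sph n → ℂ := fun ζ p => pker (√(w / t)) ξ.1 ζ.1 •
    ((ppow (α - 1) (w - p.1) * pker (√(p.1 / w)) ζ.1 p.2.1) • g p.1 p.2)
  have hk1 : Measurable fun ζ : Sph n => pker (√(w / t)) ξ.1 ζ.1 :=
    measurable_pker_comp measurable_const measurable_const measurable_id
  have hF : Measurable (Function.uncurry F) :=
    (hk1.comp measurable_fst).smul (measurable_potential_integrand α hg w w)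
  have hnorm : ∀ p : ℝ × Sph n, 0 < p.1 → ∀ ζ, ‖F ζ p‖ₑ = ENNReal.ofReal (pker (√(w / t)) ξ.1 ζ.1) *
      (ENNReal.ofReal (ppow (α - 1) (w - p.1)) *
        (ENNReal.ofReal (pker (√(p.1 / w)) ζ.1 p.2.1) * ‖g p.1 p.2‖ₑ)) := fun p hp ζ => by
    simp only [F]
    rw [enorm_smul, Real.enorm_of_nonneg (pker_pos hn hρ0 hρ1 ξ ζ).le,
      enorm_potential_integrand hn α _ hp le_rfl]
  -- All kernels are positive, so integrating `ζ` first merges them into one kernel of radius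
  -- `√(w/t) √(s/w) = √(s/t)`; the remaining integral is bounded by the finite `capPotential`.
  have hint : Integrable (Function.uncurry F) ((surf n).prod (cyl n)) := by
    refine ⟨hF.aestronglyMeasurable, ?_⟩
    rw [HasFiniteIntegral, lintegral_prod_symm _ hF.enorm.aemeasurable]
    refine lt_of_le_of_lt ?_ ((lintegral_potential_integrand_le hg hC hwt.le ξ).trans_lt
      (ENNReal.mul_lt_top ENNReal.ofReal_lt_top hfin.lt_top))
    refine le_of_eq (lintegral_congr_ae ?_)
    filter_upwards [ae_cyl_pos n] with p hp
    simp only [Function.uncurry_apply_pair]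
    simp_rw [hnorm p hp]
    by_cases hsw : p.1 < w
    · obtain ⟨hr0, hr1⟩ := sqrt_div_mem hp.le hsw
      rw [← hmul p.1 hp, ← lintegral_pker_mul_pker hn hρ0 hρ1 hr0 hr1 ξ p.2]
      have hk2 : Measurable fun ζ : Sph n => pker (√(p.1 / w)) ζ.1 p.2.1 :=
        measurable_pker_comp measurable_const measurable_id measurable_const
      have hk3 : Measurable fun ζ : Sph n => ENNReal.ofReal (pker (√(w / t)) ξ.1 ζ.1) *
          ENNReal.ofReal (pker (√(p.1 / w)) ζ.1 p.2.1) := hk1.ennreal_ofReal.mul hk2.ennreal_ofReal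
      rw [mul_comm _ ‖g p.1 p.2‖ₑ, ← mul_assoc, ← lintegral_const_mul _ hk3]
      refine lintegral_congr fun ζ => ?_
      ring
    · rw [ppow_of_nonpos (by linarith), ENNReal.ofReal_zero]
      simp
  calc pint (potential α g w) (√(w / t)) ξ = ∫ ζ, ∫ p, F ζ p ∂(cyl n) ∂(surf n) := by
        unfold pint potential
        refine integral_congr_ae (Eventually.of_forall fun ζ => ?_)
        simp only [F]
        rw [integral_smul]
    _ = ∫ p, ∫ ζ, F ζ p ∂(surf n) ∂(cyl n) := integral_integral_swap hint
    _ = _ := by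
        refine integral_congr_ae ?_
        filter_upwards [ae_cyl_pos n] with p hp
        by_cases hsw : p.1 < w
        · obtain ⟨hr0, hr1⟩ := sqrt_div_mem hp.le hsw
          rw [← hmul p.1 hp, ← integral_pker_mul_pker hn hρ0 hρ1 hr0 hr1 ξ p.2,
            ← integral_const_mul, ← integral_smul_const]
          refine integral_congr_ae (Eventually.of_forall fun ζ => ?_)
          simp only [F]
          rw [smul_smul]
          congr 1
          ring
        · simp only [F]
          rw [ppow_of_nonpos (by linarith)]
          simp

/-- The substitution `s = t - y`. On the right only the power depends on `w`, so all levels `w = t -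
u` are values of the fractional integral of one and the same profile. -/
theorem integral_ppow_smul_pint_eq {n : ℕ} (α : ℝ) (g : ℝ → Sph n → ℂ) {w t : ℝ} (hwt : w ≤ t)
    (ξ : Sph n) :
    ∫ s in Set.Ioi (0 : ℝ), ppow (α - 1) (w - s) • pint (g s) (√(s / t)) ξ =
      ∫ y in Set.Ioi (0 : ℝ), ppow (α - 1) (y - (t - w)) • profile g t ξ y := by
  rw [← integral_indicator measurableSet_Ioi, ← integral_indicator measurableSet_Ioi,
    ← integral_sub_left_eq_self _ volume t]
  refine integral_congr_ae (Eventually.of_forall fun y => ?_)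
  dsimp only
  by_cases h1 : 0 < y
  · rw [Set.indicator_of_mem (show y ∈ Set.Ioi (0 : ℝ) from h1)]
    by_cases h2 : y < t
    · rw [Set.indicator_of_mem (show t - y ∈ Set.Ioi (0 : ℝ) from sub_pos.2 h2), profile,
        if_pos ⟨h1, h2⟩]
      congr 2
      ring
    · rw [Set.indicator_of_notMem (fun h : t - y ∈ Set.Ioi (0 : ℝ) => h2 (sub_pos.1 h)), profile,
        if_neg (fun h => h2 h.2), smul_zero]
  · rw [Set.indicator_of_notMem (show y ∉ Set.Ioi (0 : ℝ) from h1)]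
    by_cases h2 : t - y ∈ Set.Ioi (0 : ℝ)
    · rw [Set.indicator_of_mem h2, ppow_of_nonpos (by linarith), zero_smul]
    · rw [Set.indicator_of_notMem h2]

theorem exists_enorm_profile_le {n : ℕ} (hn : 0 < n) : ∃ C : ℝ, 0 < C ∧
    ∀ g : ℝ → Sph n → ℂ, Measurable (Function.uncurry g) → ∀ t ξ y,
      ‖profile g t ξ y‖ₑ ≤ (Set.Ioo 0 t).indicator
        (fun y => ENNReal.ofReal C * capMax (fun η => ‖g (t - y) η‖ₑ) ξ) y := by
  obtain ⟨C, hC, h⟩ := exists_enorm_pint_le_capMax hn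
  refine ⟨C, hC, fun g hg t ξ y => ?_⟩
  by_cases hy : 0 < y ∧ y < t
  · rw [profile, if_pos hy, Set.indicator_of_mem (show y ∈ Set.Ioo 0 t from hy)]
    obtain ⟨h0, h1, -⟩ := sqrt_sub_div_mem hy.1 hy.2
    exact h _ (hg.comp measurable_prodMk_left) ξ _ h0 h1
  · rw [profile, if_neg hy, enorm_zero]
    exact zero_le

theorem lintegral_Ioi_reflect_le (Φ : ℝ → ℝ≥0∞) (t : ℝ) :
    ∫⁻ y in Set.Ioo 0 t, Φ (t - y) ≤ ∫⁻ s in Set.Ioo 0 t, Φ s := by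
  rw [← lintegral_indicator measurableSet_Ioo, ← lintegral_indicator measurableSet_Ioo,
    ← lintegral_sub_left_eq_self ((Set.Ioo 0 t).indicator Φ) t]
  refine lintegral_mono fun y => ?_
  by_cases hy : y ∈ Set.Ioo 0 t
  · rw [Set.indicator_of_mem hy, Set.indicator_of_mem
      (show t - y ∈ Set.Ioo 0 t from ⟨sub_pos.2 hy.2, sub_lt_self _ hy.1⟩)]
  · rw [Set.indicator_of_notMem hy]
    exact zero_le

theorem lintegral_profile_ne_top {n : ℕ} (hn : 0 < n) {g : ℝ → Sph n → ℂ}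
    (hg : Measurable (Function.uncurry g)) {ξ : Sph n}
    (h : ∀ N : ℕ, ∫⁻ s in Set.Ioo (0 : ℝ) N, capMax (fun η => ‖g s η‖ₑ) ξ ≠ ∞) (t : ℝ) :
    ∫⁻ y in Set.Ioi (0 : ℝ), ‖profile g t ξ y‖ₑ ≠ ∞ := by
  obtain ⟨C, -, hC⟩ := exists_enorm_profile_le hn
  obtain ⟨N, hN⟩ := exists_nat_gt t
  refine ne_top_of_le_ne_top (ENNReal.mul_ne_top (ENNReal.ofReal_ne_top (r := C)) (h N)) ?_
  calc ∫⁻ y in Set.Ioi (0 : ℝ), ‖profile g t ξ y‖ₑ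
      ≤ ∫⁻ y in Set.Ioi (0 : ℝ), (Set.Ioo 0 t).indicator
        (fun y => ENNReal.ofReal C * capMax (fun η => ‖g (t - y) η‖ₑ) ξ) y :=
        lintegral_mono fun y => hC g hg t ξ y
    _ ≤ ∫⁻ y in Set.Ioo 0 t, ENNReal.ofReal C * capMax (fun η => ‖g (t - y) η‖ₑ) ξ := by
        rw [← lintegral_indicator measurableSet_Ioo]
        exact setLIntegral_le_lintegral _ _
    _ = ENNReal.ofReal C * ∫⁻ y in Set.Ioo 0 t, capMax (fun η => ‖g (t - y) η‖ₑ) ξ :=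
        lintegral_const_mul' _ _ ENNReal.ofReal_ne_top
    _ ≤ ENNReal.ofReal C * ∫⁻ s in Set.Ioo (0 : ℝ) N, capMax (fun η => ‖g s η‖ₑ) ξ := by
        refine mul_le_mul' le_rfl ?_
        refine (lintegral_Ioi_reflect_le (fun s => capMax (fun η => ‖g s η‖ₑ) ξ) t).trans ?_
        exact lintegral_mono_set (Set.Ioo_subset_Ioo_right hN.le)

theorem integrableOn_rpow_smul_profile {n : ℕ} (hn : 0 < n) {α : ℝ} {g : ℝ → Sph n → ℂ}
    (hg : Measurable (Function.uncurry g)) {t : ℝ} {ξ : Sph n}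
    (h : capPotential α g t ξ ≠ ∞) :
    IntegrableOn (fun y => y ^ (α - 1) • profile g t ξ y) (Set.Ioi 0) := by
  obtain ⟨C, -, hC⟩ := exists_enorm_profile_le hn
  have hm : Measurable fun y : ℝ => y ^ (α - 1) • profile g t ξ y := by
    have h1 : Measurable fun y : ℝ => y ^ (α - 1) := by fun_prop
    exact h1.smul (measurable_profile hg t ξ)
  refine ⟨hm.aestronglyMeasurable, ?_⟩
  refine lt_of_le_of_lt ?_ (ENNReal.mul_lt_top (ENNReal.ofReal_lt_top (r := C)) h.lt_top)
  set Φ : ℝ → ℝ≥0∞ := fun s => ENNReal.ofReal (ppow (α - 1) (t - s)) * capMax (fun η => ‖g s η‖ₑ) ξ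
  calc ∫⁻ y in Set.Ioi (0 : ℝ), ‖y ^ (α - 1) • profile g t ξ y‖ₑ
      ≤ ∫⁻ y in Set.Ioi (0 : ℝ), (Set.Ioo 0 t).indicator
        (fun y => ENNReal.ofReal C * Φ (t - y)) y := by
        refine setLIntegral_mono' measurableSet_Ioi fun y hy => ?_
        have hy0 : (0 : ℝ) < y := hy
        rw [enorm_smul, Real.enorm_of_nonneg (Real.rpow_nonneg hy0.le _)]
        refine (mul_le_mul' le_rfl (hC g hg t ξ y)).trans ?_
        by_cases hyt : y ∈ Set.Ioo 0 t
        · rw [Set.indicator_of_mem hyt, Set.indicator_of_mem hyt]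
          simp only [Φ]
          rw [sub_sub_cancel, ppow_of_pos hy0, mul_left_comm]
        · rw [Set.indicator_of_notMem hyt, mul_zero]
          exact zero_le
    _ ≤ ∫⁻ y in Set.Ioo 0 t, ENNReal.ofReal C * Φ (t - y) := by
        rw [← lintegral_indicator measurableSet_Ioo]
        exact setLIntegral_le_lintegral _ _
    _ = ENNReal.ofReal C * ∫⁻ y in Set.Ioo 0 t, Φ (t - y) :=
        lintegral_const_mul' _ _ ENNReal.ofReal_ne_top
    _ ≤ ENNReal.ofReal C * capPotential α g t ξ := by
        refine mul_le_mul' le_rfl ((lintegral_Ioi_reflect_le Φ t).trans ?_)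
        exact lintegral_mono_set Set.Ioo_subset_Ioi_self

/-! ### Marchaud inversion on the half-line. -/

theorem ae_comp_mul_left {P : ℝ → Prop} (h : ∀ᵐ u, P u) {c : ℝ} (hc : c ≠ 0) :
    ∀ᵐ τ : ℝ, P (c * τ) := by
  have hq : Measure.QuasiMeasurePreserving (fun τ : ℝ => c * τ) :=
    ⟨measurable_const_mul c, by
      rw [Real.map_volume_mul_left hc]
      exact Measure.smul_absolutelyContinuous⟩
  exact hq.ae h

/-- Inversion of a fractional integral on the half line by Marchaud's truncated integrals. -/
theorem marchaud_inversion {α : ℝ} (hα : 0 < α) {l : ℕ} (hl : α < l) {G : ℝ → ℂ} {γ : ℂ}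
    (hG : Measurable G) (hGi : ∫⁻ y in Set.Ioi (0 : ℝ), ‖G y‖ₑ ≠ ∞)
    (hint : IntegrableOn (fun y => y ^ (α - 1) • G y) (Set.Ioi 0))
    (hleb : Tendsto (fun δ : ℝ => (∫⁻ y in Set.Ioc 0 δ, ‖G y - γ‖ₑ) / ENNReal.ofReal δ)
      (𝓝[>] 0) (𝓝 0))
    {A : ℝ → ℂ} {K : ℝ} (hA0 : A 0 = K • ∫ y in Set.Ioi (0 : ℝ), ppow (α - 1) y • G y)
    (hA : ∀ᵐ u : ℝ, 0 < u → A (-u) = K • ∫ y in Set.Ioi (0 : ℝ), ppow (α - 1) (y - u) • G y) :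
    (∀ ε : ℝ, 0 < ε →
      IntegrableOn (fun τ : ℝ => (1 / τ ^ (1 + α) : ℝ) • findiff l τ A 0) (Set.Ioi ε)) ∧
    Tendsto (fun ε : ℝ => ∫ τ in Set.Ioi ε, (1 / τ ^ (1 + α) : ℝ) • findiff l τ A 0)
      (𝓝[>] 0) (𝓝 ((K * (Real.Gamma α * kappa α l)) • γ)) := by
  set S : ℝ → ℂ := fun τ => τ ^ (-1 - α) • ∑ j ∈ Finset.range (l + 1),
    ((-1) ^ j * (l.choose j : ℂ)) * ∫ y in Set.Ioi (0 : ℝ), ppow (α - 1) (y - j * τ) • G y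
  -- The term `j = 0` uses the exact value of `A` at `0`. For `j > 0` the formula for `A` is known
  -- only for almost every argument, which suffices because `τ ↦ jτ` pulls null sets back to null
  -- sets.
  have hae : ∀ᵐ τ : ℝ, ∀ j : ℕ, 0 < τ →
      A (0 - j * τ) = K • ∫ y in Set.Ioi (0 : ℝ), ppow (α - 1) (y - j * τ) • G y := by
    rw [ae_all_iff]
    intro j
    rcases Nat.eq_zero_or_pos j with rfl | hj
    · refine Eventually.of_forall fun τ _ => ?_
      simpa using hA0
    · have hj0 : (0 : ℝ) < j := by exact_mod_cast hj
      filter_upwards [ae_comp_mul_left hA hj0.ne'] with τ hτ hτ0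
      rw [zero_sub]
      exact hτ (mul_pos hj0 hτ0)
  have hS : ∀ᵐ τ : ℝ, 0 < τ → (1 / τ ^ (1 + α) : ℝ) • findiff l τ A 0 = K • S τ := by
    filter_upwards [hae] with τ hτ hτ0
    simp only [S, findiff]
    rw [smul_comm K, show -1 - α = -(1 + α) by ring, Real.rpow_neg hτ0.le, one_div,
      Finset.smul_sum (r := K)]
    congr 1
    refine Finset.sum_congr rfl fun j _ => ?_
    rw [hτ j hτ0, mul_smul_comm]
  have hSε : ∀ ε : ℝ, 0 < ε → (fun τ : ℝ => (1 / τ ^ (1 + α) : ℝ) • findiff l τ A 0)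
      =ᵐ[volume.restrict (Set.Ioi ε)] fun τ => K • S τ := fun ε hε => by
    filter_upwards [ae_restrict_of_ae hS, ae_restrict_mem measurableSet_Ioi] with τ h1 h2
    exact h1 (hε.trans h2)
  have hsum := fun ε (hε : 0 < ε) => marchaud_sum hα hε l hG hint
  refine ⟨fun ε hε => ?_, ?_⟩
  · have h1 : IntegrableOn (fun τ => K • S τ) (Set.Ioi ε) := (hsum ε hε).1.smul K
    exact h1.congr (hSε ε hε).symm
  · have hlim := (tendsto_integral_mker hα hl hG hGi (fun ε hε => (hsum ε hε).2.1) hleb).const_smul K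
    rw [smul_smul] at hlim
    refine hlim.congr' ?_
    filter_upwards [self_mem_nhdsWithin] with ε hε
    rw [integral_congr_ae (hSε ε hε), integral_smul, (hsum ε hε).2.2]

/-! ### Transfer to the sphere and inversion at a good point. -/

/-- The function `φ` in the coordinates `(tan²(θ/2), ξ')`, with the weight that turns the spherical
fractional integral into a potential. -/
def pullback {n : ℕ} (α a : ℝ) (φ : Sph (n + 1) → ℂ) (s : ℝ) (η : Sph n) : ℂ :=
  if (1 + a) / (1 - a) < s then
    ((1 + s) ^ (-((n : ℝ) / 2) - α) * s ^ ((n : ℝ) / 2 - 1) : ℝ) • φ (slice s η) else 0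

theorem measurable_pullback {n : ℕ} (α a : ℝ) {φ : Sph (n + 1) → ℂ} (hφ : Measurable φ) :
    Measurable (Function.uncurry (pullback α a φ)) := by
  have h1 : MeasurableSet {p : ℝ × Sph n | (1 + a) / (1 - a) < p.1} :=
    measurableSet_lt measurable_const measurable_fst
  have h2 : Measurable fun p : ℝ × Sph n =>
      ((1 + p.1) ^ (-((n : ℝ) / 2) - α) * p.1 ^ ((n : ℝ) / 2 - 1) : ℝ) := by fun_prop
  have h3 : Measurable fun p : ℝ × Sph n => φ (slice p.1 p.2) := hφ.comp continuous_slice.measurable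
  exact Measurable.ite h1 (h2.smul h3) measurable_const

/-- The factor relating the spherical fractional integral to the potential. -/
def potentialFactor (n : ℕ) (α t : ℝ) : ℝ :=
  2 ^ α / Real.Gamma α * ((1 + t) ^ ((n : ℝ) / 2 - α) * t ^ (1 - (n : ℝ) / 2))

/-- The height difference is a multiple of `t - s` and the distance a multiple of `√t ‖√(s/t) ξ -
η‖`. Writing `(t - s)^α = (t - s)^(α-1) t (1 - s/t)` supplies the numerator of the Poisson kernel;
everything else separates into powers of `s`, `t`, `1 + s` and `1 + t`. -/
theorem density_mul_kernel {n : ℕ} (hn : 0 < n) {α s t : ℝ} (hs : 0 < s) (hst : s < t)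
    (ξ η : Sph n) :
    sliceDensity n s * ((height (slice t ξ) - height (slice s η)) ^ α /
      ‖(slice t ξ).1 - (slice s η).1‖ ^ n) =
    2 ^ (α - 1) * sigma n * ((1 + t) ^ ((n : ℝ) / 2 - α) * t ^ (1 - (n : ℝ) / 2)) *
      (ppow (α - 1) (t - s) * pker (√(s / t)) ξ.1 η.1) *
      ((1 + s) ^ (-((n : ℝ) / 2) - α) * s ^ ((n : ℝ) / 2 - 1)) := by
  have ht : 0 < t := hs.trans hst
  have hts : 0 < t - s := sub_pos.2 hst
  have hs1 : 0 < 1 + s := by linarith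
  have ht1 : 0 < 1 + t := by linarith
  obtain ⟨hr0, hr1⟩ := sqrt_div_mem hs.le hst
  have hσ := sigma_pos hn
  have hpk := pker_pos hn hr0 hr1 ξ η
  rw [height_slice_sub hs.le ht.le, norm_slice_sub hs ht, ppow_of_pos hts, sliceDensity, pker]
  have hr2 : √(s / t) ^ 2 = s / t := Real.sq_sqrt (by positivity)
  have hD : 0 < ‖√(s / t) • ξ.1 - η.1‖ := by
    refine lt_of_lt_of_le (sub_pos.2 hr1) ?_
    have h := norm_sub_norm_le η.1 (√(s / t) • ξ.1)
    rw [norm_smul, Real.norm_of_nonneg hr0, norm_sub_rev] at h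
    simpa using h
  generalize ‖√(s / t) • ξ.1 - η.1‖ = D at hD
  rw [hr2, Real.div_rpow (by positivity) (by positivity), Real.mul_rpow two_pos.le hts.le,
    Real.mul_rpow ht1.le hs1.le, div_pow, mul_pow, mul_pow, mul_pow]
  have e1 : ∀ x : ℝ, 0 < x → √x ^ n = x ^ ((n : ℝ) / 2) := fun x hx => by
    rw [Real.sqrt_eq_rpow, ← Real.rpow_mul_natCast hx.le]
    congr 1
    ring
  rw [e1 t ht, e1 _ ht1, e1 _ hs1, Real.rpow_sub_one two_ne_zero, Real.rpow_sub_one hts.ne',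
    Real.rpow_sub ht1, Real.rpow_sub ht, Real.rpow_one, Real.rpow_sub hs1, Real.rpow_neg hs1.le]
  have e2 : (1 + s) ^ n = (1 + s) ^ ((n : ℝ) / 2) * (1 + s) ^ ((n : ℝ) / 2) := by
    rw [← Real.rpow_add hs1, ← Real.rpow_natCast]
    congr 1
    ring
  obtain ⟨k, rfl⟩ : ∃ k, n = k + 1 := ⟨n - 1, by omega⟩
  rw [e2, Nat.add_sub_cancel, pow_succ (2 : ℝ) k]
  have := Real.rpow_pos_of_pos hs1 (((k + 1 : ℕ) : ℝ) / 2)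
  have := Real.rpow_pos_of_pos ht1 (((k + 1 : ℕ) : ℝ) / 2)
  have := Real.rpow_pos_of_pos ht (((k + 1 : ℕ) : ℝ) / 2)
  have := Real.rpow_pos_of_pos hs1 α
  have := Real.rpow_pos_of_pos ht1 α
  have := Real.rpow_pos_of_pos hts α
  have := Real.rpow_pos_of_pos two_pos α
  generalize (1 + s) ^ (((k + 1 : ℕ) : ℝ) / 2) = X1 at *
  generalize (1 + t) ^ (((k + 1 : ℕ) : ℝ) / 2) = X2 at *
  generalize t ^ (((k + 1 : ℕ) : ℝ) / 2) = X3 at *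
  generalize (1 + s) ^ α = X4 at *
  generalize (1 + t) ^ α = X5 at *
  generalize (t - s) ^ α = X6 at *
  generalize (2 : ℝ) ^ α = X7 at *
  generalize s ^ (((k + 1 : ℕ) : ℝ) / 2 - 1) = X8 at *
  have hts' : t - s ≠ 0 := hts.ne'
  field_simp

theorem measurable_fracIntegrand {n : ℕ} (α : ℝ) {φ : Sph (n + 1) → ℂ} (hφ : Measurable φ)
    (x : Sph (n + 1)) : Measurable (fracIntegrand α φ x) := by
  have h1 : Measurable fun y : Sph (n + 1) => (height x - height y) ^ α :=
    (measurable_const.sub measurable_height).pow_const α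
  have h2 : Measurable fun y : Sph (n + 1) => ‖x.1 - y.1‖ ^ n := by fun_prop
  exact (h1.div h2).smul hφ

theorem measurableSet_seg (n : ℕ) (a b : ℝ) : MeasurableSet (seg n a b) :=
  (measurableSet_lt measurable_const measurable_height).inter
    (measurableSet_lt measurable_height measurable_const)

theorem density_smul_indicator {n : ℕ} (hn : 0 < n) {α a : ℝ} (ha' : a < 1)
    (φ : Sph (n + 1) → ℂ) {s t : ℝ} (hs : 0 < s) (ht : 0 < t) (ξ η : Sph n) :
    sliceDensity n s • (seg n a (height (slice t ξ))).indicator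
      (fracIntegrand α φ (slice t ξ)) (slice s η) =
    (2 ^ (α - 1) * sigma n * ((1 + t) ^ ((n : ℝ) / 2 - α) * t ^ (1 - (n : ℝ) / 2))) •
      ((ppow (α - 1) (t - s) * pker (√(s / t)) ξ.1 η.1) • pullback α a φ s η) := by
  by_cases hst : s < t
  · by_cases hsa : (1 + a) / (1 - a) < s
    · rw [Set.indicator_of_mem ((slice_mem_seg ha' hs.le ht.le ξ η).2 ⟨hsa, hst⟩), pullback,
        if_pos hsa, fracIntegrand, smul_smul, smul_smul, smul_smul, density_mul_kernel hn hs hst ξ η]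
    · rw [Set.indicator_of_notMem (fun h => hsa ((slice_mem_seg ha' hs.le ht.le ξ η).1 h).1),
        pullback, if_neg hsa, smul_zero, smul_zero, smul_zero]
  · rw [Set.indicator_of_notMem (fun h => hst ((slice_mem_seg ha' hs.le ht.le ξ η).1 h).2),
      ppow_of_nonpos (by linarith), zero_mul, zero_smul, smul_zero, smul_zero]

theorem integrableOn_fracIntegrand {n : ℕ} (hn : 0 < n) {α a : ℝ} (ha' : a < 1)
    {φ : Sph (n + 1) → ℂ} (hφ : Measurable φ) {t : ℝ} (ht : 0 < t) {ξ : Sph n}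
    (hfin : capPotential α (pullback α a φ) t ξ ≠ ∞) :
    IntegrableOn (fracIntegrand α φ (slice t ξ)) (seg n a (height (slice t ξ))) (surf (n + 1)) := by
  rw [← integrable_indicator_iff (measurableSet_seg _ _ _), integrable_surf_iff hn
    ((measurable_fracIntegrand α hφ _).indicator (measurableSet_seg _ _ _))]
  refine ((integrable_potential_integrand hn (measurable_pullback α a hφ) le_rfl hfin).smul
    (2 ^ (α - 1) * sigma n * ((1 + t) ^ ((n : ℝ) / 2 - α) * t ^ (1 - (n : ℝ) / 2)))).congr ?_
  filter_upwards [ae_cyl_pos n] with p hp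
  exact (density_smul_indicator hn ha' φ hp ht ξ p.2).symm

theorem sphFrac_slice {n : ℕ} (hn : 0 < n) {α a : ℝ} (hα : 0 < α) (ha' : a < 1)
    {φ : Sph (n + 1) → ℂ} (hφ : Measurable φ) {t : ℝ} (ht : 0 < t) (ξ : Sph n) :
    sphFrac α a φ (slice t ξ) =
      potentialFactor n α t • potential α (pullback α a φ) t ξ := by
  have h1 : ∫ y in seg n a (height (slice t ξ)), fracIntegrand α φ (slice t ξ) y ∂(surf (n + 1)) =
      (2 ^ (α - 1) * sigma n * ((1 + t) ^ ((n : ℝ) / 2 - α) * t ^ (1 - (n : ℝ) / 2))) •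
        potential α (pullback α a φ) t ξ := by
    rw [← integral_indicator (measurableSet_seg _ _ _), integral_surf_slice hn
      ((measurable_fracIntegrand α hφ _).indicator (measurableSet_seg _ _ _)), potential,
      ← integral_smul]
    refine integral_congr_ae ?_
    filter_upwards [ae_cyl_pos n] with p hp using density_smul_indicator hn ha' φ hp ht ξ p.2
  rw [sphFrac, h1, smul_smul, potentialFactor]
  congr 1
  have hσ := (sigma_pos hn).ne'
  have hΓ := (Real.Gamma_pos_of_pos hα).ne'
  rw [Real.rpow_sub_one two_ne_zero]
  field_simp

/-- Extension by zero agrees with the potential formula below the cap as well: there every `s < t`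
lies outside the support of `pullback`, so the potential vanishes. -/
theorem zeroExt_sphFrac_slice {n : ℕ} (hn : 0 < n) {α a : ℝ} (hα : 0 < α) (ha' : a < 1)
    {φ : Sph (n + 1) → ℂ} (hφ : Measurable φ) {t : ℝ} (ht : 0 < t) (ξ : Sph n) :
    zeroExt a (sphFrac α a φ) (slice t ξ) =
      potentialFactor n α t • potential α (pullback α a φ) t ξ := by
  by_cases hta : (1 + a) / (1 - a) < t
  · rw [zeroExt, Set.indicator_of_mem ((slice_mem_cap ha' ht.le ξ).2 hta),
      sphFrac_slice hn hα ha' hφ ht]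
  · rw [zeroExt, Set.indicator_of_notMem (fun h => hta ((slice_mem_cap ha' ht.le ξ).1 h)), potential]
    have : ∀ p : ℝ × Sph n, (ppow (α - 1) (t - p.1) * pker (√(p.1 / t)) ξ.1 p.2.1) •
        pullback α a φ p.1 p.2 = 0 := fun p => by
      by_cases hp : p.1 < t
      · rw [pullback, if_neg (fun h => hta (h.trans hp)), smul_zero]
      · rw [ppow_of_nonpos (by linarith), zero_mul, zero_smul]
    simp_rw [this]
    simp

theorem poisson_eq_pint {n : ℕ} (ψ : Sph n → ℂ) (ξ : Sph n) (r : ℝ) :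
    poisson ψ ξ.1 r = pint ψ r ξ := by
  rw [poisson, pint, ← integral_smul]
  refine integral_congr_ae (Eventually.of_forall fun η => ?_)
  simp only [pker]
  rw [smul_smul]

theorem Aplus_zero {n : ℕ} (hn : 0 < n) {α a : ℝ} (hα : 0 < α) (ha' : a < 1)
    {φ : Sph (n + 1) → ℂ} (hφ : Measurable φ) {t : ℝ} (ht : 0 < t) (ξ : Sph n) :
    Aplus α (zeroExt a (sphFrac α a φ)) (slice t ξ) 0 =
      (2 ^ α / Real.Gamma α * t ^ (1 - (n : ℝ) / 2)) • potential α (pullback α a φ) t ξ := by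
  have ht1 : 0 < 1 + t := by linarith
  rw [Aplus, if_pos rfl, tsq_slice ht.le, zeroExt_sphFrac_slice hn hα ha' hφ ht, smul_smul,
    potentialFactor]
  congr 1
  have e : (1 + t) ^ (α - (n : ℝ) / 2) * (1 + t) ^ ((n : ℝ) / 2 - α) = 1 := by
    rw [← Real.rpow_add ht1]
    simp
  linear_combination (2 ^ α / Real.Gamma α * t ^ (1 - (n : ℝ) / 2)) * e

/-- The powers in `Aplus` are chosen to cancel `potentialFactor` at the level `t - u`, leaving a
factor independent of `u`, the same as at `u = 0`. -/
theorem Aplus_neg {n : ℕ} (hn : 0 < n) {α a : ℝ} (hα : 0 < α) (ha' : a < 1)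
    {φ : Sph (n + 1) → ℂ} (hφ : Measurable φ) {u t : ℝ} (hu : 0 < u) (hut : u < t) (ξ : Sph n) :
    Aplus α (zeroExt a (sphFrac α a φ)) (slice t ξ) (-u) =
      (2 ^ α / Real.Gamma α * t ^ (1 - (n : ℝ) / 2)) •
        pint (potential α (pullback α a φ) (t - u)) (√((t - u) / t)) ξ := by
  have ht : 0 < t := hu.trans hut
  have hw : 0 < t - u := sub_pos.2 hut
  have hw1 : 0 < 1 + (t - u) := by linarith
  have e0 : 1 + -u / t = (t - u) / t := by field_simp; ring
  have e1 : pint (fun η => zeroExt a (sphFrac α a φ) (slice (t - u) η)) (√((t - u) / t)) ξ =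
      potentialFactor n α (t - u) • pint (potential α (pullback α a φ) (t - u)) (√((t - u) / t)) ξ := by
    rw [pint, pint, ← integral_smul]
    refine integral_congr_ae (Eventually.of_forall fun η => ?_)
    simp only
    rw [zeroExt_sphFrac_slice hn hα ha' hφ hw, smul_comm]
  rw [Aplus, if_neg (neg_ne_zero.2 hu.ne'), tsq_slice ht.le, if_pos ⟨by linarith, by linarith⟩,
    dir_slice ht, poisson_eq_pint, e0, ← sub_eq_add_neg, add_sub_assoc]
  simp only [slice] at e1
  simp only [← sub_eq_add_neg]
  rw [e1, smul_smul, potentialFactor]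
  congr 1
  rw [Real.div_rpow hw.le ht.le]
  have e2 : (1 + (t - u)) ^ (α - (n : ℝ) / 2) * (1 + (t - u)) ^ ((n : ℝ) / 2 - α) = 1 := by
    rw [← Real.rpow_add hw1]
    simp
  have e3 : (t - u) ^ ((n : ℝ) / 2 - 1) * (t - u) ^ (1 - (n : ℝ) / 2) = 1 := by
    rw [← Real.rpow_add hw]
    simp
  have e4 : t ^ (1 - (n : ℝ) / 2) = (t ^ ((n : ℝ) / 2 - 1))⁻¹ := by
    rw [← Real.rpow_neg ht.le]
    congr 1
    ring
  rw [e4, div_eq_mul_inv]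
  generalize (1 + (t - u)) ^ (α - (n : ℝ) / 2) = X1 at *
  generalize (1 + (t - u)) ^ ((n : ℝ) / 2 - α) = X2 at *
  generalize (t - u) ^ ((n : ℝ) / 2 - 1) = X3 at *
  generalize (t - u) ^ (1 - (n : ℝ) / 2) = X4 at *
  generalize (t ^ ((n : ℝ) / 2 - 1))⁻¹ = X5 at *
  linear_combination (X5 * (2 ^ α / Real.Gamma α)) * (X3 * X4 * e2 + e3)

theorem Aplus_neg_of_le {n : ℕ} (α : ℝ) (f : Sph (n + 1) → ℂ) {u t : ℝ} (ht : 0 < t) (hut : t ≤ u)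
    (ξ : Sph n) : Aplus α f (slice t ξ) (-u) = 0 := by
  rw [Aplus, if_neg (by linarith), tsq_slice ht.le, if_neg (fun h => by linarith [h.1])]

/-- The truncated hypersingular integrals invert the fractional integral at every point satisfying
the finiteness and the Lebesgue point conditions. -/
theorem inversion_at {n : ℕ} (hn : 0 < n) {α a : ℝ} (hα : 0 < α) {l : ℕ} (hl : α < l) (ha' : a < 1)
    {φ : Sph (n + 1) → ℂ} (hφ : Measurable φ) {t : ℝ} (ht : 0 < t) {ξ : Sph n}
    (hcap : ∀ N : ℕ, ∫⁻ s in Set.Ioo (0 : ℝ) N, capMax (fun η => ‖pullback α a φ s η‖ₑ) ξ ≠ ∞)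
    (hpot : capPotential α (pullback α a φ) t ξ ≠ ∞)
    (hleb : Tendsto (fun δ : ℝ => (∫⁻ y in Set.Ioc 0 δ,
      ‖profile (pullback α a φ) t ξ y - pullback α a φ t ξ‖ₑ) / ENNReal.ofReal δ) (𝓝[>] 0) (𝓝 0)) :
    (∀ ε : ℝ, 0 < ε → IntegrableOn
      (marchaudIntegrand α l (zeroExt a (sphFrac α a φ)) (slice t ξ)) (Set.Ioi ε)) ∧
    Tendsto (fun ε : ℝ => Tplus α l ε (zeroExt a (sphFrac α a φ)) (slice t ξ)) (𝓝[>] 0)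
      (𝓝 (((1 + t) ^ (α + (n : ℝ) / 2) * t ^ (1 - (n : ℝ) / 2)) • pullback α a φ t ξ)) := by
  have hg := measurable_pullback (n := n) α a hφ
  set g := pullback α a φ
  set f := zeroExt a (sphFrac α a φ)
  set K : ℝ := 2 ^ α / Real.Gamma α * t ^ (1 - (n : ℝ) / 2)
  have hA0 : Aplus α f (slice t ξ) 0 =
      K • ∫ y in Set.Ioi (0 : ℝ), ppow (α - 1) y • profile g t ξ y := by
    rw [Aplus_zero hn hα ha' hφ ht, potential, integral_potential_integrand hn hg le_rfl hpot,
      integral_ppow_smul_pint_eq α _ le_rfl]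
    simp_rw [sub_self, sub_zero]
    rfl
  have hA : ∀ᵐ u : ℝ, 0 < u → Aplus α f (slice t ξ) (-u) =
      K • ∫ y in Set.Ioi (0 : ℝ), ppow (α - 1) (y - u) • profile g t ξ y := by
    -- For the given direction `ξ`, the maximal potential is finite at almost every level `t - u`;
    -- at those levels the semigroup formula for potentials is available.
    filter_upwards [ae_volume_of_ae_Ioi (ae_capPotential_ne_top_left hα hg hcap) t] with u hu hu0
    by_cases hut : u < t
    · rw [Aplus_neg hn hα ha' hφ hu0 hut, pint_potential hn hg (sub_pos.2 hut)
        (sub_lt_self t hu0) (hu hut), integral_ppow_smul_pint_eq α _ (sub_le_self t hu0.le)]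
      simp_rw [sub_sub_cancel]
      rfl
    · rw [Aplus_neg_of_le α f ht (not_lt.1 hut)]
      have : ∀ y, ppow (α - 1) (y - u) • profile g t ξ y = 0 := fun y => by
        by_cases hy : y < t
        · rw [ppow_of_nonpos (by linarith), zero_smul]
        · rw [profile, if_neg (fun h => hy h.2), smul_zero]
      simp_rw [this]
      simp
  obtain ⟨h1, h2⟩ := marchaud_inversion hα hl (measurable_profile hg t ξ)
    (lintegral_profile_ne_top hn hg hcap t) (integrableOn_rpow_smul_profile hn hg hpot) hleb hA0 hA
  refine ⟨h1, ?_⟩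
  have h3 := h2.const_smul ((2 : ℝ) ^ (-α) / kappa α l * (1 + tsq (slice t ξ)) ^ (α + (n : ℝ) / 2))
  rw [smul_smul, tsq_slice ht.le] at h3
  have hc : (2 : ℝ) ^ (-α) / kappa α l * (1 + t) ^ (α + (n : ℝ) / 2) *
      (K * (Real.Gamma α * kappa α l)) = (1 + t) ^ (α + (n : ℝ) / 2) * t ^ (1 - (n : ℝ) / 2) := by
    have hΓ := (Real.Gamma_pos_of_pos hα).ne'
    have hκ := (kappa_pos hα hl).ne'
    have h2 : (2 : ℝ) ^ α ≠ 0 := (Real.rpow_pos_of_pos two_pos α).ne'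
    simp only [K]
    rw [Real.rpow_neg two_pos.le]
    field_simp
  rw [hc] at h3
  refine h3.congr fun ε => ?_
  rw [Tplus, tsq_slice ht.le]
  rfl

theorem smul_pullback {n : ℕ} {α a : ℝ} (φ : Sph (n + 1) → ℂ) {t : ℝ} (ht : 0 < t)
    (hta : (1 + a) / (1 - a) < t) (ξ : Sph n) :
    ((1 + t) ^ (α + (n : ℝ) / 2) * t ^ (1 - (n : ℝ) / 2)) • pullback α a φ t ξ = φ (slice t ξ) := by
  have ht1 : 0 < 1 + t := by linarith
  rw [pullback, if_pos hta, smul_smul]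
  have e1 : (1 + t) ^ (α + (n : ℝ) / 2) * (1 + t) ^ (-((n : ℝ) / 2) - α) = 1 := by
    rw [← Real.rpow_add ht1, show α + (n : ℝ) / 2 + (-((n : ℝ) / 2) - α) = 0 by ring,
      Real.rpow_zero]
  have e2 : t ^ (1 - (n : ℝ) / 2) * t ^ ((n : ℝ) / 2 - 1) = 1 := by
    rw [← Real.rpow_add ht, show 1 - (n : ℝ) / 2 + ((n : ℝ) / 2 - 1) = 0 by ring, Real.rpow_zero]
  rw [mul_mul_mul_comm, e1, e2, one_mul, one_smul]

/-- Integrating the pointwise bound by `capPotential` over the sphere and exchanging leaves the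
fractional integral of the slice norms `v` of the maximal function, which are locally integrable in
`s`. -/
theorem ae_integrable_potential {n : ℕ} (hn : 0 < n) {α : ℝ} (hα : 0 < α) {q : ℝ} (hq : 1 < q)
    {g : ℝ → Sph n → ℂ} (hg : Measurable (Function.uncurry g))
    (hgq : ∀ N : ℕ, ∫⁻ s in Set.Ioo (0 : ℝ) N, ∫⁻ η, ‖g s η‖ₑ ^ q ∂(surf n) ≠ ∞) :
    ∀ᵐ t ∂(volume.restrict (Set.Ioi (0 : ℝ))), Integrable (potential α g t) (surf n) := by
  obtain ⟨C, -, hC⟩ := exists_lintegral_pker_le_capMax hn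
  obtain ⟨C', -, hC'⟩ := exists_lintegral_capMax_le hn hq
  have hmc : Measurable fun p : ℝ × Sph n => capMax (fun η => ‖g p.1 η‖ₑ) p.2 :=
    measurable_capMax (W := fun s η => ‖g s η‖ₑ) hg.enorm
  set v : ℝ → ℝ≥0∞ := fun s => ∫⁻ ξ, capMax (fun η => ‖g s η‖ₑ) ξ ∂(surf n)
  have hv : Measurable v := hmc.lintegral_prod_right'
  have hvfin : ∀ N : ℕ, ∫⁻ s in Set.Ioo (0 : ℝ) N, v s ≠ ∞ := fun N => by
    refine ne_top_of_le_ne_top ?_ (lintegral_mono fun s =>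
      hC' (fun η => ‖g s η‖ₑ) (hg.comp measurable_prodMk_left).enorm)
    rw [lintegral_const_mul' _ _ ENNReal.ofReal_ne_top, lintegral_add_left measurable_const]
    exact ENNReal.mul_ne_top ENNReal.ofReal_ne_top (ENNReal.add_ne_top.2 ⟨by simp, hgq N⟩)
  filter_upwards [ae_lintegral_ppow_mul_ne_top hα hv hvfin, ae_restrict_mem measurableSet_Ioi]
    with t ht ht0
  have hm : Measurable (potential α g t) := by
    refine StronglyMeasurable.measurable (StronglyMeasurable.integral_prod_right
      (f := fun (ξ : Sph n) (p : ℝ × Sph n) =>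
        (ppow (α - 1) (t - p.1) * pker (√(p.1 / t)) ξ.1 p.2.1) • g p.1 p.2) ?_)
    exact (measurable_potential_integrand α hg t t).stronglyMeasurable
  refine ⟨hm.aestronglyMeasurable, ?_⟩
  have hle : ∀ ξ, ‖potential α g t ξ‖ₑ ≤ ENNReal.ofReal C * capPotential α g t ξ := fun ξ => by
    refine (enorm_integral_le_lintegral_enorm _).trans (le_trans (le_of_eq (lintegral_congr_ae ?_))
      (lintegral_potential_integrand_le hg hC le_rfl ξ))
    filter_upwards [ae_cyl_pos n] with p hp using enorm_potential_integrand hn α _ hp le_rfl ξ p.2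
  refine lt_of_le_of_lt (lintegral_mono hle) ?_
  rw [lintegral_const_mul' _ _ ENNReal.ofReal_ne_top]
  refine ENNReal.mul_lt_top ENNReal.ofReal_lt_top ?_
  have hms : Measurable fun q : Sph n × ℝ =>
      ENNReal.ofReal (ppow (α - 1) (t - q.2)) * capMax (fun η => ‖g q.2 η‖ₑ) q.1 := by
    refine Measurable.mul ?_ ?_
    · exact ((measurable_ppow (α - 1)).comp (measurable_const.sub measurable_snd)).ennreal_ofReal
    · have h2 := hmc.comp (measurable_swap : Measurable (Prod.swap : Sph n × ℝ → ℝ × Sph n))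
      exact h2
  unfold capPotential
  rw [lintegral_lintegral_swap hms.aemeasurable]
  refine lt_of_le_of_lt (le_of_eq ?_) ht.lt_top
  refine lintegral_congr fun s => ?_
  rw [lintegral_const_mul' _ _ ENNReal.ofReal_ne_top]

/-- The exceptional radii are square roots of exceptional `s`, and the square root, differentiable
on the open half-line, maps null sets to null sets. This passes from `s = r²` to the radius `r`. -/
theorem ae_comp_sq {P : ℝ → Prop} (h : ∀ᵐ s ∂(volume.restrict (Set.Ioi (0 : ℝ))), P s) :
    ∀ᵐ r ∂(volume.restrict (Set.Ioi (0 : ℝ))), P (r ^ 2) := by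
  rw [ae_restrict_iff' measurableSet_Ioi, ae_iff] at h ⊢
  have hd : DifferentiableOn ℝ Real.sqrt {s : ℝ | ¬(s ∈ Set.Ioi (0 : ℝ) → P s)} := fun s hs => by
    have hs0 : s ∈ Set.Ioi (0 : ℝ) := (Classical.not_imp.1 hs).1
    exact (Real.hasDerivAt_sqrt (ne_of_gt hs0)).differentiableAt.differentiableWithinAt
  have hz := addHaar_image_eq_zero_of_differentiableOn_of_addHaar_eq_zero volume hd h
  refine measure_mono_null ?_ hz
  intro r hr
  obtain ⟨h0, h1⟩ := Classical.not_imp.1 hr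
  have h0' : (0 : ℝ) < r := h0
  exact ⟨r ^ 2, fun h2 => h1 (h2 (pow_pos h0' 2)), Real.sqrt_sq h0'.le⟩

theorem ae_integrable_zeroExt_sphFrac {n : ℕ} (hn : 0 < n) {α a : ℝ} (hα : 0 < α) (ha' : a < 1)
    {q : ℝ} (hq : 1 < q) {φ : Sph (n + 1) → ℂ} (hφ : Measurable φ)
    (hgq : ∀ N : ℕ, ∫⁻ s in Set.Ioo (0 : ℝ) N,
      ∫⁻ η, ‖pullback α a φ s η‖ₑ ^ q ∂(surf n) ≠ ∞) :
    ∀ᵐ r : ℝ ∂(volume.restrict (Set.Ioi 0)),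
      Integrable (fun η => zeroExt a (sphFrac α a φ) (polar (2 * Real.arctan r) η)) (surf n) := by
  filter_upwards [ae_comp_sq (ae_integrable_potential hn hα hq (measurable_pullback α a hφ) hgq),
    ae_restrict_mem measurableSet_Ioi] with r hr hr0
  have hr0' : (0 : ℝ) < r := hr0
  have h1 := hr.smul (potentialFactor n α (r ^ 2))
  refine h1.congr (Eventually.of_forall fun η => ?_)
  have h2 := zeroExt_sphFrac_slice hn hα ha' hφ (pow_pos hr0' 2) η
  rw [slice, Real.sqrt_sq hr0'.le] at h2
  exact h2.symm

/-! ### Weighted `L^p` functions on the cap and the conclusion. -/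

instance (n : ℕ) (a : ℝ) : IsFiniteMeasure (capMeasure n a) := by
  unfold capMeasure
  infer_instance

theorem height_le_one {n : ℕ} (x : Sph (n + 1)) : height x ≤ 1 := by
  have h := PiLp.norm_apply_le x.1 (Fin.last n)
  have hx : ‖x.1‖ = 1 := by simp
  rw [hx] at h
  exact (le_abs_self _).trans h

theorem seg_height_subset {n : ℕ} (a : ℝ) (x : Sph (n + 1)) : seg n a (height x) ⊆ seg n a 1 :=
  fun _ hy => ⟨hy.1, hy.2.trans_le (height_le_one x)⟩

/-- All factors are continuous and positive on the open half-line, so their quotient is bounded on a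
compact interval. -/
theorem exists_weight_le {n : ℕ} {q : ℝ} (α ν : ℝ) {b : ℝ} (hb : 0 < b) (N : ℕ) :
    ∃ B : ℝ, ∀ s ∈ Set.Icc b (N : ℝ),
      ((1 + s) ^ (-((n : ℝ) / 2) - α) * s ^ ((n : ℝ) / 2 - 1)) ^ q ≤
        B * (sliceDensity n s * ((2 / (1 + s)) ^ ν) ^ q) := by
  have hsub : Set.Icc b (N : ℝ) ⊆ Set.Ioi 0 := fun s hs => hb.trans_le hs.1
  have h1 : ∀ e : ℝ, ContinuousOn (fun s : ℝ => (1 + s) ^ e) (Set.Ioi 0) := fun e =>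
    ContinuousOn.rpow_const (by fun_prop) fun s hs => .inl (by linarith [show (0 : ℝ) < s from hs])
  have h2 : ∀ e : ℝ, ContinuousOn (fun s : ℝ => s ^ e) (Set.Ioi 0) := fun e =>
    ContinuousOn.rpow_const (by fun_prop) fun s hs => .inl (ne_of_gt hs)
  have h3 : ContinuousOn (fun s : ℝ => 2 / (1 + s)) (Set.Ioi 0) :=
    ContinuousOn.div (by fun_prop) (by fun_prop) fun s hs => by
      linarith [show (0 : ℝ) < s from hs]
  have hpos : ∀ s ∈ Set.Ioi (0 : ℝ), 0 < sliceDensity n s * ((2 / (1 + s)) ^ ν) ^ q := fun s hs => by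
    have hs0 : (0 : ℝ) < s := hs
    have := sliceDensity_pos (n := n) hs0
    positivity
  have hJ : ContinuousOn (sliceDensity n) (Set.Ioi 0) := by
    refine ContinuousOn.div (continuousOn_const.mul (h2 _)) (by fun_prop) fun s hs => ?_
    have hs0 : (0 : ℝ) < s := hs
    positivity
  have hden : ContinuousOn (fun s : ℝ => sliceDensity n s * ((2 / (1 + s)) ^ ν) ^ q) (Set.Ioi 0) := by
    refine hJ.mul (ContinuousOn.rpow_const (ContinuousOn.rpow_const h3 fun s hs => .inl ?_)
      fun s hs => .inl ?_)
    all_goals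
      have hs0 : (0 : ℝ) < s := hs
      positivity
  have hnum : ContinuousOn (fun s : ℝ =>
      ((1 + s) ^ (-((n : ℝ) / 2) - α) * s ^ ((n : ℝ) / 2 - 1)) ^ q) (Set.Ioi 0) := by
    refine ContinuousOn.rpow_const ((h1 _).mul (h2 _)) fun s hs => .inl ?_
    have hs0 : (0 : ℝ) < s := hs
    positivity
  have hF := (hnum.div hden fun s hs => (hpos s hs).ne').mono hsub
  obtain ⟨B, hB⟩ := isCompact_Icc.exists_bound_of_continuousOn hF
  refine ⟨B, fun s hs => ?_⟩
  have h := (le_abs_self _).trans (hB s hs)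
  exact (div_le_iff₀ (hpos s (hsub hs))).1 h

theorem one_sub_height_slice {n : ℕ} {s : ℝ} (hs : 0 ≤ s) (η : Sph n) :
    1 - height (slice s η) = 2 / (1 + s) := by
  have : 1 + s ≠ 0 := by linarith
  rw [height_slice hs]
  field_simp
  ring

/-- Weighted `L^p` functions on the cap are locally in `L^q`, `q = min(p, 2)`, in the coordinates
`(tan²(θ/2), ξ')`. -/
theorem exists_lintegral_pullback_ne_top {n : ℕ} (hn : 0 < n) {a : ℝ} (ha : -1 < a) (ha' : a < 1)
    {p : ℝ≥0∞} (hp : 1 < p) (α ν : ℝ) {φ : Sph (n + 1) → ℂ} (hφ : Measurable φ)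
    (hφp : MemLp (fun x => ((1 - height x) ^ ν : ℝ) • φ x) p (capMeasure n a)) :
    ∃ q : ℝ, 1 < q ∧ ∀ N : ℕ, ∫⁻ s in Set.Ioo (0 : ℝ) N,
      ∫⁻ η, ‖pullback α a φ s η‖ₑ ^ q ∂(surf n) ≠ ∞ := by
  -- Lowering the exponent to `min(p, 2)`, allowed on a space of finite measure, covers `p = ∞` by a
  -- finite exponent that is still greater than `1`.
  have hp2 : min p 2 ≠ ∞ := ne_top_of_le_ne_top (by simp) (min_le_right p 2)
  have hp1 : 1 < min p 2 := lt_min hp (by norm_num)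
  set q : ℝ := (min p 2).toReal
  have hq : 1 < q := by
    rw [← ENNReal.toReal_one]
    exact ENNReal.toReal_strict_mono hp2 hp1
  have hq0 : 0 < q := one_pos.trans hq
  refine ⟨q, hq, fun N => ?_⟩
  have hmem := hφp.mono_exponent (min_le_left p 2)
  have hfin := lintegral_rpow_enorm_lt_top_of_eLpNorm_lt_top (one_pos.trans hp1).ne' hp2 hmem.2
  set Ψ : Sph (n + 1) → ℝ≥0∞ := (seg n a 1).indicator
    fun x => ‖((1 - height x) ^ ν : ℝ) • φ x‖ₑ ^ q
  have hΨ : Measurable Ψ := by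
    refine Measurable.indicator ?_ (measurableSet_seg n a 1)
    have h1 : Measurable fun x : Sph (n + 1) => (1 - height x) ^ ν :=
      (measurable_const.sub measurable_height).pow_const ν
    exact (h1.smul hφ).enorm.pow_const q
  have hΨfin : ∫⁻ x, Ψ x ∂(surf (n + 1)) ≠ ∞ := by
    rw [lintegral_indicator (measurableSet_seg n a 1)]
    exact hfin.ne
  rw [lintegral_surf_slice hn hΨ] at hΨfin
  -- The boundary of the cap is at `s = b > 0`, so the support of `pullback` stays away from `s =
  -- 0`. Together with `s < N` this confines `s` to a compact subset of the half-line.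
  set b : ℝ := (1 + a) / (1 - a)
  have hb : 0 < b := div_pos (by linarith) (by linarith)
  obtain ⟨B, hB⟩ := exists_weight_le (n := n) (q := q) α ν hb N
  have hle : ∀ s ∈ Set.Ioo (0 : ℝ) N, ∫⁻ η, ‖pullback α a φ s η‖ₑ ^ q ∂(surf n) ≤
      ENNReal.ofReal B * (ENNReal.ofReal (sliceDensity n s) * ∫⁻ η, Ψ (slice s η) ∂(surf n)) := by
    intro s hs
    have hs0 : 0 < s := hs.1
    rw [← lintegral_const_mul' _ _ ENNReal.ofReal_ne_top,
      ← lintegral_const_mul' _ _ ENNReal.ofReal_ne_top]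
    refine lintegral_mono fun η => ?_
    by_cases hsb : b < s
    · have hJ := sliceDensity_pos (n := n) hs0
      have hs1 : 0 < 1 + s := by linarith
      simp only [Ψ]
      rw [pullback, if_pos hsb, Set.indicator_of_mem ((slice_mem_cap ha' hs0.le η).2 hsb),
        one_sub_height_slice hs0.le, enorm_smul, enorm_smul, Real.enorm_of_nonneg (by positivity),
        Real.enorm_of_nonneg (by positivity), ENNReal.mul_rpow_of_nonneg _ _ hq0.le,
        ENNReal.mul_rpow_of_nonneg _ _ hq0.le, ENNReal.ofReal_rpow_of_nonneg (by positivity) hq0.le,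
        ENNReal.ofReal_rpow_of_nonneg (by positivity) hq0.le, ← mul_assoc, ← mul_assoc]
      refine mul_le_mul' ?_ le_rfl
      have h := hB s ⟨hsb.le, hs.2.le⟩
      rw [mul_assoc, ← ENNReal.ofReal_mul hJ.le, ← ENNReal.ofReal_mul' (by positivity)]
      exact ENNReal.ofReal_le_ofReal h
    · rw [pullback, if_neg hsb, enorm_zero, ENNReal.zero_rpow_of_pos hq0]
      exact zero_le
  refine ne_top_of_le_ne_top ?_ (setLIntegral_mono' measurableSet_Ioo hle)
  rw [lintegral_const_mul' _ _ ENNReal.ofReal_ne_top]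
  refine ENNReal.mul_ne_top ENNReal.ofReal_ne_top (ne_top_of_le_ne_top hΨfin ?_)
  exact lintegral_mono_set Set.Ioo_subset_Ioi_self

theorem ae_capMeasure_of_ae_cyl {n : ℕ} (hn : 0 < n) {a : ℝ} {P : Sph (n + 1) → Prop}
    (h : ∀ᵐ p ∂(cyl n), P (slice p.1 p.2)) : ∀ᵐ x ∂(capMeasure n a), P x :=
  ae_restrict_of_ae ((ae_surf_iff hn).2 h)

theorem inversion_of_measurable {n : ℕ} (hn : 0 < n) {α : ℝ} (hα : 0 < α) {l : ℕ} (hl : α < l)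
    {a : ℝ} (ha : -1 < a) (ha' : a < 1) {p : ℝ≥0∞} (hp : 1 < p) (ν : ℝ) {φ : Sph (n + 1) → ℂ}
    (hφ : Measurable φ)
    (hφp : MemLp (fun x => ((1 - height x) ^ ν : ℝ) • φ x) p (capMeasure n a)) :
    (∀ᵐ x ∂(capMeasure n a), IntegrableOn (fracIntegrand α φ x) (seg n a (height x))
      (surf (n + 1))) ∧
    (∀ᵐ r : ℝ ∂(volume.restrict (Set.Ioi 0)),
      Integrable (fun η => zeroExt a (sphFrac α a φ) (polar (2 * Real.arctan r) η)) (surf n)) ∧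
    (∀ᵐ x ∂(capMeasure n a), ∀ ε : ℝ, 0 < ε →
      IntegrableOn (marchaudIntegrand α l (zeroExt a (sphFrac α a φ)) x) (Set.Ioi ε)) ∧
    (∀ᵐ x ∂(capMeasure n a),
      Tendsto (fun ε : ℝ => TaPlus α l a ε (sphFrac α a φ) x) (𝓝[>] 0) (𝓝 (φ x))) := by
  obtain ⟨q, hq, hgq⟩ := exists_lintegral_pullback_ne_top hn ha ha' hp α ν hφ hφp
  have hg := measurable_pullback (n := n) α a hφ
  have h0 : ∀ s ≤ 0, ∀ η : Sph n, pullback α a φ s η = 0 := fun s hs η => by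
    have hb : 0 < (1 + a) / (1 - a) := div_pos (by linarith) (by linarith)
    rw [pullback, if_neg (by linarith)]
  have hcap := ae_lintegral_capMax_ne_top hn hq hg hgq
  have hcap' : ∀ᵐ p ∂(cyl n), ∀ N : ℕ,
      ∫⁻ s in Set.Ioo (0 : ℝ) N, capMax (fun η => ‖pullback α a φ s η‖ₑ) p.2 ≠ ∞ :=
    Measure.quasiMeasurePreserving_snd.ae hcap
  have hpot := ae_capPotential_ne_top hα hg hcap
  have hinv := (hcap'.and (hpot.and (ae_tendsto_average_profile hn hq hg h0 hgq))).and (ae_cyl_pos n)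
  refine ⟨ae_capMeasure_of_ae_cyl hn ?_, ae_integrable_zeroExt_sphFrac hn hα ha' hq hφ hgq,
    ae_capMeasure_of_ae_cyl hn ?_, ?_⟩
  · filter_upwards [hinv] with p h
    exact integrableOn_fracIntegrand hn ha' hφ h.2 h.1.2.1
  · filter_upwards [hinv] with p h
    exact (inversion_at hn hα hl ha' hφ h.2 h.1.1 h.1.2.1 h.1.2.2).1
  · rw [capMeasure, ae_restrict_iff' (measurableSet_seg n a 1), ae_surf_iff hn]
    filter_upwards [hinv] with p h hp
    have h1 := (inversion_at hn hα hl ha' hφ h.2 h.1.1 h.1.2.1 h.1.2.2).2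
    rw [smul_pullback φ h.2 ((slice_mem_cap ha' h.2.le p.2).1 hp)] at h1
    refine h1.congr fun ε => ?_
    rw [TaPlus, restr, Set.indicator_of_mem hp]

theorem aestronglyMeasurable_of_weight {n : ℕ} {a ν : ℝ} {φ : Sph (n + 1) → ℂ}
    (h : AEStronglyMeasurable (fun x => ((1 - height x) ^ ν : ℝ) • φ x) (capMeasure n a)) :
    AEStronglyMeasurable φ (capMeasure n a) := by
  have h1 : Measurable fun x : Sph (n + 1) => (1 - height x) ^ (-ν) :=
    (measurable_const.sub measurable_height).pow_const _
  refine (h1.aestronglyMeasurable.smul h).congr ?_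
  filter_upwards [ae_restrict_mem (measurableSet_seg n a 1)] with x hx
  have hx1 : 0 < 1 - height x := sub_pos.2 hx.2
  simp only [Pi.smul_apply']
  rw [smul_smul, ← Real.rpow_add hx1, neg_add_cancel, Real.rpow_zero, one_smul]

end SphFrac

/-- For `φ ∈ L^p(⟨a, 1⟩_S; (1 - x_{n+1})^ν)`: the integral `S^α_{a+} φ` exists a.e. on the cap, all
Poisson integrals and truncated integrals in `T^α_{a+,ε} S^α_{a+} φ` exist (for almost all radii,
respectively for almost all `x` and all `ε > 0`), and `T^α_{a+,ε} S^α_{a+} φ → φ` a.e. on the cap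
as `ε → 0+`. -/
theorem mainTheorem12 (n : ℕ) (hn : 2 ≤ n) (α : ℝ) (hα : 0 < α) (l : ℕ) (hl : α < (l : ℝ))
    (a : ℝ) (ha : -1 < a) (ha' : a < 1) (p : ℝ≥0∞) (hp : 1 < p)
    (ν : ℝ) (hν : ν < (n : ℝ) / 2 * (1 - (p⁻¹).toReal))
    (φ : SphFrac.Sph (n + 1) → ℂ)
    (hφ : MemLp (fun x => ((1 - SphFrac.height x) ^ ν : ℝ) • φ x) p (SphFrac.capMeasure n a)) :
    (∀ᵐ x ∂(SphFrac.capMeasure n a),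
      IntegrableOn (SphFrac.fracIntegrand α φ x) (SphFrac.seg n a (SphFrac.height x))
        (SphFrac.surf (n + 1))) ∧
    (∀ᵐ r : ℝ ∂(volume.restrict (Set.Ioi 0)),
      Integrable (fun η => SphFrac.zeroExt a (SphFrac.sphFrac α a φ)
        (SphFrac.polar (2 * Real.arctan r) η)) (SphFrac.surf n)) ∧
    (∀ᵐ x ∂(SphFrac.capMeasure n a), ∀ ε : ℝ, 0 < ε →
      IntegrableOn
        (SphFrac.marchaudIntegrand α l (SphFrac.zeroExt a (SphFrac.sphFrac α a φ)) x)
        (Set.Ioi ε)) ∧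
    (∀ᵐ x ∂(SphFrac.capMeasure n a),
      Tendsto (fun ε : ℝ => SphFrac.TaPlus α l a ε (SphFrac.sphFrac α a φ) x)
        (𝓝[>] 0) (𝓝 (φ x))) := by
  have hn0 : 0 < n := by omega
  have hm := SphFrac.aestronglyMeasurable_of_weight hφ.1
  -- The coordinate computations need a Borel function. Changing `φ` on a null subset of the cap
  -- leaves `sphFrac α a φ` unchanged at every point, since each segment of integration lies in the
  -- cap.
  set φ₁ := hm.mk φ
  have hφ₁ : Measurable φ₁ := hm.stronglyMeasurable_mk.measurable
  have hae : φ =ᵐ[SphFrac.capMeasure n a] φ₁ := hm.ae_eq_mk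
  have hseg : ∀ x : SphFrac.Sph (n + 1), SphFrac.fracIntegrand α φ₁ x
      =ᵐ[(SphFrac.surf (n + 1)).restrict (SphFrac.seg n a (SphFrac.height x))]
      SphFrac.fracIntegrand α φ x := fun x => by
    have h := ae_restrict_of_ae_restrict_of_subset (SphFrac.seg_height_subset a x) hae
    filter_upwards [h] with y hy
    rw [SphFrac.fracIntegrand, SphFrac.fracIntegrand, hy]
  have hfrac : SphFrac.sphFrac α a φ = SphFrac.sphFrac α a φ₁ := by
    funext x
    rw [SphFrac.sphFrac, SphFrac.sphFrac, integral_congr_ae (hseg x)]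
  have hφp : MemLp (fun x => ((1 - SphFrac.height x) ^ ν : ℝ) • φ₁ x) p
      (SphFrac.capMeasure n a) := by
    refine hφ.ae_eq ?_
    filter_upwards [hae] with x hx
    rw [hx]
  obtain ⟨h1, h2, h3, h4⟩ := SphFrac.inversion_of_measurable hn0 hα hl ha ha' hp ν hφ₁ hφp
  rw [hfrac]
  refine ⟨?_, h2, h3, ?_⟩
  · filter_upwards [h1] with x hx using hx.congr (hseg x)
  · filter_upwards [h4, hae] with x hx hx1
    rwa [hx1]
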